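/- **Definitions.** An almost CR structure on a real manifold $M$ is a subbundle $H\subset TM$ with a bundle automorphism $J\colon H\to H$, $J^2=-\mathrm{id}$; it is smooth (resp. real-analytic) if $M$, $H$ and $J$ are. It is of hypersurface type if $H$ has corank $1$; its CR dimension is $\dim_{\mathbb C}H_p$. Let $H^{1,0}\subset\mathbb C\otimes H$ be the $i$-eigenbundle of $J$, and for $p\in M$ define $\mathcal L_p,\mathcal N^w_p\colon H^{1,0}_p\times H^{1,0}_p\to(\mathbb C\otimes T_pM)/(\mathbb C\otimes H_p)$ by $$\mathcal L_p(X_p,Y_p)=\tfrac1{2i}[\bar X,Y]_p \bmod \mathbb C\otimes H_p,\qquad \mathcal N^w_p(X_p,Y_p)=[X,Y]_p \bmod \mathbb C\otimes H_p$$ for smooth local sections $X,Y$ of $H^{1,0}$ (the Levi form, which is conjugate-linear in the first argument, and the transversal component of the non-integrability tensor). The structure is strongly nondegenerate if for every $p\in M$ and $\xi\in H^{1,0}_p$ each of the two conditions $$\mathcal L_p(\xi,\eta)=0\ \ \forall \eta\in H^{1,0}_p\qquad\text{and}\qquad 6i\,\mathcal L_p(\xi,\eta)+\mathcal N^w_p(\xi,\eta)=0\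 \ \forall\eta\in H^{1,0}_p$$ implies $\xi=0$. A CR-diffeomorphism is a diffeomorphism $f$ with $df(H)=H'$ and $df\circ J=J'\circ df$ on $H$. For manifolds $M,M'$ of the same dimension, $G^k(M,M')$ is the manifold of all $k$-jets of invertible smooth maps from $M$ to $M'$, $G^k_p(M,M')$ is the set of those with source $p$, and $j^k_pf$ is the $k$-jet of $f$ at $p$. **Theorem.** Let $M$ and $M'$ be smooth (resp. real-analytic) strongly nondegenerate hypersurface-type almost CR manifolds of the same dimension and of positive CR dimension. Then for every $p_0\in M$ and every $\Lambda_0\in G^2_{p_0}(M,M')$ there exist an open neighborhood $\Omega$ of $\Lambda_0$ in $G^2(M,M')$ and a smooth (resp. real-analytic) map $\Phi\colon\Omega\to G^3(M,M')$ such that every smooth CR-diffeomorphism $f$ between open pieces of $M$ and $M'$ satisfies the complete differential system $$j^3_pf=\Phi(j^2_pf)$$ whenever $p\in M$ is in the domain of definition of $f$ and $j^2_pf\in\Omega$. -/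

import Mathlib

open scoped Manifold ContDiff TensorProduct Topology

noncomputable section

/-! ### Jets of invertible maps -/

section Jets

variable {m : ℕ} {M M' : Type*}
  [TopologicalSpace M] [ChartedSpace (EuclideanSpace ℝ (Fin m)) M]
  [TopologicalSpace M'] [ChartedSpace (EuclideanSpace ℝ (Fin m)) M']

/-- The coordinates in which `k`-jets of maps between `m`-dimensional manifolds are written: the
coordinates of the source point, and the derivatives of order `0, …, k` of the map (the derivative
of order `0` gives the coordinates of the target point). -/
abbrev JetCoord (m k : ℕ) : Type :=
  EuclideanSpace ℝ (Fin m) ×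
    ((i : Fin (k + 1)) → EuclideanSpace ℝ (Fin m) [×(i : ℕ)]→L[ℝ] EuclideanSpace ℝ (Fin m))

/-- The coordinates, in a chart `e` of `M` and a chart `e'` of `M'`, of the `k`-jet at `p` of a map
`f : M → M'`. -/
def taylorCoord (k : ℕ) (e : OpenPartialHomeomorph M (EuclideanSpace ℝ (Fin m)))
    (e' : OpenPartialHomeomorph M' (EuclideanSpace ℝ (Fin m))) (p : M) (f : M → M') :
    JetCoord m k :=
  (e p, fun i => iteratedFDeriv ℝ (i : ℕ) (e' ∘ f ∘ e.symm) (e p))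

variable (m M M') in
/-- A point `p` of `M` together with a map that is a smooth local diffeomorphism at `p`. -/
structure PointedLocalDiffeo where
  point : M
  toFun : M → M'
  isLocalDiffeomorphAt : IsLocalDiffeomorphAt (𝓡 m) (𝓡 m) ∞ toFun point

variable (m M M') in
/-- Two invertible maps have the same `k`-jet if they have the same source point, the same target
point, and the same derivatives of order at most `k` there, in all local coordinates. -/
def jetSetoid (k : ℕ) : Setoid (PointedLocalDiffeo m M M') where
  r a b := a.point = b.point ∧ a.toFun a.point = b.toFun b.point ∧
    ∀ e ∈ atlas (EuclideanSpace ℝ (Fin m)) M, ∀ e' ∈ atlas (EuclideanSpace ℝ (Fin m)) M',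
      a.point ∈ e.source → a.toFun a.point ∈ e'.source →
        taylorCoord k e e' a.point a.toFun = taylorCoord k e e' b.point b.toFun
  iseqv :=
    { refl := fun _ => ⟨rfl, rfl, fun _ _ _ _ _ _ => rfl⟩
      symm := fun h => ⟨h.1.symm, h.2.1.symm, fun e he e' he' hp hq =>
        (h.2.2 e he e' he' (h.1 ▸ hp) (h.2.1 ▸ hq)).symm⟩
      trans := fun h g => ⟨h.1.trans g.1, h.2.1.trans g.2.1, fun e he e' he' hp hq =>
        (h.2.2 e he e' he' hp hq).trans (g.2.2 e he e' he' (h.1 ▸ hp) (h.2.1 ▸ hq))⟩ }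

variable (m M M') in
/-- The space `G^k(M, M')` of `k`-jets of invertible maps between the `m`-dimensional manifolds
`M` and `M'`. -/
def InvJet (k : ℕ) : Type _ := Quotient (jetSetoid m M M' k)

namespace InvJet

variable {k l : ℕ}

/-- The source of a jet. -/
def source (Λ : InvJet m M M' k) : M :=
  Quotient.lift (fun a => a.point) (fun a b (h : jetSetoid m M M' k a b) => h.1) Λ

/-- The target of a jet. -/
def target (Λ : InvJet m M M' k) : M' :=
  Quotient.lift (fun a => a.toFun a.point) (fun a b (h : jetSetoid m M M' k a b) => h.2.1) Λ

/-- The domain of the coordinates on the jet space given by a chart of `M` and a chart of `M'`. -/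
def coordDomain (k : ℕ) (e : OpenPartialHomeomorph M (EuclideanSpace ℝ (Fin m)))
    (e' : OpenPartialHomeomorph M' (EuclideanSpace ℝ (Fin m))) : Set (InvJet m M M' k) :=
  {Λ | Λ.source ∈ e.source ∧ Λ.target ∈ e'.source}

/-- The coordinates on the jet space given by a chart `e` of `M` and a chart `e'` of `M'`. They are
meaningful on `coordDomain k e e'`, for `e` and `e'` in the atlases, where they do not depend on the
representative (`coord_mk`). The image of this domain is open in the linear space of all those
elements of `JetCoord m k` whose multilinear components are symmetric. -/
def coord (e : OpenPartialHomeomorph M (EuclideanSpace ℝ (Fin m)))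
    (e' : OpenPartialHomeomorph M' (EuclideanSpace ℝ (Fin m))) (Λ : InvJet m M M' k) :
    JetCoord m k :=
  taylorCoord k e e' (Quotient.out Λ).point (Quotient.out Λ).toFun

theorem coord_mk (e : OpenPartialHomeomorph M (EuclideanSpace ℝ (Fin m)))
    (he : e ∈ atlas (EuclideanSpace ℝ (Fin m)) M)
    (e' : OpenPartialHomeomorph M' (EuclideanSpace ℝ (Fin m)))
    (he' : e' ∈ atlas (EuclideanSpace ℝ (Fin m)) M') (a : PointedLocalDiffeo m M M')
    (hp : a.point ∈ e.source) (hq : a.toFun a.point ∈ e'.source) :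
    coord e e' (Quotient.mk (jetSetoid m M M' k) a : InvJet m M M' k) =
      taylorCoord k e e' a.point a.toFun := by
  have h : jetSetoid m M M' k a (Quotient.out (Quotient.mk (jetSetoid m M M' k) a)) :=
    (jetSetoid m M M' k).symm (Quotient.exact (Quotient.out_eq _))
  exact (h.2.2 e he e' he' hp hq).symm

/-- The manifold topology of the jet space: the one generated by the sets that are open in the
coordinates given by charts of `M` and `M'`. -/
instance (k : ℕ) : TopologicalSpace (InvJet m M M' k) :=
  TopologicalSpace.generateFrom
    {S | ∃ e ∈ atlas (EuclideanSpace ℝ (Fin m)) M, ∃ e' ∈ atlas (EuclideanSpace ℝ (Fin m)) M',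
      ∃ V : Set (JetCoord m k), IsOpen V ∧ S = coordDomain k e e' ∩ coord e e' ⁻¹' V}

/-- `Φ : Ω → G^l(M, M')` is a `C^n` map on the set `Ω ⊆ G^k(M, M')` (smooth for `n = ∞`,
real-analytic for `n = ω`): near every point of `Ω` it is given, in suitable coordinates of the two
jet spaces, by (the restriction of) a `C^n` function `F`. -/
def ContDiffMapOn (n : WithTop ℕ∞) (Φ : InvJet m M M' k → InvJet m M M' l)
    (Ω : Set (InvJet m M M' k)) : Prop :=
  ∀ Λ ∈ Ω,
    ∃ e ∈ atlas (EuclideanSpace ℝ (Fin m)) M, ∃ e' ∈ atlas (EuclideanSpace ℝ (Fin m)) M',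
    ∃ d ∈ atlas (EuclideanSpace ℝ (Fin m)) M, ∃ d' ∈ atlas (EuclideanSpace ℝ (Fin m)) M',
    ∃ (W : Set (JetCoord m k)) (F : JetCoord m k → JetCoord m l),
      Λ ∈ coordDomain k e e' ∧ IsOpen W ∧ coord e e' Λ ∈ W ∧ ContDiffOn ℝ n F W ∧
      ∀ Λ' ∈ Ω, Λ' ∈ coordDomain k e e' → coord e e' Λ' ∈ W →
        Φ Λ' ∈ coordDomain l d d' ∧ coord d d' (Φ Λ') = F (coord e e' Λ')

end InvJet

/-- The `k`-jet `j^k_p f` at `p` of a smooth diffeomorphism `f` between open pieces of `M` and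
`M'`. -/
def PartialDiffeomorph.jet (k : ℕ) (f : PartialDiffeomorph (𝓡 m) (𝓡 m) M M' ∞) (p : M)
    (hp : p ∈ f.source) : InvJet m M M' k :=
  Quotient.mk (jetSetoid m M M' k) ⟨p, f, f.isLocalDiffeomorphAt _ _ _ hp⟩

end Jets

/-! ### Almost CR structures -/

/-- An almost CR structure of class `C^n` on a manifold `M`: a subbundle `H` of the tangent bundle
and a bundle automorphism `J` of `H` with `J² = -id`, both of class `C^n`. -/
structure AlmostCRStructure (m : ℕ) (n : WithTop ℕ∞) (M : Type*) [TopologicalSpace M]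
    [ChartedSpace (EuclideanSpace ℝ (Fin m)) M] [IsManifold (𝓡 m) ∞ M] where
  H : ∀ p : M, Submodule ℝ (TangentSpace (𝓡 m) p)
  J : ∀ p : M, H p →ₗ[ℝ] H p
  J_J : ∀ p (v : H p), J p (J p v) = -v
  /-- `H` has local frames of class `C^n`. -/
  exists_frame : ∀ p : M, ∃ U : Set M, IsOpen U ∧ p ∈ U ∧
    ∃ (r : ℕ) (X : Fin r → ∀ q : M, TangentSpace (𝓡 m) q),
      (∀ j, ContMDiffOn (𝓡 m) (𝓡 m).tangent n
        (fun q => (⟨q, X j q⟩ : TangentBundle (𝓡 m) M)) U) ∧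
      ∀ q ∈ U, LinearIndependent ℝ (fun j => X j q) ∧
        Submodule.span ℝ (Set.range fun j => X j q) = H q
  /-- `J` maps local sections of `H` of class `C^n` to local sections of class `C^n`. -/
  contMDiffOn_J : ∀ U : Set M, IsOpen U → ∀ X Y : ∀ q : M, TangentSpace (𝓡 m) q,
    (∀ q ∈ U, ∃ h : X q ∈ H q, Y q = J q ⟨X q, h⟩) →
    ContMDiffOn (𝓡 m) (𝓡 m).tangent n (fun q => (⟨q, X q⟩ : TangentBundle (𝓡 m) M)) U →
    ContMDiffOn (𝓡 m) (𝓡 m).tangent n (fun q => (⟨q, Y q⟩ : TangentBundle (𝓡 m) M)) U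

section ComplexVectorFields

variable (m : ℕ) (M : Type*) [TopologicalSpace M] [ChartedSpace (EuclideanSpace ℝ (Fin m)) M]

/-- A complex vector field `re + i im`, i.e. a section of `ℂ ⊗ TM`, given by its real and imaginary
parts. -/
structure ComplexVectorField where
  re : ∀ q : M, TangentSpace (𝓡 m) q
  im : ∀ q : M, TangentSpace (𝓡 m) q

variable {m M}

namespace ComplexVectorField

/-- The value of a complex vector field at a point. -/
def eval (X : ComplexVectorField m M) (q : M) : ℂ ⊗[ℝ] TangentSpace (𝓡 m) q :=
  (1 : ℂ) ⊗ₜ[ℝ] X.re q + Complex.I ⊗ₜ[ℝ] X.im q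

/-- The conjugate vector field. -/
def conj (X : ComplexVectorField m M) : ComplexVectorField m M :=
  ⟨X.re, fun q => -X.im q⟩

/-- The complex-bilinear extension of the Lie bracket of vector fields. -/
def bracket (X Y : ComplexVectorField m M) : ComplexVectorField m M where
  re q := VectorField.mlieBracket (𝓡 m) X.re Y.re q - VectorField.mlieBracket (𝓡 m) X.im Y.im q
  im q := VectorField.mlieBracket (𝓡 m) X.re Y.im q + VectorField.mlieBracket (𝓡 m) X.im Y.re q

/-- The complex vector field `X` is smooth near `p`. -/
def SmoothNear [IsManifold (𝓡 m) ∞ M] (X : ComplexVectorField m M) (p : M) : Prop :=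
  ∀ᶠ q in 𝓝 p,
    ContMDiffAt (𝓡 m) (𝓡 m).tangent ∞ (fun x => (⟨x, X.re x⟩ : TangentBundle (𝓡 m) M)) q ∧
    ContMDiffAt (𝓡 m) (𝓡 m).tangent ∞ (fun x => (⟨x, X.im x⟩ : TangentBundle (𝓡 m) M)) q

end ComplexVectorField

end ComplexVectorFields

namespace AlmostCRStructure

variable {m : ℕ} {n : WithTop ℕ∞} {M : Type*} [TopologicalSpace M]
  [ChartedSpace (EuclideanSpace ℝ (Fin m)) M] [IsManifold (𝓡 m) ∞ M]
  (S : AlmostCRStructure m n M)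

/-- Hypersurface type: `H` has corank `1` in the tangent bundle. -/
def IsHypersurfaceType : Prop := ∀ p : M, Module.finrank ℝ (S.H p) + 1 = m

/-- The complexification `ℂ ⊗ H_p`, as a subspace of `ℂ ⊗ T_pM`. -/
def complexH (p : M) : Submodule ℂ (ℂ ⊗[ℝ] TangentSpace (𝓡 m) p) :=
  (S.H p).baseChange ℂ

/-- `H^{1,0}_p ⊆ ℂ ⊗ T_pM`, the `i`-eigenspace of `J` in `ℂ ⊗ H_p`. -/
def H10 (p : M) : Submodule ℂ (ℂ ⊗[ℝ] TangentSpace (𝓡 m) p) :=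
  (Module.End.eigenspace ((S.J p).baseChange ℂ) Complex.I).map ((S.H p).subtype.baseChange ℂ)

/-- `X` is a smooth section of `H^{1,0}` near `p`. -/
def IsSection10Near (X : ComplexVectorField m M) (p : M) : Prop :=
  X.SmoothNear p ∧ ∀ᶠ q in 𝓝 p, X.eval q ∈ S.H10 q

open Classical in
/-- A smooth local section of `H^{1,0}` whose value at `p` is the given vector `ξ ∈ H^{1,0}_p`. The
tensors below do not depend on which section is taken. -/
def extend (p : M) (ξ : S.H10 p) : ComplexVectorField m M :=
  if h : ∃ X : ComplexVectorField m M, S.IsSection10Near X p ∧ X.eval p = ξ then h.choose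
  else ⟨fun _ => 0, fun _ => 0⟩

/-- The Levi form `ℒ_p : H^{1,0}_p × H^{1,0}_p → ℂT_p / ℂH_p`,
`ℒ_p(X_p, Y_p) = (1 / 2i) [X̄, Y]_p mod ℂH_p` for smooth sections `X`, `Y` of `H^{1,0}`. -/
def leviForm (p : M) (ξ η : S.H10 p) : (ℂ ⊗[ℝ] TangentSpace (𝓡 m) p) ⧸ S.complexH p :=
  (1 / (2 * Complex.I)) •
    (S.complexH p).mkQ ((((S.extend p ξ).conj).bracket (S.extend p η)).eval p)

/-- The transversal component `𝒩^w_p : H^{1,0}_p × H^{1,0}_p → ℂT_p / ℂH_p` of the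
non-integrability tensor, `𝒩^w_p(X_p, Y_p) = [X, Y]_p mod ℂH_p` for smooth sections `X`, `Y` of
`H^{1,0}`. -/
def transversalNonintegrability (p : M) (ξ η : S.H10 p) :
    (ℂ ⊗[ℝ] TangentSpace (𝓡 m) p) ⧸ S.complexH p :=
  (S.complexH p).mkQ (((S.extend p ξ).bracket (S.extend p η)).eval p)

/-- Strong nondegeneracy: at every point the Levi form `ℒ` is nondegenerate, and so is the
combination `6iℒ + 𝒩^w`. -/
def IsStronglyNondegenerate : Prop :=
  ∀ p : M,
    (∀ ξ : S.H10 p, (∀ η : S.H10 p, S.leviForm p ξ η = 0) → ξ = 0) ∧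
    (∀ ξ : S.H10 p,
      (∀ η : S.H10 p,
        (6 * Complex.I) • S.leviForm p ξ η + S.transversalNonintegrability p ξ η = 0) → ξ = 0)

end AlmostCRStructure

/-- `f` is a smooth CR-diffeomorphism between open pieces of `M` and `M'`: its differential maps
`H` onto `H'` and intertwines `J` and `J'`. -/
def IsCRDiffeo {m : ℕ} {n : WithTop ℕ∞} {M M' : Type*}
    [TopologicalSpace M] [ChartedSpace (EuclideanSpace ℝ (Fin m)) M] [IsManifold (𝓡 m) ∞ M]
    [TopologicalSpace M'] [ChartedSpace (EuclideanSpace ℝ (Fin m)) M'] [IsManifold (𝓡 m) ∞ M']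
    (S : AlmostCRStructure m n M) (S' : AlmostCRStructure m n M')
    (f : PartialDiffeomorph (𝓡 m) (𝓡 m) M M' ∞) : Prop :=
  ∀ p ∈ f.source,
    (∀ w : TangentSpace (𝓡 m) (f p),
      w ∈ S'.H (f p) ↔ ∃ v ∈ S.H p, mfderiv (𝓡 m) (𝓡 m) f p v = w) ∧
    ∀ (v : S.H p) (w : S'.H (f p)), mfderiv (𝓡 m) (𝓡 m) f p v = w →
      mfderiv (𝓡 m) (𝓡 m) f p (S.J p v) = S'.J (f p) w

end

/-! Near `p₀` and the target of `Λ₀` choose complex frames `T, Z_α, Z̄_α` with the `Z_α` spanning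
`H^{1,0}`. For a CR map `f` one has `df Z_α = a_α^β Z'_β` and `df T = u T' + c^γ Z'_γ + c̄^γ Z̄'_γ`,
so the 1-jet of `f` is the point, its image and `(a, u, c)`. Comparing brackets upstairs and
downstairs gives structure equations, first-order relations among `a, u, c` with coefficients
depending on `p` and `f(p)` only. Put `r = T u`. The claim is that every first derivative of `a, u,
c, r` is again a function of `p, f(p), a, u, c, r`; as `r` is of second order in `f`, all third
derivatives of `f` then become functions of its 2-jet.

The closure (`CRTower.D_Sh_mem`) is proved by solving linear systems that are injective at one base
point, where the target frame is normalised so that `a = 1`, `u = 1`. The structure equations give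
`Z̄a` and `Zu` as affine functions of `c`, and the Levi identity `K u = a ā K'`, differentiated
along `Z`, gives `Za` (`exists_D_a`). Applying `[Z_α, Z̄_β] = K_{αβ̄} T + …` to `a` yields linear
equations for `Ta` and `Tā`; with the `T`-derivative of the Levi identity they determine both as
multiples of `r`, with `Ta ≈ r/2` at the base point (`exists_D_none_a`). The derivative of `c` along
`Z` is, up to known terms, `Ta`. Applying `[Z̄, T]` to `a` gives a linear system for `Tc`
(`D_none_c_mem`), and then `Z r` and, through `[Z, T]c`, also `T r` are known (`D_none_r_mem`).

To obtain one function `Φ` for all `f` at once, the computation takes place in an algebra of germs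
of functions of a pair (map, point) along the filter of adapted maps with 2-jet near `Λ₀`. A germ
lies in `functionsOf r Y y₀` if it is a single `C^r` function of the `Y j`, so membership of the
third derivatives in the algebra generated by the 2-jet is exactly the complete system
(`exists_third_derivative_eq`). Evaluation at the base point is the limit along the filter, and
functions nonzero there are invertible.

The rest is translation. Levi nondegeneracy becomes nonvanishing of the determinant of structure
functions (`det_structFun_ne_zero`), CR maps become maps with block triangular differential
(`isAdaptedNear_of_isCRDiffeo`), and the function of the 2-jet becomes a map into `G^3` after
symmetrization, since only symmetric third derivatives belong to jets
(`InvJet.exists_coord_eq_jetProlong`). -/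

section

open Filter

set_option linter.unusedSimpArgs false
set_option linter.unusedSectionVars false

noncomputable section

/-! ### The algebra of moving frames adapted to almost CR structures -/

/-- Indices of a complex frame `T, Z_α, Z̄_α` adapted to a hypersurface-type almost CR structure:
`none` stands for `T`, `some (false, α)` for `Z_α` and `some (true, α)` for `Z̄_α`. -/
abbrev FrameIdx (n : ℕ) : Type := Option (Bool × Fin n)

/-- Splitting off an arbitrary type `p` first lets each identity be proved once, for the `Z` and for
their conjugates. -/
theorem sum_frameIdx {n : ℕ} {N : Type*} [AddCommMonoid N] (p : Bool) (F : FrameIdx n → N) :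
    ∑ i, F i = F none + (∑ α, F (some (p, α)) + ∑ α, F (some (!p, α))) := by
  rw [Fintype.sum_option, Fintype.sum_prod_type]
  congr 1
  cases p <;> simp [add_comm]

theorem sum_bool {N : Type*} [AddCommMonoid N] (p : Bool) (f : Bool → N) :
    ∑ q, f q = f p + f (!p) := by
  cases p <;> simp [add_comm]

/-- The differential algebra of a CR diffeomorphism expressed in adapted complex frames. Here `R` is
a ring of functions, `D i` are the derivations along the frame, `C` and `C'` the structure functions
of the source and target frames, `A` is the matrix of the differential of the map in the frames, and
`Sa ⊆ S1 ⊆ Sh` are the subalgebras of functions of the point, its image and, respectively, of the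
diagonal blocks of `A`, of all of `A`, and of `A` together with `D none (A none none)`. Finally `ev`
is the evaluation at a base point. -/
structure CRTower (n : ℕ) (R : Type*) [CommRing R] [Algebra ℂ R] where
  D : FrameIdx n → Derivation ℂ R R
  C : FrameIdx n → FrameIdx n → FrameIdx n → R
  C' : FrameIdx n → FrameIdx n → FrameIdx n → R
  A : FrameIdx n → FrameIdx n → R
  commutator : ∀ i j g, D i (D j g) - D j (D i g) = ∑ k, C i j k * D k g
  structure_eq : ∀ i j s, D i (A j s) - D j (A i s) =
    ∑ k, C i j k * A k s - ∑ k, ∑ l, A i k * A j l * C' k l s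
  C_antisymm : ∀ i j k, C i j k = -C j i k
  C'_antisymm : ∀ i j k, C' i j k = -C' j i k
  block_none : ∀ p α, A (some (p, α)) none = 0
  block_not : ∀ p α β, A (some (p, α)) (some (!p, β)) = 0
  Sa : Subalgebra ℂ R
  S1 : Subalgebra ℂ R
  Sh : Subalgebra ℂ R
  Sa_le : Sa ≤ S1
  S1_le : S1 ≤ Sh
  C_mem : ∀ i j k, C i j k ∈ Sa
  C'_mem : ∀ i j k, C' i j k ∈ Sa
  D_C_mem : ∀ p α i j k, D (some (p, α)) (C i j k) ∈ Sa
  D_C'_mem : ∀ p α i j k, D (some (p, α)) (C' i j k) ∈ Sa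
  D_none_C_mem : ∀ i j k, D none (C i j k) ∈ S1
  D_none_C'_mem : ∀ i j k, D none (C' i j k) ∈ S1
  a_mem : ∀ p α β, A (some (p, α)) (some (p, β)) ∈ Sa
  u_mem : A none none ∈ Sa
  c_mem : ∀ p γ, A none (some (p, γ)) ∈ S1
  r_mem : D none (A none none) ∈ Sh
  chain_some : ∀ p α (S : Subalgebra ℂ R), Sa ≤ S →
    (∀ q β γ, D (some (p, α)) (A (some (q, β)) (some (q, γ))) ∈ S) →
    D (some (p, α)) (A none none) ∈ S → ∀ s ∈ Sa, D (some (p, α)) s ∈ S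
  chain_none : ∀ S : Subalgebra ℂ R, S1 ≤ S →
    (∀ q β γ, D none (A (some (q, β)) (some (q, γ))) ∈ S) →
    D none (A none none) ∈ S → ∀ s ∈ Sa, D none s ∈ S
  chain_one : ∀ i (S : Subalgebra ℂ R), S1 ≤ S → (∀ s ∈ Sa, D i s ∈ S) →
    (∀ p γ, D i (A none (some (p, γ))) ∈ S) → ∀ s ∈ S1, D i s ∈ S
  chain_h : ∀ i (S : Subalgebra ℂ R), Sh ≤ S → (∀ s ∈ S1, D i s ∈ S) →
    D i (D none (A none none)) ∈ S → ∀ s ∈ Sh, D i s ∈ S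
  ev : Sa →ₐ[ℂ] ℂ
  isUnit_of_ev : ∀ s : Sa, ev s ≠ 0 → IsUnit s
  ev_a : ∀ p α β, ev ⟨_, a_mem p α β⟩ = if α = β then 1 else 0
  ev_u : ev ⟨_, u_mem⟩ = 1
  levi_nondegenerate :
    (Matrix.of fun α β => ev ⟨_, C_mem (some (false, α)) (some (true, β)) none⟩).det ≠ 0

/-! ### Components of the differential, the Levi identity, and linear algebra over `Sa` -/

namespace CRTower

variable {n : ℕ} {R : Type*} [CommRing R] [Algebra ℂ R] (F : CRTower n R)

/-- In the notation of frames, `df Z_α = a_α^β Z'_β` and `df T = u T' + c^γ Z'_γ + c̄^γ Z̄'_γ`. -/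
def a (p : Bool) (α β : Fin n) : F.Sa := ⟨_, F.a_mem p α β⟩

def u : F.Sa := ⟨_, F.u_mem⟩

def c (p : Bool) (γ : Fin n) : R := F.A none (some (p, γ))

/-- Up to a constant factor this is the Levi form of the source in the frame; `K'` is that of the
target, and `N'` is the transversal part of the target's non-integrability tensor. -/
def K (p : Bool) (α β : Fin n) : F.Sa := ⟨_, F.C_mem (some (p, α)) (some (!p, β)) none⟩

def K' (p : Bool) (α β : Fin n) : F.Sa := ⟨_, F.C'_mem (some (p, α)) (some (!p, β)) none⟩

def N' (p : Bool) (α β : Fin n) : F.Sa := ⟨_, F.C'_mem (some (p, α)) (some (p, β)) none⟩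

theorem A_none_none : F.A none none = F.u := rfl
theorem A_none_some (p : Bool) (γ : Fin n) : F.A none (some (p, γ)) = F.c p γ := rfl
theorem A_diag (p : Bool) (α β : Fin n) : F.A (some (p, α)) (some (p, β)) = F.a p α β := rfl

theorem block_not' (p : Bool) (α β : Fin n) : F.A (some (!p, α)) (some (p, β)) = 0 := by
  simpa using F.block_not (!p) α β

theorem ev_a' (p : Bool) (α β : Fin n) : F.ev (F.a p α β) = if α = β then 1 else 0 :=
  F.ev_a p α β

theorem ev_u' : F.ev F.u = 1 := F.ev_u

theorem K_not (p : Bool) (α β : Fin n) : F.K (!p) α β = -F.K p β α := by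
  ext
  simpa [K] using F.C_antisymm (some (!p, α)) (some (p, β)) none

theorem N'_antisymm (p : Bool) (α β : Fin n) : F.N' p α β = -F.N' p β α := by
  ext
  simpa [N'] using F.C'_antisymm (some (p, α)) (some (p, β)) none

/-- Matrices over `Sa` that are injective at the base point have a left inverse over `Sa`. -/
theorem exists_left_inverse {ι κ : Type*} [Fintype ι] [Fintype κ] [DecidableEq ι] [DecidableEq κ]
    (P : Matrix ι κ F.Sa) (hP : ∀ x : κ → ℂ, (P.map F.ev).mulVec x = 0 → x = 0) :
    ∃ L : Matrix κ ι F.Sa, L * P = 1 := by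
  have hinj : Function.Injective (Matrix.toLin' (P.map F.ev)) :=
    (injective_iff_map_eq_zero _).2 fun x hx => hP x (by simpa using hx)
  obtain ⟨g, hg⟩ := LinearMap.exists_leftInverse_of_injective _ (LinearMap.ker_eq_bot.2 hinj)
  have hL₀ : LinearMap.toMatrix' g * P.map F.ev = 1 := by
    have := congrArg LinearMap.toMatrix' hg
    rwa [LinearMap.toMatrix'_comp, LinearMap.toMatrix'_toLin', LinearMap.toMatrix'_id] at this
  -- A left inverse over `ℂ` at the base point, taken as a constant matrix. Then `L₀ * P` evaluates
  -- to `1`, so its determinant is a unit of `Sa`.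
  set L₀ : Matrix κ ι F.Sa := (LinearMap.toMatrix' g).map (algebraMap ℂ F.Sa) with hL₀_def
  have hev : (L₀ * P).map F.ev = 1 := by
    rw [← hL₀]
    ext i j
    simp [Matrix.mul_apply, hL₀_def]
  have hdet : IsUnit (L₀ * P).det := by
    apply F.isUnit_of_ev
    have h := AlgHom.map_det F.ev (L₀ * P)
    rw [h, AlgHom.mapMatrix_apply, hev, Matrix.det_one]
    exact one_ne_zero
  exact ⟨(L₀ * P)⁻¹ * L₀, by rw [Matrix.mul_assoc, Matrix.nonsing_inv_mul _ hdet]⟩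

/-- In the `T'`-component of the structure equation for `(Z_α, Z̄_β)` the derivatives drop out,
because images of horizontal vectors have no `T'`-component. What is left is the equivariance of the
Levi form. -/
theorem levi_eq (p : Bool) (α β : Fin n) :
    F.K p α β * F.u = ∑ γ, ∑ δ, F.a p α γ * F.a (!p) β δ * F.K' p γ δ := by
  have h := F.structure_eq (some (p, α)) (some (!p, β)) none
  simp only [sum_frameIdx p, block_none, block_not, block_not', map_zero, A_diag, mul_zero,
    zero_mul, Finset.sum_const_zero, add_zero, zero_add, A_none_none, sub_zero] at h
  ext
  push_cast
  rw [eq_comm, ← sub_eq_zero, ← neg_eq_zero, neg_sub]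
  exact h.symm

/-- `Z̄_β` has no `Z'`-component in its image, so only one derivative survives in this component of
the structure equation; `c` enters through the `T`-part of `[Z_α, Z̄_β]`. -/
theorem exists_D_not_a (p : Bool) (α β γ : Fin n) : ∃ B : F.Sa,
    F.D (some (!p, β)) (F.a p α γ : R) = -(F.K p α β * F.c p γ) + B := by
  have h := F.structure_eq (some (p, α)) (some (!p, β)) (some (p, γ))
  simp only [sum_frameIdx p, block_none, block_not, block_not', map_zero, A_diag, mul_zero,
    zero_mul, Finset.sum_const_zero, add_zero, zero_add, A_none_some, zero_sub] at h
  refine ⟨-(∑ δ, ⟨_, F.C_mem (some (p, α)) (some (!p, β)) (some (p, δ))⟩ * F.a p δ γ) +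
    ∑ δ, ∑ ε, F.a p α δ * F.a (!p) β ε * ⟨_, F.C'_mem (some (p, δ)) (some (!p, ε)) (some (p, γ))⟩,
    ?_⟩
  push_cast
  have hK : (F.K p α β : R) = F.C (some (p, α)) (some (!p, β)) none := rfl
  rw [hK]
  linear_combination -h

/-- The `T'`-component of the structure equation for `(T, Z_α)`, in which `T` of the vanishing entry
of `Z_α` disappears. -/
theorem exists_D_u (p : Bool) (α : Fin n) : ∃ B : F.Sa,
    F.D (some (p, α)) (F.u : R) = ∑ γ, ∑ δ, F.a p α δ *
      (F.c p γ * F.N' p γ δ + F.c (!p) γ * F.K' (!p) γ δ) + B := by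
  have h := F.structure_eq none (some (p, α)) none
  simp only [sum_frameIdx p, block_none, block_not, map_zero, A_diag, mul_zero,
    zero_mul, Finset.sum_const_zero, add_zero, zero_add, A_none_some, A_none_none, zero_sub] at h
  refine ⟨-(⟨_, F.C_mem none (some (p, α)) none⟩ * F.u) +
    ∑ δ, F.u * F.a p α δ * ⟨_, F.C'_mem none (some (p, δ)) none⟩, ?_⟩
  have hN : ∀ γ δ, (F.N' p γ δ : R) = F.C' (some (p, γ)) (some (p, δ)) none := fun _ _ => rfl
  have hK : ∀ γ δ, (F.K' (!p) γ δ : R) = F.C' (some (!p, γ)) (some (p, δ)) none := fun γ δ => by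
    simp [K']
  push_cast
  simp only [hN, hK, mul_add, Finset.sum_add_distrib]
  have e1 : ∑ γ, ∑ δ, (F.a p α δ : R) * (F.c p γ * F.C' (some (p, γ)) (some (p, δ)) none) =
      ∑ γ, ∑ δ, F.c p γ * F.a p α δ * F.C' (some (p, γ)) (some (p, δ)) none := by
    refine Finset.sum_congr rfl fun _ _ => Finset.sum_congr rfl fun _ _ => by ring
  have e2 : ∑ γ, ∑ δ, (F.a p α δ : R) * (F.c (!p) γ * F.C' (some (!p, γ)) (some (p, δ)) none) =
      ∑ γ, ∑ δ, F.c (!p) γ * F.a p α δ * F.C' (some (!p, γ)) (some (p, δ)) none := by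
    refine Finset.sum_congr rfl fun _ _ => Finset.sum_congr rfl fun _ _ => by ring
  rw [e1, e2]
  linear_combination -h

theorem c_mem' (p : Bool) (γ : Fin n) : F.c p γ ∈ F.S1 := F.c_mem p γ

theorem A_mem (i j : FrameIdx n) : F.A i j ∈ F.S1 := by
  rcases i with _ | ⟨p, α⟩ <;> rcases j with _ | ⟨q, β⟩
  · exact F.Sa_le F.u_mem
  · exact F.c_mem _ _
  · rw [block_none]; exact zero_mem _
  · by_cases h : q = p
    · subst h; exact F.Sa_le (F.a_mem _ _ _)
    · obtain rfl : q = !p := by cases p <;> cases q <;> simp_all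
      rw [block_not]; exact zero_mem _

theorem D_sub_D_mem (i j s : FrameIdx n) : F.D i (F.A j s) - F.D j (F.A i s) ∈ F.S1 := by
  rw [F.structure_eq]
  refine sub_mem (sum_mem fun k _ => mul_mem (F.Sa_le (F.C_mem _ _ _)) (F.A_mem _ _))
    (sum_mem fun k _ => sum_mem fun l _ => mul_mem (mul_mem (F.A_mem _ _) (F.A_mem _ _))
      (F.Sa_le (F.C'_mem _ _ _)))

/-- Structure equation for `(Z_α, T)`: modulo functions of the 1-jet, differentiating `c` along
`Z_α` is differentiating `a_α` along `T`. For the opposite type, in `D_not_c`, the corresponding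
entry is zero and the derivative itself is of first order. -/
theorem D_none_a (p : Bool) (α γ : Fin n) :
    F.D (some (p, α)) (F.c p γ) - F.D none (F.a p α γ : R) ∈ F.S1 :=
  F.D_sub_D_mem (some (p, α)) none (some (p, γ))

theorem D_not_c (p : Bool) (α γ : Fin n) : F.D (some (!p, α)) (F.c p γ) ∈ F.S1 := by
  have := F.D_sub_D_mem (some (!p, α)) none (some (p, γ))
  simpa [block_not', A_none_some] using this

/-- The normalisation `a = 1`, `u = 1` at the base point turns the Levi identity into equality of
the two Levi matrices. -/
theorem ev_K' (p : Bool) (α β : Fin n) : F.ev (F.K' p α β) = F.ev (F.K p α β) := by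
  have h := congrArg F.ev (F.levi_eq p α β)
  simp only [map_mul, map_sum, ev_a', ev_u', mul_one, ite_mul, mul_ite, one_mul, zero_mul,
    mul_zero, Finset.sum_ite_eq, Finset.mem_univ, if_true] at h
  exact h.symm

theorem eq_zero_of_sum_K_mul (p : Bool) (x : Fin n → ℂ)
    (hx : ∀ β, ∑ α, F.ev (F.K p α β) * x α = 0) : x = 0 := by
  have hdet := F.levi_nondegenerate
  set k : Matrix (Fin n) (Fin n) ℂ :=
    Matrix.of fun α β => F.ev ⟨_, F.C_mem (some (false, α)) (some (true, β)) none⟩ with hk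
  have hK : ∀ α β, F.ev (F.K false α β) = k α β := fun α β => rfl
  cases p
  · refine Matrix.eq_zero_of_vecMul_eq_zero hdet (funext fun β => ?_)
    simpa [Matrix.vecMul, dotProduct, hK, mul_comm] using hx β
  · refine Matrix.eq_zero_of_mulVec_eq_zero hdet (funext fun β => ?_)
    have hK' : ∀ α β, F.ev (F.K true α β) = -k β α := fun α β => by
      rw [show true = !false from rfl, K_not, map_neg, hK]
    simpa [Matrix.mulVec, dotProduct, hK'] using hx β

theorem eq_zero_of_sum_K_mul' (p : Bool) (x : Fin n → ℂ)
    (hx : ∀ α, ∑ β, F.ev (F.K p α β) * x β = 0) : x = 0 := by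
  refine F.eq_zero_of_sum_K_mul (!p) x fun β => ?_
  simpa [K_not] using hx β

/-- Linear systems with coefficients in `Sa` that are injective at the base point can be solved. -/
theorem exists_solution {ι κ : Type*} [Fintype ι] [Fintype κ] [DecidableEq ι] [DecidableEq κ]
    (P : Matrix ι κ F.Sa) (hP : ∀ x : κ → ℂ, (∀ i, ∑ k, F.ev (P i k) * x k = 0) → x = 0)
    (S : Subalgebra ℂ R) (hS : F.Sa ≤ S) (q : ι → F.Sa) (x : κ → R) (r : R) (x₀ : κ → ℂ)
    (hx : ∀ i, ∑ k, P i k * x k - q i * r ∈ S) (hx₀ : ∀ i, ∑ k, F.ev (P i k) * x₀ k = F.ev (q i)) :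
    ∃ s : κ → F.Sa, (∀ k, F.ev (s k) = x₀ k) ∧ ∀ k, x k - s k * r ∈ S := by
  obtain ⟨L, hL⟩ := F.exists_left_inverse P fun x hx => hP x fun i => by
    simpa [Matrix.mulVec, dotProduct] using congrFun hx i
  have hLP : ∀ k l, ∑ i, L k i * P i l = if k = l then 1 else 0 := fun k l => by
    rw [← Matrix.mul_apply, hL, Matrix.one_apply]
  -- Multiplying the system by the left inverse `L`. The same left inverse at the base point forces
  -- the prescribed value `x₀`.
  refine ⟨fun k => ∑ i, L k i * q i, fun k => ?_, fun k => ?_⟩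
  · have : ∀ l, ∑ i, F.ev (L k i) * F.ev (P i l) = if k = l then 1 else 0 := fun l => by
      have := congrArg F.ev (hLP k l)
      simpa [apply_ite F.ev] using this
    simp only [map_sum, map_mul, ← hx₀, Finset.mul_sum]
    rw [Finset.sum_comm]
    simp only [← mul_assoc, ← Finset.sum_mul, this]
    simp
  · have : ∀ l, ∑ i, (L k i : R) * P i l = if k = l then 1 else 0 := fun l => by
      have := congrArg (Subtype.val) (hLP k l)
      push_cast [apply_ite Subtype.val] at this
      exact this
    have e : x k - ((∑ i, L k i * q i : F.Sa) : R) * r =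
        ∑ i, L k i * (∑ l, P i l * x l - q i * r) := by
      simp only [mul_sub, Finset.sum_sub_distrib, Finset.mul_sum]
      push_cast
      rw [Finset.sum_comm]
      simp only [← mul_assoc, ← Finset.sum_mul, this]
      simp
    rw [e]
    exact sum_mem fun i _ => mul_mem (hS (L k i).2) (hx i)

theorem mem_of_linear_system {ι κ : Type*} [Fintype ι] [Fintype κ] [DecidableEq ι] [DecidableEq κ]
    (P : Matrix ι κ F.Sa) (hP : ∀ x : κ → ℂ, (∀ i, ∑ k, F.ev (P i k) * x k = 0) → x = 0)
    (S : Subalgebra ℂ R) (hS : F.Sa ≤ S) (x : κ → R) (hx : ∀ i, ∑ k, P i k * x k ∈ S) (k : κ) :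
    x k ∈ S := by
  obtain ⟨s, -, hs⟩ := F.exists_solution P hP S hS 0 x 0 0 (by simpa using hx) (by simp)
  simpa using hs k

/-- Differentiate the Levi identity `K u = a ā K'` along `Z_γ`: `Z_γ u` and `Z_γ ā` are already
affine in `c`, and the coefficient `ā K'` of the unknown `Z_γ a` is invertible near the base point.
The values of `Q` there are recorded because they enter the symbol of the system for `T a`. -/
theorem exists_D_a (p : Bool) (γ α : Fin n) : ∃ (P Q : Fin n → Fin n → F.Sa) (B : Fin n → F.Sa),
    (∀ δ, F.D (some (p, γ)) (F.a p α δ : R) =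
      ∑ ε, (P δ ε * F.c p ε + Q δ ε * F.c (!p) ε) + B δ) ∧
    ∀ δ ε, F.ev (Q δ ε) = -(F.ev (F.K p γ ε) * if δ = α then 1 else 0) -
      F.ev (F.K p α ε) * if δ = γ then 1 else 0 := by
  obtain ⟨B₃, hB₃⟩ := F.exists_D_u p γ
  have hB : ∀ β ε, ∃ B : F.Sa, F.D (some (p, γ)) (F.a (!p) β ε : R) =
      F.K p γ β * F.c (!p) ε + B := fun β ε => by
    obtain ⟨B, hB⟩ := F.exists_D_not_a (!p) β γ ε
    exact ⟨B, by simpa [K_not] using hB⟩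
  choose B₂ hB₂ using hB
  -- The coefficient of the unknowns `Z_γ a_α^δ`, equal to the transposed Levi matrix at the base
  -- point.
  let M : Matrix (Fin n) (Fin n) F.Sa := fun β δ => ∑ ε, F.a (!p) β ε * F.K' p δ ε
  have hM : ∀ β δ, F.ev (M β δ) = F.ev (F.K p δ β) := fun β δ => by
    simp [M, ev_a', ev_K']
  obtain ⟨L, hL⟩ := F.exists_left_inverse M fun x hx => F.eq_zero_of_sum_K_mul p x fun β => by
    simpa [Matrix.mulVec, dotProduct, hM] using congrFun hx β
  have hLM : ∀ k l, ∑ i, L k i * M i l = if k = l then 1 else 0 := fun k l => by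
    rw [← Matrix.mul_apply, hL, Matrix.one_apply]
  have hLev : ∀ δ β, ∑ i, F.ev (L δ i) * F.ev (F.K p β i) = if δ = β then 1 else 0 := fun δ β => by
    simpa [hM, apply_ite F.ev] using congrArg F.ev (hLM δ β)
  let DK : Fin n → F.Sa := fun β => ⟨_, F.D_C_mem p γ (some (p, α)) (some (!p, β)) none⟩
  let DK' : Fin n → Fin n → F.Sa := fun δ ε => ⟨_, F.D_C'_mem p γ (some (p, δ)) (some (!p, ε)) none⟩
  let P₀ : Fin n → Fin n → F.Sa := fun β ε => F.K p α β * ∑ δ, F.a p γ δ * F.N' p ε δ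
  let Q₀ : Fin n → Fin n → F.Sa := fun β ε => F.K p α β * ∑ δ, F.a p γ δ * F.K' (!p) ε δ -
    ∑ δ, F.a p α δ * F.K' p δ ε * F.K p γ β
  let B₀ : Fin n → F.Sa := fun β => F.K p α β * B₃ + DK β * F.u -
    ∑ δ, ∑ ε, F.a p α δ * B₂ β ε * F.K' p δ ε - ∑ δ, ∑ ε, F.a p α δ * F.a (!p) β ε * DK' δ ε
  have key : ∀ β, ∑ δ, (M β δ : R) * F.D (some (p, γ)) (F.a p α δ : R) =
      ∑ ε, (P₀ β ε * F.c p ε + Q₀ β ε * F.c (!p) ε) + B₀ β := by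
    intro β
    have h := congrArg (fun s : F.Sa => F.D (some (p, γ)) (s : R)) (F.levi_eq p α β)
    have hDK : F.D (some (p, γ)) (F.K p α β : R) = DK β := rfl
    have hDK' : ∀ δ ε, F.D (some (p, γ)) (F.K' p δ ε : R) = DK' δ ε := fun _ _ => rfl
    push_cast at h
    simp only [map_sum, Derivation.leibniz, smul_eq_mul, hDK, hDK', hB₂, hB₃] at h
    simp only [M, P₀, Q₀, B₀]
    push_cast
    have t₁ : ∑ ε, ((F.K p α β : R) * ∑ δ, (F.a p γ δ : R) * F.N' p ε δ) * F.c p ε +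
        ∑ ε, ((F.K p α β : R) * ∑ δ, (F.a p γ δ : R) * F.K' (!p) ε δ) * F.c (!p) ε =
        F.K p α β * ∑ ε, ∑ δ, (F.a p γ δ : R) *
          (F.c p ε * F.N' p ε δ + F.c (!p) ε * F.K' (!p) ε δ) := by
      simp only [Finset.mul_sum, Finset.sum_mul, ← Finset.sum_add_distrib]
      exact Finset.sum_congr rfl fun _ _ => Finset.sum_congr rfl fun _ _ => by ring
    have t₂ : ∑ ε, (∑ δ, (F.a p α δ : R) * F.K' p δ ε * F.K p γ β) * F.c (!p) ε =
        ∑ δ, ∑ ε, (F.a p α δ : R) * (F.K p γ β * F.c (!p) ε) * F.K' p δ ε := by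
      simp only [Finset.sum_mul]
      rw [Finset.sum_comm]
      exact Finset.sum_congr rfl fun _ _ => Finset.sum_congr rfl fun _ _ => by ring
    have t₃ : ∑ δ, (∑ ε, (F.a (!p) β ε : R) * F.K' p δ ε) * F.D (some (p, γ)) (F.a p α δ : R) +
        ∑ δ, ∑ ε, (F.a p α δ : R) * (F.K p γ β * F.c (!p) ε) * F.K' p δ ε +
        ∑ δ, ∑ ε, (F.a p α δ : R) * B₂ β ε * F.K' p δ ε +
        ∑ δ, ∑ ε, (F.a p α δ : R) * F.a (!p) β ε * DK' δ ε =
        F.K p α β * (∑ ε, ∑ δ, (F.a p γ δ : R) *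
          (F.c p ε * F.N' p ε δ + F.c (!p) ε * F.K' (!p) ε δ) + B₃) + F.u * DK β := by
      rw [h]
      simp only [Finset.sum_mul, ← Finset.sum_add_distrib]
      exact Finset.sum_congr rfl fun _ _ => Finset.sum_congr rfl fun _ _ => by ring
    simp only [sub_mul, Finset.sum_add_distrib, Finset.sum_sub_distrib]
    linear_combination t₃ - t₁ + t₂
  refine ⟨fun δ ε => ∑ β, L δ β * P₀ β ε, fun δ ε => ∑ β, L δ β * Q₀ β ε,
    fun δ => ∑ β, L δ β * B₀ β, fun δ => ?_, fun δ ε => ?_⟩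
  · have hLM' : ∀ l, ∑ i, (L δ i : R) * M i l = if δ = l then 1 else 0 := fun l => by
      have := congrArg (Subtype.val) (hLM δ l)
      push_cast [apply_ite Subtype.val] at this
      exact this
    have e : F.D (some (p, γ)) (F.a p α δ : R) =
        ∑ β, L δ β * ∑ δ', (M β δ' : R) * F.D (some (p, γ)) (F.a p α δ' : R) := by
      simp only [Finset.mul_sum]
      rw [Finset.sum_comm]
      simp only [← mul_assoc, ← Finset.sum_mul, hLM']
      simp
    rw [e]
    simp only [key]
    push_cast
    simp only [mul_add, Finset.sum_add_distrib, Finset.mul_sum, Finset.sum_mul]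
    rw [Finset.sum_comm (γ := Fin n), Finset.sum_comm (γ := Fin n) (f := fun x i =>
      (L δ x : R) * (Q₀ x i * F.c (!p) i))]
    simp only [mul_assoc]
  · have e1 : ∀ β, F.ev (Q₀ β ε) = -(F.ev (F.K p γ ε) * F.ev (F.K p α β)) -
        F.ev (F.K p α ε) * F.ev (F.K p γ β) := fun β => by
      simp only [Q₀, map_sub, map_mul, map_sum, ev_a', ev_K', K_not, map_neg, ite_mul, one_mul,
        zero_mul, Finset.sum_ite_eq, Finset.mem_univ, if_true]
      ring
    simp only [map_sum, map_mul, e1, mul_sub, mul_neg, Finset.sum_sub_distrib,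
      Finset.sum_neg_distrib, mul_left_comm _ (F.ev (F.K p _ ε)), ← Finset.mul_sum, hLev]

/-! ### Derivatives of `a` along the transversal direction -/

theorem D_a_mem (p q : Bool) (γ α δ : Fin n) : F.D (some (p, γ)) (F.a q α δ : R) ∈ F.S1 := by
  by_cases h : q = p
  · subst h
    obtain ⟨P, Q, B, hD, -⟩ := F.exists_D_a q γ α
    rw [hD]
    exact add_mem (sum_mem fun ε _ => add_mem (mul_mem (F.Sa_le (P δ ε).2) (F.c_mem' _ _))
      (mul_mem (F.Sa_le (Q δ ε).2) (F.c_mem' _ _))) (F.Sa_le (B δ).2)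
  · obtain rfl : p = !q := by cases p <;> cases q <;> simp_all
    obtain ⟨B, hB⟩ := F.exists_D_not_a q α γ δ
    rw [hB]
    exact add_mem (neg_mem (mul_mem (F.Sa_le (F.K _ _ _).2) (F.c_mem' _ _))) (F.Sa_le B.2)

theorem D_u_mem (p : Bool) (γ : Fin n) : F.D (some (p, γ)) (F.u : R) ∈ F.S1 := by
  obtain ⟨B, hB⟩ := F.exists_D_u p γ
  rw [hB]
  exact add_mem (sum_mem fun γ _ => sum_mem fun δ _ => mul_mem (F.Sa_le (F.a _ _ _).2)
    (add_mem (mul_mem (F.c_mem' _ _) (F.Sa_le (F.N' _ _ _).2))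
      (mul_mem (F.c_mem' _ _) (F.Sa_le (F.K' _ _ _).2)))) (F.Sa_le B.2)

theorem D_Sa_mem (p : Bool) (γ : Fin n) (s : F.Sa) : F.D (some (p, γ)) (s : R) ∈ F.S1 :=
  F.chain_some p γ F.S1 F.Sa_le (fun q β δ => F.D_a_mem p q γ β δ) (F.D_u_mem p γ) s s.2

theorem commutator_mem (i j : FrameIdx n) (g : R) (S : Subalgebra ℂ R) (hS : F.Sa ≤ S)
    (hg : ∀ k, F.D k g ∈ S) : F.D i (F.D j g) - F.D j (F.D i g) ∈ S := by
  rw [F.commutator]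
  exact sum_mem fun k _ => mul_mem (hS (F.C_mem _ _ _)) (hg k)

/-- Apply `[Z_α, Z̄_β] = K_{αβ̄} T + …` to `a_ρ^δ`. Both iterated derivatives are derivatives of
expressions affine in `c`, and derivatives of `c` are derivatives of `a` along `T` modulo `S1`; so
second-order information enters only through `T a` and `T ā`. -/
theorem levi_system (p : Bool) (α β ρ δ : Fin n) {P Q : Fin n → Fin n → F.Sa} {B : Fin n → F.Sa}
    (hD : ∀ δ, F.D (some (p, α)) (F.a p ρ δ : R) =
      ∑ ε, (P δ ε * F.c p ε + Q δ ε * F.c (!p) ε) + B δ) :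
    F.K p α β * F.D none (F.a p ρ δ : R) + F.K p ρ β * F.D none (F.a p α δ : R) +
      ∑ ε, Q δ ε * F.D none (F.a (!p) β ε : R) ∈ F.S1 := by
  obtain ⟨B₂, hB₂⟩ := F.exists_D_not_a p ρ β δ
  have h := F.commutator (some (p, α)) (some (!p, β)) (F.a p ρ δ : R)
  rw [hB₂, hD, sum_frameIdx p] at h
  have hK : (F.K p α β : R) = F.C (some (p, α)) (some (!p, β)) none := rfl
  rw [← hK] at h
  have hc : ∀ γ, F.D (some (!p, β)) (F.c (!p) γ) - F.D none (F.a (!p) β γ : R) ∈ F.S1 := fun γ =>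
    F.D_none_a (!p) β γ
  have h₁ : F.D (some (p, α)) (-(F.K p ρ β * F.c p δ) + B₂ : R) +
      F.K p ρ β * F.D none (F.a p α δ : R) ∈ F.S1 := by
    simp only [map_add, map_neg, Derivation.leibniz, smul_eq_mul]
    have e : -((F.K p ρ β : R) * F.D (some (p, α)) (F.c p δ) +
        F.c p δ * F.D (some (p, α)) (F.K p ρ β : R)) + F.D (some (p, α)) (B₂ : R) +
        F.K p ρ β * F.D none (F.a p α δ : R) =
        -(F.K p ρ β * (F.D (some (p, α)) (F.c p δ) - F.D none (F.a p α δ : R))) -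
        F.c p δ * F.D (some (p, α)) (F.K p ρ β : R) + F.D (some (p, α)) (B₂ : R) := by ring
    rw [e]
    exact add_mem (sub_mem (neg_mem (mul_mem (F.Sa_le (F.K _ _ _).2) (F.D_none_a _ _ _)))
      (mul_mem (F.c_mem' _ _) (F.D_Sa_mem _ _ _))) (F.D_Sa_mem _ _ _)
  have h₂ : F.D (some (!p, β)) (∑ ε, (P δ ε * F.c p ε + Q δ ε * F.c (!p) ε) + B δ : R) -
      ∑ ε, Q δ ε * F.D none (F.a (!p) β ε : R) ∈ F.S1 := by
    simp only [map_add, map_sum, Derivation.leibniz, smul_eq_mul]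
    rw [add_sub_right_comm, ← Finset.sum_sub_distrib]
    refine add_mem (sum_mem fun ε _ => ?_) (F.D_Sa_mem _ _ _)
    have e : (P δ ε : R) * F.D (some (!p, β)) (F.c p ε) +
        F.c p ε * F.D (some (!p, β)) (P δ ε : R) +
        (Q δ ε * F.D (some (!p, β)) (F.c (!p) ε) + F.c (!p) ε * F.D (some (!p, β)) (Q δ ε : R)) -
        Q δ ε * F.D none (F.a (!p) β ε : R) =
        P δ ε * F.D (some (!p, β)) (F.c p ε) + F.c p ε * F.D (some (!p, β)) (P δ ε : R) +
        (Q δ ε * (F.D (some (!p, β)) (F.c (!p) ε) - F.D none (F.a (!p) β ε : R)) +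
          F.c (!p) ε * F.D (some (!p, β)) (Q δ ε : R)) := by ring
    rw [e]
    exact add_mem (add_mem (mul_mem (F.Sa_le (P _ _).2) (F.D_not_c _ _ _))
      (mul_mem (F.c_mem' _ _) (F.D_Sa_mem _ _ _))) (add_mem (mul_mem (F.Sa_le (Q _ _).2) (hc ε))
      (mul_mem (F.c_mem' _ _) (F.D_Sa_mem _ _ _)))
  have h₃ : ∑ γ, F.C (some (p, α)) (some (!p, β)) (some (p, γ)) *
      F.D (some (p, γ)) (F.a p ρ δ : R) + ∑ γ, F.C (some (p, α)) (some (!p, β)) (some (!p, γ)) *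
      F.D (some (!p, γ)) (F.a p ρ δ : R) ∈ F.S1 :=
    add_mem (sum_mem fun γ _ => mul_mem (F.Sa_le (F.C_mem _ _ _)) (F.D_Sa_mem _ _ _))
      (sum_mem fun γ _ => mul_mem (F.Sa_le (F.C_mem _ _ _)) (F.D_Sa_mem _ _ _))
  convert sub_mem (sub_mem h₁ h₂) h₃ using 1
  linear_combination -h

/-- The derivative of the Levi identity along `T`. It is what ties `T a` and `T ā` to `T u`. -/
theorem conformal_system (p : Bool) (α β : Fin n) :
    ∑ γ, (∑ δ, F.a (!p) β δ * F.K' p γ δ : R) * F.D none (F.a p α γ : R) +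
      ∑ δ, (∑ γ, F.a p α γ * F.K' p γ δ : R) * F.D none (F.a (!p) β δ : R) -
      F.K p α β * F.D none (F.u : R) ∈ F.S1 := by
  have h := congrArg (fun s : F.Sa => F.D none (s : R)) (F.levi_eq p α β)
  push_cast at h
  simp only [map_sum, Derivation.leibniz, smul_eq_mul] at h
  have h₁ : (F.u : R) * F.D none (F.K p α β : R) -
      ∑ γ, ∑ δ, (F.a p α γ * F.a (!p) β δ : R) * F.D none (F.K' p γ δ : R) ∈ F.S1 :=
    sub_mem (mul_mem (F.Sa_le F.u.2) (F.D_none_C_mem _ _ _))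
      (sum_mem fun γ _ => sum_mem fun δ _ => mul_mem
        (mul_mem (F.Sa_le (F.a _ _ _).2) (F.Sa_le (F.a _ _ _).2)) (F.D_none_C'_mem _ _ _))
  convert h₁ using 1
  have e : ∑ γ, (∑ δ, F.a (!p) β δ * F.K' p γ δ : R) * F.D none (F.a p α γ : R) +
      ∑ δ, (∑ γ, F.a p α γ * F.K' p γ δ : R) * F.D none (F.a (!p) β δ : R) +
      ∑ γ, ∑ δ, (F.a p α γ * F.a (!p) β δ : R) * F.D none (F.K' p γ δ : R) =
      F.K p α β * F.D none (F.u : R) + F.u * F.D none (F.K p α β : R) := by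
    rw [h]
    simp only [Finset.sum_mul]
    rw [Finset.sum_comm (γ := Fin n) (f := fun x i => (F.a p α i : R) * F.K' p i x * _)]
    simp only [← Finset.sum_add_distrib]
    exact Finset.sum_congr rfl fun _ _ => Finset.sum_congr rfl fun _ _ => by ring
  linear_combination e

/-- The equations of `levi_system` and `conformal_system` form an overdetermined system for `T a`
and `T ā`, with right-hand side proportional to `T u` modulo `S1` and with symbol injective at the
base point. The value `1 / 2` reflects `u ≈ a ā`: infinitesimally `a` changes like the square root
of `u`. -/
theorem exists_D_none_a (p : Bool) : ∃ s : Fin n → Fin n → F.Sa,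
    (∀ α γ, F.ev (s α γ) = if α = γ then 1 / 2 else 0) ∧
    ∀ α γ, F.D none (F.a p α γ : R) - s α γ * F.D none (F.u : R) ∈ F.S1 := by
  choose P Q B hD hQ using F.exists_D_a p
  -- Equations: the commutator identities, then the differentiated Levi identity. Unknowns: `T a`
  -- for the type `p`, then for the opposite type.
  let ι := (Fin n × Fin n × Fin n × Fin n) ⊕ (Fin n × Fin n)
  let κ := (Fin n × Fin n) ⊕ (Fin n × Fin n)
  let Mx : Matrix ι κ F.Sa := fun i k => match i, k with
    | .inl (α, β, ρ, δ), .inl (i, j) => (if j = δ then (if i = ρ then F.K p α β else 0) else 0) +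
        (if j = δ then (if i = α then F.K p ρ β else 0) else 0)
    | .inl (α, β, ρ, δ), .inr (i, j) => if i = β then Q α ρ δ j else 0
    | .inr (α, β), .inl (i, j) => if i = α then ∑ δ, F.a (!p) β δ * F.K' p j δ else 0
    | .inr (α, β), .inr (i, j) => if i = β then ∑ γ, F.a p α γ * F.K' p γ j else 0
  let q : ι → F.Sa := fun i => match i with
    | .inl _ => 0
    | .inr (α, β) => F.K p α β
  let x : κ → R := fun k => match k with
    | .inl (i, j) => F.D none (F.a p i j : R)
    | .inr (i, j) => F.D none (F.a (!p) i j : R)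
  -- A solution at the base point: it makes the two pairs of terms in the commutator equations
  -- cancel and the conformal equation read `K / 2 + K / 2 = K`.
  let x₀ : κ → ℂ := fun k => match k with
    | .inl (i, j) => if i = j then 1 / 2 else 0
    | .inr (i, j) => if i = j then 1 / 2 else 0
  have hMx : ∀ y : κ → ℂ, (∀ i, ∑ k, F.ev (Mx i k) * y k = 0) → y = 0 := by
    intro y hy
    have h₂ : ∀ α β, ∑ ε, F.ev (F.K p α ε) * y (.inr (β, ε)) =
        -∑ γ, F.ev (F.K p γ β) * y (.inl (α, γ)) := fun α β => by
      have := hy (.inr (α, β))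
      simp only [κ, Mx, Fintype.sum_sum_type, Fintype.sum_prod_type, apply_ite F.ev, map_sum,
        map_mul, ev_a', ev_K', map_zero, ite_mul, one_mul, zero_mul, Finset.sum_ite_eq,
        Finset.mem_univ, if_true] at this
      simp at this
      linear_combination this
    have h₁ : ∀ α β ρ δ, F.ev (F.K p α β) * y (.inl (ρ, δ)) + F.ev (F.K p ρ β) * y (.inl (α, δ)) +
        (if δ = ρ then ∑ γ, F.ev (F.K p γ β) * y (.inl (α, γ)) else 0) +
        (if δ = α then ∑ γ, F.ev (F.K p γ β) * y (.inl (ρ, γ)) else 0) = 0 := fun α β ρ δ => by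
      have := hy (.inl (α, β, ρ, δ))
      simp only [κ, Mx, Fintype.sum_sum_type, Fintype.sum_prod_type, apply_ite F.ev, map_add,
        map_zero, ite_mul, add_mul, zero_mul, Finset.sum_add_distrib, Finset.sum_ite_eq',
        Finset.sum_ite_eq, Finset.mem_univ, if_true, Finset.sum_ite_irrel, Finset.sum_const_zero,
        hQ, sub_mul, neg_mul, Finset.sum_sub_distrib, Finset.sum_neg_distrib] at this
      have e : ∀ a b (c : Prop) [Decidable c],
          ∑ ε, F.ev (F.K p a ε) * (if c then 1 else 0) * y (.inr (b, ε)) =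
          -(if c then ∑ γ, F.ev (F.K p γ b) * y (.inl (a, γ)) else 0) := fun a b c _ => by
        by_cases hc : c <;> simp [hc, h₂]
      rw [e, e] at this
      linear_combination this
    -- The conformal equations eliminate the conjugate unknowns; every remaining term then contains
    -- one factor of the Levi matrix, which cancels by nondegeneracy.
    have h₃ : ∀ α ρ δ σ, (if α = σ then y (.inl (ρ, δ)) else 0) +
        (if ρ = σ then y (.inl (α, δ)) else 0) + (if δ = ρ then y (.inl (α, σ)) else 0) +
        (if δ = α then y (.inl (ρ, σ)) else 0) = 0 := fun α ρ δ σ => by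
      refine congrFun (F.eq_zero_of_sum_K_mul p (fun σ => (if α = σ then y (.inl (ρ, δ)) else 0) +
        (if ρ = σ then y (.inl (α, δ)) else 0) + (if δ = ρ then y (.inl (α, σ)) else 0) +
        (if δ = α then y (.inl (ρ, σ)) else 0)) fun β => ?_) σ
      refine Eq.trans ?_ (h₁ α β ρ δ)
      simp [mul_add, Finset.sum_add_distrib, Finset.sum_ite_irrel]
    -- With `ρ = σ = α` the identity reads `2 X_α^δ = 0` off the diagonal and `4 X_α^α = 0` on it.
    have hX : ∀ α δ, y (.inl (α, δ)) = 0 := fun α δ => by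
      have := h₃ α α δ α
      by_cases h : δ = α
      · subst h
        simp only [if_true] at this
        linear_combination this / 4
      · simp only [if_true, h, if_false] at this
        linear_combination this / 2
    have hY : ∀ β, (fun ε => y (.inr (β, ε))) = 0 := fun β =>
      F.eq_zero_of_sum_K_mul' p _ fun α => by simpa [hX] using h₂ α β
    funext k
    rcases k with ⟨α, γ⟩ | ⟨α, γ⟩
    · exact hX α γ
    · exact congrFun (hY α) γ
  obtain ⟨s, hs₀, hs⟩ := F.exists_solution Mx hMx F.S1 F.Sa_le q x (F.D none (F.u : R)) x₀
    (fun i => by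
      rcases i with ⟨α, β, ρ, δ⟩ | ⟨α, β⟩
      · have := F.levi_system p α β ρ δ (hD α ρ)
        simp only [κ, Mx, x, q, Fintype.sum_sum_type, Fintype.sum_prod_type,
          apply_ite (Subtype.val : F.Sa → R), Subalgebra.coe_add, Subalgebra.coe_zero, ite_mul,
          add_mul, zero_mul, Finset.sum_add_distrib, Finset.sum_ite_eq', Finset.sum_ite_eq,
          Finset.mem_univ, if_true, Finset.sum_ite_irrel, Finset.sum_const_zero, sub_zero]
        exact this
      · have := F.conformal_system p α β
        simp only [κ, Mx, x, q, Fintype.sum_sum_type, Fintype.sum_prod_type,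
          apply_ite (Subtype.val : F.Sa → R), Subalgebra.coe_add, Subalgebra.coe_zero, ite_mul,
          add_mul, zero_mul, Finset.sum_add_distrib, Finset.sum_ite_eq', Finset.sum_ite_eq,
          Finset.mem_univ, if_true, Finset.sum_ite_irrel, Finset.sum_const_zero, sub_zero]
        push_cast
        exact this)
    (fun i => by
      rcases i with ⟨α, β, ρ, δ⟩ | ⟨α, β⟩
      · simp only [κ, Mx, x₀, q, Fintype.sum_sum_type, Fintype.sum_prod_type, apply_ite F.ev,
          map_add, map_zero, ite_mul, add_mul, zero_mul, Finset.sum_add_distrib,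
          Finset.sum_ite_eq', Finset.sum_ite_eq, Finset.mem_univ, if_true, Finset.sum_ite_irrel,
          Finset.sum_const_zero, hQ, sub_mul, neg_mul, Finset.sum_sub_distrib,
          Finset.sum_neg_distrib, mul_ite, mul_zero, mul_one]
        by_cases h₁ : ρ = δ <;> by_cases h₂ : α = δ <;> simp [h₁, h₂, eq_comm]
      · simp only [κ, Mx, x₀, q, Fintype.sum_sum_type, Fintype.sum_prod_type, apply_ite F.ev,
          map_sum, map_mul, map_zero, ite_mul, zero_mul, Finset.sum_ite_eq', Finset.sum_ite_eq,
          Finset.mem_univ, if_true, Finset.sum_ite_irrel, Finset.sum_const_zero, mul_ite, mul_zero,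
          ev_a', ev_K', one_mul]
        ring)
  exact ⟨fun α γ => s (.inl (α, γ)), fun α γ => hs₀ _, fun α γ => hs (.inl (α, γ))⟩

/-! ### Closing the tower: derivatives of `c` and of `r = T u` -/

theorem Sa_le_Sh : F.Sa ≤ F.Sh := F.Sa_le.trans F.S1_le

theorem r_mem' : F.D none (F.u : R) ∈ F.Sh := F.r_mem

theorem D_none_a_mem (p : Bool) (α γ : Fin n) : F.D none (F.a p α γ : R) ∈ F.Sh := by
  obtain ⟨s, -, hs⟩ := F.exists_D_none_a p
  simpa using add_mem (F.S1_le (hs α γ)) (mul_mem (F.Sa_le_Sh (s α γ).2) F.r_mem')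

theorem D_none_Sa_mem (s : F.Sa) : F.D none (s : R) ∈ F.Sh :=
  F.chain_none F.Sh F.S1_le (fun q β δ => F.D_none_a_mem q β δ) F.r_mem s s.2

theorem D_c_mem (p q : Bool) (α γ : Fin n) : F.D (some (p, α)) (F.c q γ) ∈ F.Sh := by
  by_cases h : q = p
  · subst h
    simpa using add_mem (F.S1_le (F.D_none_a q α γ)) (F.D_none_a_mem q α γ)
  · obtain rfl : p = !q := by cases p <;> cases q <;> simp_all
    exact F.S1_le (F.D_not_c q α γ)

theorem D_S1_mem (p : Bool) (α : Fin n) {s : R} (hs : s ∈ F.S1) : F.D (some (p, α)) s ∈ F.Sh :=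
  F.chain_one _ F.Sh F.S1_le (fun s hs => F.S1_le (F.D_Sa_mem p α ⟨s, hs⟩))
    (fun q γ => F.D_c_mem p q α γ) s hs

theorem D_u_mem' (k : FrameIdx n) : F.D k (F.u : R) ∈ F.Sh := by
  rcases k with _ | ⟨p, γ⟩
  · exact F.r_mem
  · exact F.S1_le (F.D_u_mem p γ)

theorem D_a_mem' (k : FrameIdx n) (q : Bool) (α δ : Fin n) : F.D k (F.a q α δ : R) ∈ F.Sh := by
  rcases k with _ | ⟨p, γ⟩
  · exact F.D_none_a_mem q α δ
  · exact F.S1_le (F.D_a_mem p q γ α δ)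

/-- `Z_β u` is linear in `c` over `Sa`, up to a term in `Sa`. Under `T` the coefficients and that
term stay in `Sh`, so only the terms with `T c` survive. -/
theorem D_none_D_u (p : Bool) (β : Fin n) :
    F.D none (F.D (some (p, β)) (F.u : R)) - ∑ γ, ∑ σ, F.a p β σ *
      (F.D none (F.c p γ) * F.N' p γ σ + F.D none (F.c (!p) γ) * F.K' (!p) γ σ) ∈ F.Sh := by
  obtain ⟨B, hB⟩ := F.exists_D_u p β
  rw [hB]
  simp only [map_add, map_sum, Derivation.leibniz, smul_eq_mul]
  rw [add_sub_right_comm, ← Finset.sum_sub_distrib]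
  simp only [← Finset.sum_sub_distrib]
  refine add_mem (sum_mem fun γ _ => sum_mem fun σ _ => ?_) (F.D_none_Sa_mem _)
  have e : (F.a p β σ : R) * (F.c p γ * F.D none (F.N' p γ σ : R) +
      F.N' p γ σ * F.D none (F.c p γ) + (F.c (!p) γ * F.D none (F.K' (!p) γ σ : R) +
      F.K' (!p) γ σ * F.D none (F.c (!p) γ))) +
      (F.c p γ * F.N' p γ σ + F.c (!p) γ * F.K' (!p) γ σ) * F.D none (F.a p β σ : R) -
      F.a p β σ * (F.D none (F.c p γ) * F.N' p γ σ + F.D none (F.c (!p) γ) * F.K' (!p) γ σ) =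
      F.a p β σ * (F.c p γ * F.D none (F.N' p γ σ : R) +
        F.c (!p) γ * F.D none (F.K' (!p) γ σ : R)) +
      (F.c p γ * F.N' p γ σ + F.c (!p) γ * F.K' (!p) γ σ) * F.D none (F.a p β σ : R) := by ring
  rw [e]
  have hc : ∀ p γ, F.c p γ ∈ F.Sh := fun p γ => F.S1_le (F.c_mem' p γ)
  exact add_mem (mul_mem (F.Sa_le_Sh (F.a _ _ _).2) (add_mem
    (mul_mem (hc _ _) (F.D_none_Sa_mem _)) (mul_mem (hc _ _) (F.D_none_Sa_mem _))))
    (mul_mem (add_mem (mul_mem (hc _ _) (F.Sa_le_Sh (F.N' _ _ _).2))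
      (mul_mem (hc _ _) (F.Sa_le_Sh (F.K' _ _ _).2))) (F.D_none_Sa_mem _))

theorem D_r_sub_mem (p : Bool) (β : Fin n) :
    F.D (some (p, β)) (F.D none (F.u : R)) - F.D none (F.D (some (p, β)) (F.u : R)) ∈ F.Sh :=
  F.commutator_mem _ _ _ F.Sh F.Sa_le_Sh F.D_u_mem'

/-- Apply `[Z̄_β, T]` to `a_ρ^δ`. One order of differentiation gives `T(K c)`; in the other, `T a ≡
s T u` turns `Z̄_β T a` into `s T Z̄_β u`, which again involves `T c` and its conjugate only. -/
theorem transversal_system (p : Bool) (ρ δ β : Fin n) {s : F.Sa}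
    (hs : F.D none (F.a p ρ δ : R) - s * F.D none (F.u : R) ∈ F.S1) :
    F.K p ρ β * F.D none (F.c p δ) + s * ∑ γ, ∑ σ, F.a (!p) β σ *
      (F.D none (F.c (!p) γ) * F.N' (!p) γ σ + F.D none (F.c p γ) * F.K' p γ σ) ∈ F.Sh := by
  obtain ⟨B, hB⟩ := F.exists_D_not_a p ρ β δ
  have h₁ := F.commutator_mem (some (!p, β)) none (F.a p ρ δ) F.Sh F.Sa_le_Sh
    fun k => F.D_a_mem' k p ρ δ
  have h₂ := F.D_S1_mem (!p) β hs
  have h₃ := F.D_r_sub_mem (!p) β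
  have h₄ := F.D_none_D_u (!p) β
  rw [hB] at h₁
  simp only [map_sub, map_add, map_neg, Derivation.leibniz, smul_eq_mul, Bool.not_not] at h₁ h₂ h₄
  have hs' := F.Sa_le_Sh s.2
  have h₅ := sub_mem (sub_mem (sub_mem (sub_mem h₁ h₂) (mul_mem hs' h₃)) (mul_mem hs' h₄))
    (mul_mem F.r_mem (F.S1_le (F.D_Sa_mem (!p) β s)))
  have h₆ := sub_mem (add_mem h₅ (F.D_none_Sa_mem B))
    (mul_mem (F.S1_le (F.c_mem' p δ)) (F.D_none_Sa_mem (F.K p ρ β)))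
  rw [A_none_none] at h₆
  convert h₆ using 1
  ring

/-- The equations of `transversal_system` for both types are solved together. At the base point `s`
is half the identity, so the equations with `ρ ≠ δ` isolate a single unknown; with only one index
available, `N'` vanishes by antisymmetry. -/
theorem D_none_c_mem (p : Bool) (γ : Fin n) : F.D none (F.c p γ) ∈ F.Sh := by
  choose s hs₀ hs using F.exists_D_none_a
  let Mx : Matrix (Bool × Fin n × Fin n × Fin n) (Bool × Fin n) F.Sa := fun i k =>
    if k.1 = i.1 then (if k.2 = i.2.2.1 then F.K i.1 i.2.1 i.2.2.2 else 0) +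
      s i.1 i.2.1 i.2.2.1 * ∑ σ, F.a (!i.1) i.2.2.2 σ * F.K' i.1 k.2 σ
    else s i.1 i.2.1 i.2.2.1 * ∑ σ, F.a (!i.1) i.2.2.2 σ * F.N' (!i.1) k.2 σ
  refine F.mem_of_linear_system Mx ?_ F.Sh F.Sa_le_Sh (fun k => F.D none (F.c k.1 k.2)) ?_ (p, γ)
  · intro x hx
    have h₁ : ∀ p ρ δ β, F.ev (F.K p ρ β) * x (p, δ) + (if ρ = δ then 1 / 2 else 0) *
        (∑ γ, F.ev (F.K p γ β) * x (p, γ) +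
          ∑ γ, F.ev (F.N' (!p) γ β) * x (!p, γ)) = 0 := fun p ρ δ β => by
      have := hx (p, ρ, δ, β)
      rw [Fintype.sum_prod_type, sum_bool p] at this
      simp only [Mx, if_true, Bool.not_eq_self, if_false, map_add, map_mul, map_sum, ev_a', ev_K',
        hs₀, apply_ite F.ev, map_zero, ite_mul, one_mul, zero_mul, Finset.sum_ite_eq,
        Finset.mem_univ, add_mul, Finset.sum_add_distrib, Finset.sum_ite_eq'] at this
      by_cases h : ρ = δ <;> simp [h, mul_assoc, ← Finset.mul_sum, -mul_eq_zero] at this ⊢ <;>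
        linear_combination this
    funext ⟨p, δ⟩
    -- An index `ρ ≠ δ` removes the sum multiplied by `s`. If there is none, `ρ = δ` has to be used.
    have h₂ : ∃ ρ, ∀ β, F.ev (F.K p ρ β) * x (p, δ) = 0 := by
      by_cases h : ∃ ρ, ρ ≠ δ
      · obtain ⟨ρ, hρ⟩ := h
        exact ⟨ρ, fun β => by simpa [hρ] using h₁ p ρ δ β⟩
      -- In CR dimension one the equation is `K x + (1 / 2) K x = 0`, that is `(3 / 2) K x = 0`.
      · push Not at h
        have : Subsingleton (Fin n) := ⟨fun i j => (h i).trans (h j).symm⟩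
        refine ⟨δ, fun β => ?_⟩
        have h₃ := h₁ p δ δ β
        have hN : F.ev (F.N' (!p) δ β) = 0 := by
          have := congrArg F.ev (F.N'_antisymm (!p) δ β)
          rw [h β, map_neg] at this
          rw [h β]
          linear_combination this / 2
        rw [Fintype.sum_subsingleton _ δ, Fintype.sum_subsingleton _ δ, hN] at h₃
        simp only [if_true] at h₃
        linear_combination 2 / 3 * h₃
    obtain ⟨ρ, hρ⟩ := h₂
    have := congrFun (F.eq_zero_of_sum_K_mul p (Pi.single ρ (x (p, δ))) fun β => by
      rw [Finset.sum_eq_single ρ (fun α _ hα => by simp [hα]) (by simp)]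
      simpa using hρ β) ρ
    simpa using this
  · intro ⟨p, ρ, δ, β⟩
    have := F.transversal_system p ρ δ β (hs p ρ δ)
    rw [Fintype.sum_prod_type, sum_bool p]
    simp only [Mx, if_true, Bool.not_eq_self, if_false]
    convert this using 1
    push_cast [apply_ite (Subtype.val : F.Sa → R)]
    simp only [add_mul, Finset.sum_add_distrib, ite_mul, zero_mul, Finset.sum_ite_eq',
      Finset.mem_univ, if_true, Finset.mul_sum, Finset.sum_mul, mul_add]
    rw [add_assoc, ← Finset.sum_add_distrib]
    simp only [← Finset.sum_add_distrib]
    congr 1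
    exact Finset.sum_congr rfl fun _ _ => Finset.sum_congr rfl fun _ _ => by ring

theorem D_none_S1_mem {s : R} (hs : s ∈ F.S1) : F.D none s ∈ F.Sh :=
  F.chain_one none F.Sh F.S1_le (fun s hs => F.D_none_Sa_mem ⟨s, hs⟩) F.D_none_c_mem s hs

theorem D_some_Sh_mem (p : Bool) (α : Fin n) {s : R} (hs : s ∈ F.Sh) :
    F.D (some (p, α)) s ∈ F.Sh := by
  refine F.chain_h _ F.Sh le_rfl (fun s hs => F.D_S1_mem p α hs) ?_ s hs
  simpa [A_none_none] using add_mem (F.D_r_sub_mem p α) (F.D_none_S1_mem (F.D_u_mem p α))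

/-- Apply `[Z_α, T]` to `c^α`. Modulo `Sh`, `Z_α T c^α` vanishes, while `T Z_α c^α ≡ T T a_α^α ≡ s T
r`; the coefficient `s` is `1 / 2` at the base point, hence invertible. -/
theorem D_none_r_mem (α : Fin n) : F.D none (F.D none (F.A none none)) ∈ F.Sh := by
  obtain ⟨s, hs₀, hs⟩ := F.exists_D_none_a false
  have h₁ := F.commutator_mem (some (false, α)) none (F.c false α) F.Sh F.Sa_le_Sh fun k => by
    rcases k with _ | ⟨p, γ⟩
    · exact F.D_none_c_mem false α
    · exact F.D_c_mem p false γ α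
  have h₂ := F.D_some_Sh_mem false α (F.D_none_c_mem false α)
  have h₃ := F.D_none_S1_mem (F.D_none_a false α α)
  have h₄ := F.D_none_S1_mem (hs α α)
  simp only [map_sub, Derivation.leibniz, smul_eq_mul] at h₃ h₄
  have h₅ := sub_mem (sub_mem (sub_mem (sub_mem h₂ h₁) h₃) h₄)
    (mul_mem F.r_mem (F.D_none_Sa_mem (s α α)))
  have h₆ : (s α α : R) * F.D none (F.D none (F.A none none)) ∈ F.Sh := by
    rw [A_none_none] at h₅ ⊢
    convert h₅ using 1
    ring
  obtain ⟨⟨v, w, hv, hw⟩, rfl : v = s α α⟩ := F.isUnit_of_ev (s α α) (by simp [hs₀])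
  have hw' : (w : R) * s α α = 1 := by simpa using congrArg (Subtype.val) hw
  simpa [← mul_assoc, hw'] using mul_mem (F.Sa_le_Sh w.2) h₆

/-- All first derivatives of functions in `Sh` are again in `Sh`. -/
theorem D_Sh_mem [NeZero n] (i : FrameIdx n) {s : R} (hs : s ∈ F.Sh) : F.D i s ∈ F.Sh := by
  rcases i with _ | ⟨p, α⟩
  · exact F.chain_h none F.Sh le_rfl (fun s hs => F.D_none_S1_mem hs) (F.D_none_r_mem 0) s hs
  · exact F.D_some_Sh_mem p α hs

end CRTower

/-! ### Germs of functions of a map and a point along a filter -/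

/-- A filter on pairs (map, point) is local if its sets contain, together with a pair, all pairs
with the same map and a nearby point. -/
def IsLocalFilter {ι E : Type*} [TopologicalSpace E] (l : Filter (ι × E)) : Prop :=
  ∀ s ∈ l, ∀ᶠ τ in l, ∀ᶠ y in 𝓝 τ.2, (τ.1, y) ∈ s

/-- The function `G` is of class `C^r` in a neighbourhood of `y₀`. -/
def SmoothNearAt {V W : Type*} [NormedAddCommGroup V] [NormedSpace ℝ V] [NormedAddCommGroup W]
    [NormedSpace ℝ W] (r : WithTop ℕ∞) (G : V → W) (y₀ : V) : Prop :=
  ∀ᶠ y in 𝓝 y₀, ContDiffAt ℝ r G y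

namespace SmoothNearAt

variable {V W X : Type*} [NormedAddCommGroup V] [NormedSpace ℝ V] [NormedAddCommGroup W]
    [NormedSpace ℝ W] [NormedAddCommGroup X] [NormedSpace ℝ X] {r : WithTop ℕ∞} {y₀ : V}

theorem contDiffAt {G : V → W} (h : SmoothNearAt r G y₀) : ContDiffAt ℝ r G y₀ := h.self_of_nhds

theorem of_contDiff {G : V → W} (h : ContDiff ℝ r G) : SmoothNearAt r G y₀ :=
  Eventually.of_forall fun _ => h.contDiffAt

theorem comp {G : W → X} {F : V → W} (hG : SmoothNearAt r G (F y₀)) (hF : SmoothNearAt r F y₀) :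
    SmoothNearAt r (fun y => G (F y)) y₀ := by
  filter_upwards [hF, hF.contDiffAt.continuousAt.eventually hG] with y h₁ h₂
  exact h₂.comp y h₁

theorem const (w : W) : SmoothNearAt r (fun _ : V => w) y₀ := of_contDiff contDiff_const

theorem add {F G : V → W} (hF : SmoothNearAt r F y₀) (hG : SmoothNearAt r G y₀) :
    SmoothNearAt r (fun y => F y + G y) y₀ := by
  filter_upwards [hF, hG] with y h₁ h₂ using h₁.add h₂

theorem sub {F G : V → W} (hF : SmoothNearAt r F y₀) (hG : SmoothNearAt r G y₀) :
    SmoothNearAt r (fun y => F y - G y) y₀ := by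
  filter_upwards [hF, hG] with y h₁ h₂ using h₁.sub h₂

theorem mul {F G : V → ℂ} (hF : SmoothNearAt r F y₀) (hG : SmoothNearAt r G y₀) :
    SmoothNearAt r (fun y => F y * G y) y₀ := by
  filter_upwards [hF, hG] with y h₁ h₂ using h₁.mul h₂

theorem sum {κ : Type*} {s : Finset κ} {F : κ → V → W} (hF : ∀ k ∈ s, SmoothNearAt r (F k) y₀) :
    SmoothNearAt r (fun y => ∑ k ∈ s, F k y) y₀ := by
  have : ∀ᶠ y in 𝓝 y₀, ∀ k ∈ s, ContDiffAt ℝ r (F k) y :=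
    (Filter.eventually_all_finset s).2 hF
  filter_upwards [this] with y h using ContDiffAt.sum h

theorem pi {κ : Type*} [Fintype κ] {F : κ → V → W} (hF : ∀ k, SmoothNearAt r (F k) y₀) :
    SmoothNearAt r (fun y k => F k y) y₀ := by
  have : ∀ᶠ y in 𝓝 y₀, ∀ k, ContDiffAt ℝ r (F k) y := Filter.eventually_all.2 hF
  filter_upwards [this] with y h using contDiffAt_pi.2 h

theorem fderiv_apply {G : V → W} (hr : r + 1 ≤ r) (h : SmoothNearAt r G y₀) (v : V) :
    SmoothNearAt r (fun y => fderiv ℝ G y v) y₀ := by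
  filter_upwards [h] with y hy
  exact (hy.fderiv_right hr).clm_apply contDiffAt_const

theorem differentiableAt {G : V → W} (hr : ∞ ≤ r) (h : SmoothNearAt r G y₀) :
    ∀ᶠ y in 𝓝 y₀, DifferentiableAt ℝ G y := by
  filter_upwards [h] with y hy using (hy.of_le hr).differentiableAt (by simp)

end SmoothNearAt

section GermAlgebra

variable {ι E : Type*} [NormedAddCommGroup E] [NormedSpace ℝ E] (l : Filter (ι × E))

/-- Functions of a map and a point that are, along `l`, smooth in the point. -/
def smoothAlong : Subalgebra ℂ (ι × E → ℂ) where
  carrier := {G | ∀ᶠ τ in l, ContDiffAt ℝ ∞ (fun y => G (τ.1, y)) τ.2}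
  mul_mem' hF hG := by
    filter_upwards [hF, hG] with τ h₁ h₂ using h₁.mul h₂
  add_mem' hF hG := by
    filter_upwards [hF, hG] with τ h₁ h₂ using h₁.add h₂
  algebraMap_mem' z := Eventually.of_forall fun τ => contDiffAt_const

/-- The functions vanishing along `l`. -/
def vanishingAlong : Ideal (smoothAlong l) where
  carrier := {G | ∀ᶠ τ in l, (G : ι × E → ℂ) τ = 0}
  add_mem' hF hG := by
    filter_upwards [hF, hG] with τ h₁ h₂
    simp [h₁, h₂]
  zero_mem' := Eventually.of_forall fun τ => rfl
  smul_mem' F G hG := by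
    filter_upwards [hG] with τ h
    simp [h]

/-- Germs along `l` of functions of a map and a point that are smooth in the point. -/
def GermAlong : Type _ := smoothAlong l ⧸ vanishingAlong l

instance : CommRing (GermAlong l) :=
  inferInstanceAs (CommRing (smoothAlong l ⧸ vanishingAlong l))

instance : Algebra ℂ (GermAlong l) :=
  inferInstanceAs (Algebra ℂ (smoothAlong l ⧸ vanishingAlong l))

/-- The quotient map to the algebra of germs. -/
def germHom : smoothAlong l →ₐ[ℂ] GermAlong l := Ideal.Quotient.mkₐ ℂ (vanishingAlong l)

variable {l}

/-- The germ of a function. -/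
def germ (G : smoothAlong l) : GermAlong l := germHom l G

theorem germ_surjective : Function.Surjective (germ : smoothAlong l → GermAlong l) :=
  Ideal.Quotient.mk_surjective

theorem germ_eq_iff {F G : smoothAlong l} :
    germ F = germ G ↔ (F : ι × E → ℂ) =ᶠ[l] (G : ι × E → ℂ) := by
  refine (Ideal.Quotient.eq (I := vanishingAlong l)).trans ?_
  change (∀ᶠ τ in l, ((F - G : smoothAlong l) : ι × E → ℂ) τ = 0) ↔ _
  simp [sub_eq_zero, Filter.EventuallyEq]

theorem germ_add (F G : smoothAlong l) : germ (F + G) = germ F + germ G := rfl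
theorem germ_mul (F G : smoothAlong l) : germ (F * G) = germ F * germ G := rfl
theorem germ_sub (F G : smoothAlong l) : germ (F - G) = germ F - germ G := rfl
theorem germ_sum {κ : Type*} (s : Finset κ) (F : κ → smoothAlong l) :
    germ (∑ k ∈ s, F k) = ∑ k ∈ s, germ (F k) :=
  map_sum (germHom l) F s

theorem differentiableAt_of_mem (F : smoothAlong l) :
    ∀ᶠ τ in l, DifferentiableAt ℝ (fun y => (F : ι × E → ℂ) (τ.1, y)) τ.2 := by
  filter_upwards [F.2] with τ h using ContDiffAt.differentiableAt h (by simp)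

/-- The derivative of a function in the point, in a constant direction. -/
def pderivFun (v : E) (F : smoothAlong l) : smoothAlong l :=
  ⟨fun τ => fderiv ℝ (fun y => (F : ι × E → ℂ) (τ.1, y)) τ.2 v, by
    filter_upwards [F.2] with τ h
    exact (ContDiffAt.fderiv_right h (by simp)).clm_apply contDiffAt_const⟩

theorem IsLocalFilter.eventually_nhds {ι E : Type*} [TopologicalSpace E] {l : Filter (ι × E)}
    (hl : IsLocalFilter l) {p : ι × E → Prop}
    (hp : ∀ᶠ τ in l, p τ) : ∀ᶠ τ in l, ∀ᶠ y in 𝓝 τ.2, p (τ.1, y) := hl _ hp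

/-- This is where locality of the filter is needed: functions equal along `l` must agree at nearby
points for the same map before their derivatives can be compared. -/
theorem germ_pderivFun_congr (hl : IsLocalFilter l) (v : E) {F G : smoothAlong l}
    (h : germ F = germ G) : germ (pderivFun v F) = germ (pderivFun v G) := by
  rw [germ_eq_iff] at h ⊢
  filter_upwards [hl.eventually_nhds h] with τ hτ
  exact congrArg (fun L : E →L[ℝ] ℂ => L v) (Filter.EventuallyEq.fderiv_eq hτ)

theorem exists_pderivMap (hl : IsLocalFilter l) (v : E) :
    ∃ D : GermAlong l → GermAlong l, ∀ F, D (germ F) = germ (pderivFun v F) :=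
  ⟨fun φ => germ (pderivFun v (germ_surjective φ).choose), fun F =>
    germ_pderivFun_congr hl v (germ_surjective (germ F)).choose_spec⟩

/-- The derivation of the algebra of germs given by a constant direction. -/
def pderivAlong (hl : IsLocalFilter l) (v : E) : Derivation ℂ (GermAlong l) (GermAlong l) :=
  Derivation.mk'
    { toFun := (exists_pderivMap hl v).choose
      map_add' := fun φ ψ => by
        obtain ⟨F, rfl⟩ := germ_surjective φ
        obtain ⟨G, rfl⟩ := germ_surjective ψ
        rw [← germ_add]
        simp only [(exists_pderivMap hl v).choose_spec]
        rw [← germ_add, germ_eq_iff]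
        filter_upwards [differentiableAt_of_mem F, differentiableAt_of_mem G] with τ h₁ h₂
        exact congrArg (fun L => L v) (fderiv_fun_add h₁ h₂)
      map_smul' := fun z φ => by
        obtain ⟨F, rfl⟩ := germ_surjective φ
        have e : z • germ F = germ (z • F) := rfl
        rw [e]
        simp only [(exists_pderivMap hl v).choose_spec, RingHom.id_apply]
        have e : z • germ (pderivFun v F) = germ (z • pderivFun v F) := rfl
        rw [e, germ_eq_iff]
        filter_upwards [differentiableAt_of_mem F] with τ h₁
        exact congrArg (fun L => L v) (fderiv_fun_const_smul h₁ z) }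
    fun φ ψ => by
      obtain ⟨F, rfl⟩ := germ_surjective φ
      obtain ⟨G, rfl⟩ := germ_surjective ψ
      rw [← germ_mul]
      simp only [LinearMap.coe_mk, AddHom.coe_mk, (exists_pderivMap hl v).choose_spec, smul_eq_mul]
      rw [← germ_mul, ← germ_mul, ← germ_add, germ_eq_iff]
      filter_upwards [differentiableAt_of_mem F, differentiableAt_of_mem G] with τ h₁ h₂
      refine (congrArg (fun L => L v) (fderiv_fun_mul h₁ h₂)).trans ?_
      simp [pderivFun]

@[simp] theorem pderivAlong_germ (hl : IsLocalFilter l) (v : E) (F : smoothAlong l) :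
    pderivAlong hl v (germ F) = germ (pderivFun v F) :=
  (exists_pderivMap hl v).choose_spec F

theorem pderivAlong_comm (hl : IsLocalFilter l) (v w : E) (φ : GermAlong l) :
    pderivAlong hl v (pderivAlong hl w φ) = pderivAlong hl w (pderivAlong hl v φ) := by
  obtain ⟨F, rfl⟩ := germ_surjective φ
  simp only [pderivAlong_germ]
  rw [germ_eq_iff]
  filter_upwards [F.2] with τ h
  have h' : ContDiffAt ℝ ∞ (fun y => (F : ι × E → ℂ) (τ.1, y)) τ.2 := h
  have hd : DifferentiableAt ℝ (fderiv ℝ (fun y => (F : ι × E → ℂ) (τ.1, y))) τ.2 :=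
    (h'.fderiv_right (m := ∞) (by simp)).differentiableAt (by simp)
  have e : ∀ v w, fderiv ℝ (fun y => fderiv ℝ (fun y => (F : ι × E → ℂ) (τ.1, y)) y w) τ.2 v =
      fderiv ℝ (fderiv ℝ (fun y => (F : ι × E → ℂ) (τ.1, y))) τ.2 v w := fun v w => by
    rw [fderiv_clm_apply hd (differentiableAt_const w)]
    simp
  have hs : IsSymmSndFDerivAt ℝ (fun y => (F : ι × E → ℂ) (τ.1, y)) τ.2 :=
    h'.isSymmSndFDerivAt (by
    rw [minSmoothness_of_isRCLikeNormedField]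
    exact WithTop.coe_le_coe.2 (le_top : (2 : ℕ∞) ≤ ⊤))
  change fderiv ℝ (fun y => fderiv ℝ (fun y => (F : ι × E → ℂ) (τ.1, y)) y w) τ.2 v =
    fderiv ℝ (fun y => fderiv ℝ (fun y => (F : ι × E → ℂ) (τ.1, y)) y v) τ.2 w
  rw [e, e]
  exact hs v w

/-! ### Functions of finitely many functions -/

variable {J : Type*} [Fintype J]

/-- The germs that are `C^r` functions of the given functions `Y j`, near the values `y₀ j`. -/
def functionsOf (r : WithTop ℕ∞) (Y : J → smoothAlong l) (y₀ : J → ℂ) :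
    Subalgebra ℂ (GermAlong l) where
  carrier := {φ | ∃ F : smoothAlong l, germ F = φ ∧ ∃ G : (J → ℂ) → ℂ, SmoothNearAt r G y₀ ∧
    ∀ᶠ τ in l, (F : ι × E → ℂ) τ = G fun j => (Y j : ι × E → ℂ) τ}
  mul_mem' := by
    rintro _ _ ⟨F, rfl, G, hG, hFG⟩ ⟨F', rfl, G', hG', hFG'⟩
    refine ⟨F * F', rfl, _, hG.mul hG', ?_⟩
    filter_upwards [hFG, hFG'] with τ h₁ h₂
    simp [h₁, h₂]
  add_mem' := by
    rintro _ _ ⟨F, rfl, G, hG, hFG⟩ ⟨F', rfl, G', hG', hFG'⟩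
    refine ⟨F + F', rfl, _, hG.add hG', ?_⟩
    filter_upwards [hFG, hFG'] with τ h₁ h₂
    simp [h₁, h₂]
  algebraMap_mem' z := ⟨algebraMap ℂ _ z, rfl, fun _ => z, SmoothNearAt.const z,
    Eventually.of_forall fun _ => rfl⟩

variable {r : WithTop ℕ∞} {Y : J → smoothAlong l} {y₀ : J → ℂ}

theorem mem_functionsOf {F : smoothAlong l} {G : (J → ℂ) → ℂ} (hG : SmoothNearAt r G y₀)
    (h : ∀ᶠ τ in l, (F : ι × E → ℂ) τ = G fun j => (Y j : ι × E → ℂ) τ) :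
    germ F ∈ functionsOf r Y y₀ := ⟨F, rfl, G, hG, h⟩

theorem exists_of_mem_functionsOf {F : smoothAlong l} (h : germ F ∈ functionsOf r Y y₀) :
    ∃ G : (J → ℂ) → ℂ, SmoothNearAt r G y₀ ∧
      ∀ᶠ τ in l, (F : ι × E → ℂ) τ = G fun j => (Y j : ι × E → ℂ) τ := by
  obtain ⟨F', hF', G, hG, h'⟩ := h
  refine ⟨G, hG, ?_⟩
  filter_upwards [germ_eq_iff.1 hF', h'] with τ h₁ h₂
  rw [← h₁, h₂]

theorem germ_mem_functionsOf (j : J) : germ (Y j) ∈ functionsOf r Y y₀ :=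
  mem_functionsOf (G := fun w => w j) (.of_contDiff (contDiff_apply ℝ ℂ j))
    (Eventually.of_forall fun _ => rfl)

/-- The complex conjugate of a function. -/
def conjFun (F : smoothAlong l) : smoothAlong l :=
  ⟨fun τ => (starRingEnd ℂ) ((F : ι × E → ℂ) τ), by
    filter_upwards [F.2] with τ h
    exact (Complex.conjCLE.contDiff.contDiffAt).comp _ h⟩

theorem tendsto_of_mem_functionsOf (hY : ∀ j, Tendsto (Y j : ι × E → ℂ) l (𝓝 (y₀ j)))
    {F : smoothAlong l} {G : (J → ℂ) → ℂ} (hG : SmoothNearAt r G y₀)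
    (h : ∀ᶠ τ in l, (F : ι × E → ℂ) τ = G fun j => (Y j : ι × E → ℂ) τ) :
    Tendsto (F : ι × E → ℂ) l (𝓝 (G y₀)) :=
  Tendsto.congr' (Filter.EventuallyEq.symm h)
    (hG.contDiffAt.continuousAt.tendsto.comp (tendsto_pi_nhds.2 hY))

/-- Substitution of functions. The inner functions take the values `y₀` at `y₀'` because both are
limits along the same proper filter, so the outer function is evaluated where it is smooth. -/
theorem functionsOf_le [l.NeBot] {J' : Type*} [Fintype J'] {Y' : J' → smoothAlong l}
    {y₀' : J' → ℂ} (hY : ∀ j, Tendsto (Y j : ι × E → ℂ) l (𝓝 (y₀ j)))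
    (hY' : ∀ j, Tendsto (Y' j : ι × E → ℂ) l (𝓝 (y₀' j)))
    (h : ∀ j, germ (Y j) ∈ functionsOf r Y' y₀') : functionsOf r Y y₀ ≤ functionsOf r Y' y₀' := by
  rintro _ ⟨F, rfl, G, hG, hFG⟩
  choose G' hG' hYG' using fun j => exists_of_mem_functionsOf (h j)
  have e : (fun j => G' j y₀') = y₀ := funext fun j =>
    tendsto_nhds_unique (tendsto_of_mem_functionsOf hY' (hG' j) (hYG' j)) (hY j)
  refine mem_functionsOf (G := fun w => G fun j => G' j w) ?_ ?_
  · exact SmoothNearAt.comp (F := fun w j => G' j w) (by rwa [e]) (SmoothNearAt.pi hG')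
  · filter_upwards [hFG, Filter.eventually_all.2 hYG'] with τ h₁ h₂
    rw [h₁]
    congr 1
    exact funext h₂

/-- The limit of a germ along `l`. -/
def germLim (φ : GermAlong l) : ℂ :=
  limUnder l ((germ_surjective φ).choose : ι × E → ℂ)

theorem germLim_eq [l.NeBot] {F : smoothAlong l} {z : ℂ} (h : Tendsto (F : ι × E → ℂ) l (𝓝 z)) :
    germLim (germ F) = z := by
  refine Tendsto.limUnder_eq (h.congr' ?_)
  exact (germ_eq_iff.1 (germ_surjective (germ F)).choose_spec).symm

theorem exists_tendsto_of_mem (hY : ∀ j, Tendsto (Y j : ι × E → ℂ) l (𝓝 (y₀ j)))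
    {φ : GermAlong l} (hφ : φ ∈ functionsOf r Y y₀) : ∃ (F : smoothAlong l) (z : ℂ),
      germ F = φ ∧ Tendsto (F : ι × E → ℂ) l (𝓝 z) := by
  obtain ⟨F, hF, G, hG, h⟩ := hφ
  exact ⟨F, _, hF, tendsto_of_mem_functionsOf hY hG h⟩

/-- The evaluation of germs at the base point. -/
def germEval [l.NeBot] (hY : ∀ j, Tendsto (Y j : ι × E → ℂ) l (𝓝 (y₀ j))) :
    functionsOf r Y y₀ →ₐ[ℂ] ℂ where
  toFun φ := germLim φ.1
  map_one' := germLim_eq (F := 1) tendsto_const_nhds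
  map_zero' := germLim_eq (F := 0) tendsto_const_nhds
  map_mul' := by
    rintro ⟨_, h₁⟩ ⟨_, h₂⟩
    obtain ⟨F, z, rfl, hF⟩ := exists_tendsto_of_mem hY h₁
    obtain ⟨G, w, rfl, hG⟩ := exists_tendsto_of_mem hY h₂
    simp only [MulMemClass.mk_mul_mk, ← germ_mul]
    rw [germLim_eq hF, germLim_eq hG]
    exact germLim_eq (F := F * G) (hF.mul hG)
  map_add' := by
    rintro ⟨_, h₁⟩ ⟨_, h₂⟩
    obtain ⟨F, z, rfl, hF⟩ := exists_tendsto_of_mem hY h₁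
    obtain ⟨G, w, rfl, hG⟩ := exists_tendsto_of_mem hY h₂
    simp only [AddMemClass.mk_add_mk, ← germ_add]
    rw [germLim_eq hF, germLim_eq hG]
    exact germLim_eq (F := F + G) (hF.add hG)
  commutes' z := germLim_eq (F := algebraMap ℂ _ z) tendsto_const_nhds

theorem germEval_eq [l.NeBot] (hY : ∀ j, Tendsto (Y j : ι × E → ℂ) l (𝓝 (y₀ j)))
    {F : smoothAlong l} (hF : germ F ∈ functionsOf r Y y₀) {z : ℂ}
    (h : Tendsto (F : ι × E → ℂ) l (𝓝 z)) : germEval hY ⟨germ F, hF⟩ = z := germLim_eq h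

/-- A function with nonzero limit is nonzero along the filter, and its reciprocal is again `C^r` in
the generators near their base values. -/
theorem isUnit_of_germEval [l.NeBot]
    (hY : ∀ j, Tendsto (Y j : ι × E → ℂ) l (𝓝 (y₀ j)))
    (s : functionsOf r Y y₀) (hs : germEval hY s ≠ 0) : IsUnit s := by
  obtain ⟨_, F, rfl, G, hG, h⟩ := s
  have hF := tendsto_of_mem_functionsOf hY hG h
  replace hs : G y₀ ≠ 0 := fun h₀ => hs ((germEval_eq hY _ hF).trans h₀)
  have hF0 : ∀ᶠ τ in l, (F : ι × E → ℂ) τ ≠ 0 := hF.eventually_ne hs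
  let F' : smoothAlong l := ⟨fun τ => ((F : ι × E → ℂ) τ)⁻¹, by
    filter_upwards [F.2, hF0] with τ h₁ h₂
    exact ContDiffAt.inv h₁ h₂⟩
  have hF' : germ F' ∈ functionsOf r Y y₀ := by
    refine mem_functionsOf (G := fun w => (G w)⁻¹) ?_ ?_
    · filter_upwards [hG, hG.contDiffAt.continuousAt.eventually_ne hs] with y h₁ h₂
      exact h₁.inv h₂
    · filter_upwards [h] with τ h
      simp [F', h]
  have h₁ : germ F * germ F' = 1 := by
    change germ F * germ F' = germ 1
    rw [← germ_mul, germ_eq_iff]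
    filter_upwards [hF0] with τ h
    exact mul_inv_cancel₀ h
  have h₂ : germ F' * germ F = 1 := (mul_comm (germ F') (germ F)).trans h₁
  exact ⟨⟨_, ⟨germ F', hF'⟩, Subtype.ext h₁, Subtype.ext h₂⟩, rfl⟩

/-- The chain rule, in terms of Wirtinger derivatives. -/
theorem exists_wirtinger (hl : IsLocalFilter l) (hr : ∞ ≤ r) (hr' : r + 1 ≤ r)
    (hY : ∀ j, Tendsto (Y j : ι × E → ℂ) l (𝓝 (y₀ j)))
    {φ : GermAlong l} (hφ : φ ∈ functionsOf r Y y₀) :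
    ∃ P Q : J → GermAlong l, (∀ j, P j ∈ functionsOf r Y y₀) ∧ (∀ j, Q j ∈ functionsOf r Y y₀) ∧
      ∀ v, pderivAlong hl v φ = ∑ j, (P j * pderivAlong hl v (germ (Y j)) +
        Q j * pderivAlong hl v (germ (conjFun (Y j)))) := by
  classical
  obtain ⟨F, rfl, G, hG, h⟩ := hφ
  have hYt : Tendsto (fun τ j => (Y j : ι × E → ℂ) τ) l (𝓝 y₀) := tendsto_pi_nhds.2 hY
  have hsub : ∀ {H : (J → ℂ) → ℂ}, SmoothNearAt r H y₀ →
      (fun τ => H fun j => (Y j : ι × E → ℂ) τ) ∈ smoothAlong l := fun {H} hH => by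
    have hY' : ∀ᶠ τ in l, ∀ j, ContDiffAt ℝ ∞ (fun y => (Y j : ι × E → ℂ) (τ.1, y)) τ.2 :=
      Filter.eventually_all.2 fun j => (Y j).2
    filter_upwards [hYt.eventually hH, hY'] with τ h₁ h₂
    exact (h₁.of_le hr).comp (f := fun y j => (Y j : ι × E → ℂ) (τ.1, y)) τ.2 (contDiffAt_pi.2 h₂)
  -- The Wirtinger derivatives `∂G/∂w_j` and, as `q`, `∂G/∂w̄_j`. Since `G` is only differentiable
  -- over `ℝ`, the conjugate generators must appear as well.
  let p : J → (J → ℂ) → ℂ := fun j w => (1 / 2) * (fderiv ℝ G w (Pi.single j 1) -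
    Complex.I * fderiv ℝ G w (Pi.single j Complex.I))
  let q : J → (J → ℂ) → ℂ := fun j w => (1 / 2) * (fderiv ℝ G w (Pi.single j 1) +
    Complex.I * fderiv ℝ G w (Pi.single j Complex.I))
  have hp : ∀ j, SmoothNearAt r (p j) y₀ := fun j => (SmoothNearAt.const _).mul
    ((hG.fderiv_apply hr' _).sub ((SmoothNearAt.const _).mul (hG.fderiv_apply hr' _)))
  have hq : ∀ j, SmoothNearAt r (q j) y₀ := fun j => (SmoothNearAt.const _).mul
    ((hG.fderiv_apply hr' _).add ((SmoothNearAt.const _).mul (hG.fderiv_apply hr' _)))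
  refine ⟨fun j => germ ⟨_, hsub (hp j)⟩, fun j => germ ⟨_, hsub (hq j)⟩,
    fun j => mem_functionsOf (hp j) (Eventually.of_forall fun _ => rfl),
    fun j => mem_functionsOf (hq j) (Eventually.of_forall fun _ => rfl), fun v => ?_⟩
  simp only [pderivAlong_germ, ← germ_mul, ← germ_add, ← germ_sum]
  rw [germ_eq_iff]
  have hYd : ∀ᶠ τ in l, ∀ j, DifferentiableAt ℝ (fun y => (Y j : ι × E → ℂ) (τ.1, y)) τ.2 :=
    Filter.eventually_all.2 fun j => differentiableAt_of_mem (Y j)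
  filter_upwards [hl.eventually_nhds h, hYt.eventually (hG.differentiableAt hr), hYd] with τ h₁ h₂ h₃
  have e₁ : fderiv ℝ (fun y => (F : ι × E → ℂ) (τ.1, y)) τ.2 v =
      fderiv ℝ G (fun j => (Y j : ι × E → ℂ) τ)
        (fun j => fderiv ℝ (fun y => (Y j : ι × E → ℂ) (τ.1, y)) τ.2 v) := by
    have h₁' : (fun y => (F : ι × E → ℂ) (τ.1, y)) =ᶠ[𝓝 τ.2]
      G ∘ (fun y j => (Y j : ι × E → ℂ) (τ.1, y)) := h₁
    rw [h₁'.fderiv_eq, fderiv_comp τ.2 h₂ (differentiableAt_pi.2 h₃), fderiv_pi h₃]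
    rfl
  have e₂ : ∀ (L : (J → ℂ) →L[ℝ] ℂ) (w : J → ℂ), L w = ∑ j,
      ((1 / 2) * (L (Pi.single j 1) - Complex.I * L (Pi.single j Complex.I)) * w j +
        (1 / 2) * (L (Pi.single j 1) + Complex.I * L (Pi.single j Complex.I)) *
          (starRingEnd ℂ) (w j)) := fun L w => by
    conv_lhs => rw [← Finset.univ_sum_single w, map_sum]
    refine Finset.sum_congr rfl fun j _ => ?_
    have : (Pi.single j (w j) : J → ℂ) = (w j).re • (Pi.single j 1 : J → ℂ) +
        (w j).im • (Pi.single j Complex.I : J → ℂ) := by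
      rw [← Pi.single_smul, ← Pi.single_smul, ← Pi.single_add]
      congr 1
      simp [Complex.re_add_im]
    rw [this, map_add, map_smul, map_smul, Complex.real_smul, Complex.real_smul,
      Complex.re_eq_add_conj, Complex.im_eq_sub_conj]
    have hI := Complex.I_ne_zero
    field_simp
    ring_nf
    rw [Complex.I_sq]
    ring
  have e₃ : ∀ j, fderiv ℝ (fun y => (conjFun (Y j) : ι × E → ℂ) (τ.1, y)) τ.2 v =
      (starRingEnd ℂ) (fderiv ℝ (fun y => (Y j : ι × E → ℂ) (τ.1, y)) τ.2 v) := fun j => by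
    have := (Complex.conjCLE : ℂ →L[ℝ] ℂ).hasFDerivAt.comp τ.2 (h₃ j).hasFDerivAt
    exact congrArg (fun L => L v) this.fderiv
  have e₄ := e₂ (fderiv ℝ G (fun j => (Y j : ι × E → ℂ) τ))
    (fun j => fderiv ℝ (fun y => (Y j : ι × E → ℂ) (τ.1, y)) τ.2 v)
  refine (e₁.trans e₄).trans ?_
  simp only [AddSubmonoidClass.coe_finsetSum, Finset.sum_apply]
  refine Finset.sum_congr rfl fun j _ => ?_
  rw [← e₃ j]
  rfl

end GermAlgebra

/-! ### Structure equations -/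

section StructureEquations

variable {R ι κ : Type*} [CommRing R] [Algebra ℂ R] [Fintype ι] [Fintype κ] [DecidableEq ι]
  [DecidableEq κ]

theorem eq_sum_dual_frame {p : κ → R} {D : ι → R} {z : ι → κ → R} {h : κ → ι → R}
    (hD : ∀ i, D i = ∑ k, z i k * p k)
    (hz : ∀ k l, ∑ i, h k i * z i l = if k = l then 1 else 0) (k : κ) : p k = ∑ i, h k i * D i := by
  simp only [hD, Finset.mul_sum]
  rw [Finset.sum_comm]
  simp only [← mul_assoc, ← Finset.sum_mul, hz]
  simp

/-- Second-order terms cancel because the `pd k` commute. -/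
theorem derivation_commutator {D : ι → Derivation ℂ R R} {pd : κ → Derivation ℂ R R}
    {z : ι → κ → R} (hpd : ∀ k l φ, pd k (pd l φ) = pd l (pd k φ))
    (hD : ∀ i φ, D i φ = ∑ k, z i k * pd k φ) (i j : ι) (φ : R) :
    D i (D j φ) - D j (D i φ) = ∑ l, (D i (z j l) - D j (z i l)) * pd l φ := by
  have e : ∀ i j, D i (D j φ) = ∑ l, D i (z j l) * pd l φ +
      ∑ k, ∑ l, z i k * z j l * pd k (pd l φ) := fun i j => by
    conv_lhs => rw [hD j, map_sum]
    simp only [Derivation.leibniz, smul_eq_mul, Finset.sum_add_distrib]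
    rw [add_comm]
    congr 1
    · exact Finset.sum_congr rfl fun l _ => mul_comm (pd l φ) _
    · simp only [hD, Finset.mul_sum]
      rw [Finset.sum_comm]
      exact Finset.sum_congr rfl fun _ _ => Finset.sum_congr rfl fun _ _ => by ring
  have e' : ∑ k, ∑ l, z i k * z j l * pd k (pd l φ) = ∑ k, ∑ l, z j k * z i l * pd k (pd l φ) := by
    rw [Finset.sum_comm]
    exact Finset.sum_congr rfl fun k _ => Finset.sum_congr rfl fun l _ => by
      rw [hpd l k, mul_comm (z i l)]
  rw [e i j, e j i, e']
  simp only [sub_mul, Finset.sum_sub_distrib]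
  ring

theorem frame_commutator {D : ι → Derivation ℂ R R} {pd : κ → Derivation ℂ R R}
    {z : ι → κ → R} {h : κ → ι → R} (hpd : ∀ k l φ, pd k (pd l φ) = pd l (pd k φ))
    (hD : ∀ i φ, D i φ = ∑ k, z i k * pd k φ)
    (hz : ∀ k l, ∑ i, h k i * z i l = if k = l then 1 else 0) (i j : ι) (φ : R) :
    D i (D j φ) - D j (D i φ) = ∑ k, (∑ l, (D i (z j l) - D j (z i l)) * h l k) * D k φ := by
  rw [derivation_commutator hpd hD]
  simp only [fun l => eq_sum_dual_frame (fun i => hD i φ) hz l, Finset.mul_sum, Finset.sum_mul]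
  rw [Finset.sum_comm]
  exact Finset.sum_congr rfl fun _ _ => Finset.sum_congr rfl fun _ _ => by ring

/-- Evaluate the frame commutator on the components `f s` of the map, expand `D_i f = A z'`, and use
the chain rule for `D_i z'`. Pairing with the dual coframe `h` isolates the derivatives of `A`. -/
theorem frame_structure_eq {D : ι → Derivation ℂ R R} {f : κ → R} {A : ι → ι → R}
    {z : ι → κ → R} {h : κ → ι → R} {dz : ι → ι → κ → R} {C C' : ι → ι → ι → R}
    (hcomm : ∀ i j φ, D i (D j φ) - D j (D i φ) = ∑ k, C i j k * D k φ)
    (hA : ∀ i j, A i j = ∑ s, D i (f s) * h s j)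
    (hf : ∀ i s, D i (f s) = ∑ j, A i j * z j s)
    (hz : ∀ i j, ∑ k, z i k * h k j = if i = j then 1 else 0)
    (hdz : ∀ i t q, D i (z t q) = ∑ k, A i k * dz k t q)
    (hC' : ∀ k t q, C' k t q = ∑ s, (dz k t s - dz t k s) * h s q) (i j q : ι) :
    D i (A j q) - D j (A i q) =
      ∑ k, C i j k * A k q - ∑ k, ∑ l, A i k * A j l * C' k l q := by
  have e₁ : ∀ s, ∑ t, (D i (A j t) - D j (A i t)) * z t s =
      ∑ k, C i j k * D k (f s) - ∑ k, ∑ t, A i k * A j t * (dz k t s - dz t k s) := fun s => by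
    have h₁ := hcomm i j (f s)
    rw [hf i, hf j] at h₁
    simp only [map_sum, Derivation.leibniz, smul_eq_mul, Finset.sum_add_distrib, hdz] at h₁
    have h₂ : ∑ k, ∑ t, A i k * A j t * (dz k t s - dz t k s) =
        ∑ t, A j t * ∑ k, A i k * dz k t s - ∑ k, A i k * ∑ t, A j t * dz t k s := by
      simp only [Finset.mul_sum, mul_sub, Finset.sum_sub_distrib]
      congr 1
      · rw [Finset.sum_comm]
        exact Finset.sum_congr rfl fun _ _ => Finset.sum_congr rfl fun _ _ => by ring
      · exact Finset.sum_congr rfl fun _ _ => Finset.sum_congr rfl fun _ _ => by ring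
    rw [h₂, ← h₁]
    simp only [sub_mul, Finset.sum_sub_distrib, mul_comm (z _ s)]
    ring
  have e₂ : D i (A j q) - D j (A i q) =
      ∑ s, (∑ t, (D i (A j t) - D j (A i t)) * z t s) * h s q := by
    simp only [Finset.sum_mul]
    rw [Finset.sum_comm]
    simp only [mul_assoc, ← Finset.mul_sum, hz]
    simp
  rw [e₂]
  simp only [e₁]
  simp only [sub_mul, Finset.sum_sub_distrib]
  congr 1
  · simp only [hA, Finset.mul_sum, Finset.sum_mul]
    rw [Finset.sum_comm]
    exact Finset.sum_congr rfl fun _ _ => Finset.sum_congr rfl fun _ _ => by ring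
  · simp only [hC', Finset.mul_sum, Finset.sum_mul]
    rw [Finset.sum_comm]
    refine Finset.sum_congr rfl fun _ _ => ?_
    rw [Finset.sum_comm]
    exact Finset.sum_congr rfl fun _ _ => Finset.sum_congr rfl fun _ _ => by ring

theorem sum_mul_sum_mul_comm (a : κ → R) (b : ι → R) (c : κ → ι → R) :
    ∑ k, a k * ∑ i, b i * c k i = ∑ i, b i * ∑ k, a k * c k i := by
  simp only [Finset.mul_sum]
  rw [Finset.sum_comm]
  exact Finset.sum_congr rfl fun _ _ => Finset.sum_congr rfl fun _ _ => by ring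

theorem sum_mul_sum_mul_comm' (a : κ → R) (b : ι → R) (c : ι → κ → R) :
    ∑ k, a k * ∑ i, b i * c i k = ∑ i, b i * ∑ k, c i k * a k := by
  simp only [Finset.mul_sum]
  rw [Finset.sum_comm]
  exact Finset.sum_congr rfl fun _ _ => Finset.sum_congr rfl fun _ _ => by ring

end StructureEquations

/-! ### Conjugation of germs -/

section GermConj

variable {ι E : Type*} [NormedAddCommGroup E] [NormedSpace ℝ E] {l : Filter (ι × E)}

/-- Complex conjugation of germs. -/
def germConj : GermAlong l →+* GermAlong l :=
  (Ideal.Quotient.lift (vanishingAlong l)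
    ({ toFun := fun F => germ (conjFun F)
       map_one' := germ_eq_iff.2 (Eventually.of_forall fun _ => map_one _)
       map_zero' := germ_eq_iff.2 (Eventually.of_forall fun _ => map_zero _)
       map_mul' := fun _ _ => germ_eq_iff.2 (Eventually.of_forall fun _ => map_mul _ _ _)
       map_add' := fun _ _ => germ_eq_iff.2 (Eventually.of_forall fun _ => map_add _ _ _) } :
      smoothAlong l →+* GermAlong l)
    fun F hF => germ_eq_iff.2 (by
      filter_upwards [hF] with τ h
      exact (congrArg (starRingEnd ℂ) h).trans (map_zero _)) :
    smoothAlong l ⧸ vanishingAlong l →+* GermAlong l)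

theorem germConj_germ (F : smoothAlong l) : germConj (germ F) = germ (conjFun F) := rfl

theorem fderiv_conj_apply {F : E → ℂ} {x : E} (h : DifferentiableAt ℝ F x) (v : E) :
    fderiv ℝ (fun y => (starRingEnd ℂ) (F y)) x v = (starRingEnd ℂ) (fderiv ℝ F x v) := by
  have := (Complex.conjCLE : ℂ →L[ℝ] ℂ).hasFDerivAt.comp x h.hasFDerivAt
  exact congrArg (fun L : E →L[ℝ] ℂ => L v) this.fderiv

theorem germConj_pderivAlong (hl : IsLocalFilter l) (v : E) (φ : GermAlong l) :
    germConj (pderivAlong hl v φ) = pderivAlong hl v (germConj φ) := by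
  obtain ⟨F, rfl⟩ := germ_surjective φ
  rw [pderivAlong_germ, germConj_germ, germConj_germ, pderivAlong_germ, germ_eq_iff]
  filter_upwards [differentiableAt_of_mem F] with τ h
  exact (fderiv_conj_apply h v).symm

/-- The Wirtinger chain rule for a complex direction: conjugate generators need separate control, as
differentiation along a complex vector does not commute with conjugation. -/
theorem derivation_mem_of_functionsOf {J K : Type*} [Fintype J] [Fintype K] {r : WithTop ℕ∞}
    {Y : J → smoothAlong l} {y₀ : J → ℂ} (hl : IsLocalFilter l) (hr : ∞ ≤ r) (hr' : r + 1 ≤ r)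
    (hY : ∀ j, Tendsto (Y j : ι × E → ℂ) l (𝓝 (y₀ j))) (v : K → E) (z : K → GermAlong l)
    (D : Derivation ℂ (GermAlong l) (GermAlong l))
    (hD : ∀ φ, D φ = ∑ k, z k * pderivAlong hl (v k) φ)
    {S : Subalgebra ℂ (GermAlong l)} (hS : functionsOf r Y y₀ ≤ S)
    (h₁ : ∀ j, D (germ (Y j)) ∈ S) (h₂ : ∀ j, D (germConj (germ (Y j))) ∈ S)
    {φ : GermAlong l} (hφ : φ ∈ functionsOf r Y y₀) : D φ ∈ S := by
  obtain ⟨P, Q, hP, hQ, h⟩ := exists_wirtinger hl hr hr' hY hφ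
  have e : D φ = ∑ j, (P j * D (germ (Y j)) + Q j * D (germConj (germ (Y j)))) := by
    simp only [hD, h, Finset.mul_sum, germConj_germ, ← Finset.sum_add_distrib]
    rw [Finset.sum_comm]
    exact Finset.sum_congr rfl fun _ _ => Finset.sum_congr rfl fun _ _ => by ring
  rw [e]
  exact sum_mem fun j _ => add_mem (mul_mem (hS (hP j)) (h₁ j)) (mul_mem (hS (hQ j)) (h₂ j))

theorem tendsto_germLim [l.NeBot] {J : Type*} [Fintype J] {r : WithTop ℕ∞}
    {Y : J → smoothAlong l} {y₀ : J → ℂ} (hY : ∀ j, Tendsto (Y j : ι × E → ℂ) l (𝓝 (y₀ j)))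
    {F : smoothAlong l} (hF : germ F ∈ functionsOf r Y y₀) :
    Tendsto (F : ι × E → ℂ) l (𝓝 (germLim (germ F))) := by
  obtain ⟨F', z, hF', hz⟩ := exists_tendsto_of_mem hY hF
  have := hz.congr' (germ_eq_iff.1 hF')
  rwa [germLim_eq this]

end GermConj

/-! ### Complex frames in coordinates -/

/-- The vectors of the standard basis. -/
abbrev stdVec {m : ℕ} (k : Fin m) : EuclideanSpace ℝ (Fin m) := EuclideanSpace.single k 1

/-- The conjugate index. -/
def FrameIdx.bar {n : ℕ} : FrameIdx n → FrameIdx n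
  | none => none
  | some (p, α) => some (!p, α)

/-- A frame of the complexified tangent bundle near a point of a coordinate space, indexed by
`FrameIdx n`, compatible with conjugation, together with its dual coframe. -/
structure ComplexFrame (n m : ℕ) (r : WithTop ℕ∞) (x₀ : EuclideanSpace ℝ (Fin m)) where
  vec : FrameIdx n → Fin m → EuclideanSpace ℝ (Fin m) → ℂ
  covec : Fin m → FrameIdx n → EuclideanSpace ℝ (Fin m) → ℂ
  smooth_vec : ∀ i k, SmoothNearAt r (vec i k) x₀
  smooth_covec : ∀ k i, SmoothNearAt r (covec k i) x₀
  vec_covec : ∀ᶠ y in 𝓝 x₀, ∀ i j, ∑ k, vec i k y * covec k j y = if i = j then 1 else 0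
  covec_vec : ∀ᶠ y in 𝓝 x₀, ∀ k l, ∑ i, covec k i y * vec i l y = if k = l then 1 else 0
  conj_vec : ∀ᶠ y in 𝓝 x₀, ∀ i k, (starRingEnd ℂ) (vec i k y) = vec i.bar k y
  conj_covec : ∀ᶠ y in 𝓝 x₀, ∀ k i, (starRingEnd ℂ) (covec k i y) = covec k i.bar y

namespace ComplexFrame

variable {n m : ℕ} {r : WithTop ℕ∞} {x₀ : EuclideanSpace ℝ (Fin m)} (Z : ComplexFrame n m r x₀)

/-- The structure functions of a frame. -/
def structFun (i j k : FrameIdx n) (y : EuclideanSpace ℝ (Fin m)) : ℂ :=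
  ∑ l, (∑ s, Z.vec i s y * fderiv ℝ (Z.vec j l) y (stdVec s) -
    ∑ s, Z.vec j s y * fderiv ℝ (Z.vec i l) y (stdVec s)) * Z.covec l k y

theorem smooth_structFun (hr : r + 1 ≤ r) (i j k : FrameIdx n) :
    SmoothNearAt r (Z.structFun i j k) x₀ :=
  SmoothNearAt.sum fun l _ => ((SmoothNearAt.sum fun s _ => (Z.smooth_vec i s).mul
    ((Z.smooth_vec j l).fderiv_apply hr _)).sub (SmoothNearAt.sum fun s _ =>
      (Z.smooth_vec j s).mul ((Z.smooth_vec i l).fderiv_apply hr _))).mul (Z.smooth_covec l k)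

theorem structFun_antisymm (i j k : FrameIdx n) (y : EuclideanSpace ℝ (Fin m)) :
    Z.structFun i j k y = -Z.structFun j i k y := by
  simp only [structFun, ← Finset.sum_neg_distrib]
  exact Finset.sum_congr rfl fun _ _ => by ring

end ComplexFrame

/-- The matrix, in two frames, of a linear map. -/
def frameMatrix {n m : ℕ} {r : WithTop ℕ∞} {x₀ y₀ : EuclideanSpace ℝ (Fin m)}
    (Z : ComplexFrame n m r x₀) (Z' : ComplexFrame n m r y₀)
    (x y : EuclideanSpace ℝ (Fin m))
    (B : EuclideanSpace ℝ (Fin m) →L[ℝ] EuclideanSpace ℝ (Fin m)) (i j : FrameIdx n) : ℂ :=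
  ∑ s, (∑ k, Z.vec i k x * ((B (stdVec k) s : ℝ) : ℂ)) * Z'.covec s j y

/-- A filter of pairs (map, point) converging in the space of `2`-jets, such that the maps have
adapted matrices in two complex frames. -/
structure CRGermData (n m : ℕ) (r : WithTop ℕ∞) where
  hr : ∞ ≤ r
  hr' : r + 1 ≤ r
  x₀ : EuclideanSpace ℝ (Fin m)
  y₀ : EuclideanSpace ℝ (Fin m)
  Z : ComplexFrame n m r x₀
  Z' : ComplexFrame n m r y₀
  B₁ : EuclideanSpace ℝ (Fin m) →L[ℝ] EuclideanSpace ℝ (Fin m)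
  B₂ : EuclideanSpace ℝ (Fin m) →L[ℝ] EuclideanSpace ℝ (Fin m) →L[ℝ] EuclideanSpace ℝ (Fin m)
  l : Filter ((EuclideanSpace ℝ (Fin m) → EuclideanSpace ℝ (Fin m)) × EuclideanSpace ℝ (Fin m))
  isLocal : IsLocalFilter l
  neBot : l.NeBot
  smooth : ∀ᶠ τ in l, ContDiffAt ℝ ∞ τ.1 τ.2
  tendsto_point : Tendsto (fun τ => τ.2) l (𝓝 x₀)
  tendsto_image : Tendsto (fun τ => τ.1 τ.2) l (𝓝 y₀)
  tendsto_fderiv : Tendsto (fun τ => fderiv ℝ τ.1 τ.2) l (𝓝 B₁)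
  tendsto_fderiv_fderiv : Tendsto (fun τ => fderiv ℝ (fderiv ℝ τ.1) τ.2) l (𝓝 B₂)
  block_none : ∀ᶠ τ in l, ∀ p α,
    frameMatrix Z Z' τ.2 (τ.1 τ.2) (fderiv ℝ τ.1 τ.2) (some (p, α)) none = 0
  block_not : ∀ᶠ τ in l, ∀ p α β,
    frameMatrix Z Z' τ.2 (τ.1 τ.2) (fderiv ℝ τ.1 τ.2) (some (p, α)) (some (!p, β)) = 0
  base_diag : ∀ p α β, frameMatrix Z Z' x₀ y₀ B₁ (some (p, α)) (some (p, β)) =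
    if α = β then 1 else 0
  base_none : frameMatrix Z Z' x₀ y₀ B₁ none none = 1
  levi_nondegenerate : (Matrix.of fun α β =>
    Z.structFun (some (false, α)) (some (true, β)) none x₀).det ≠ 0

/-! ### Structure equations of a family of CR maps, as identities of germs -/

namespace CRGermData

variable {n m : ℕ} {r : WithTop ℕ∞} (𝒟 : CRGermData n m r)

abbrev Gm : Type := GermAlong 𝒟.l

instance : 𝒟.l.NeBot := 𝒟.neBot

/-- A function of the source point. -/
def src (c : EuclideanSpace ℝ (Fin m) → ℂ) (hc : SmoothNearAt r c 𝒟.x₀) : smoothAlong 𝒟.l :=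
  ⟨fun τ => c τ.2, by
    filter_upwards [𝒟.tendsto_point.eventually hc] with τ h using h.of_le 𝒟.hr⟩

/-- A function of the target point. -/
def tgt (c : EuclideanSpace ℝ (Fin m) → ℂ) (hc : SmoothNearAt r c 𝒟.y₀) : smoothAlong 𝒟.l :=
  ⟨fun τ => c (τ.1 τ.2), by
    filter_upwards [𝒟.tendsto_image.eventually hc, 𝒟.smooth] with τ h₁ h₂
    exact (h₁.of_le 𝒟.hr).comp τ.2 h₂⟩

def coordFn {m : ℕ} (k : Fin m) (y : EuclideanSpace ℝ (Fin m)) : ℂ := ((y k : ℝ) : ℂ)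

theorem contDiff_coordFn (k : Fin m) : ContDiff ℝ r (coordFn (m := m) k) :=
  Complex.ofRealCLM.contDiff.comp (EuclideanSpace.proj k : EuclideanSpace ℝ (Fin m) →L[ℝ] ℝ).contDiff

/-- The coordinates of the source point. -/
def xFun (k : Fin m) : smoothAlong 𝒟.l := 𝒟.src (coordFn k) (.of_contDiff (contDiff_coordFn k))

/-- The coordinates of the target point. -/
def fFun (k : Fin m) : smoothAlong 𝒟.l := 𝒟.tgt (coordFn k) (.of_contDiff (contDiff_coordFn k))

/-- The partial derivatives of germs. -/
def pd (k : Fin m) : Derivation ℂ 𝒟.Gm 𝒟.Gm := pderivAlong 𝒟.isLocal (stdVec k)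

theorem pd_comm (k l : Fin m) (φ : 𝒟.Gm) : 𝒟.pd k (𝒟.pd l φ) = 𝒟.pd l (𝒟.pd k φ) :=
  pderivAlong_comm _ _ _ _

theorem fderiv_coordFn (k : Fin m) (y v : EuclideanSpace ℝ (Fin m)) :
    fderiv ℝ (coordFn k) y v = ((v k : ℝ) : ℂ) := by
  have := (Complex.ofRealCLM.comp
    (EuclideanSpace.proj k : EuclideanSpace ℝ (Fin m) →L[ℝ] ℝ)).hasFDerivAt (x := y)
  exact congrArg (fun L : _ →L[ℝ] ℂ => L v) this.fderiv

theorem fderiv_coordFn_comp {g : EuclideanSpace ℝ (Fin m) → EuclideanSpace ℝ (Fin m)}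
    {x : EuclideanSpace ℝ (Fin m)} (hg : DifferentiableAt ℝ g x) (k : Fin m)
    (v : EuclideanSpace ℝ (Fin m)) :
    fderiv ℝ (fun y => coordFn k (g y)) x v = ((fderiv ℝ g x v k : ℝ) : ℂ) := by
  have h := fderiv_comp x ((contDiff_coordFn (r := 1) k).differentiable (by simp) (g x)) hg
  refine (congrArg (fun L : _ →L[ℝ] ℂ => L v) h).trans ?_
  simp [fderiv_coordFn]

theorem pd_src (k : Fin m) (c : EuclideanSpace ℝ (Fin m) → ℂ) (hc : SmoothNearAt r c 𝒟.x₀) :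
    𝒟.pd k (germ (𝒟.src c hc)) =
      germ (𝒟.src (fun y => fderiv ℝ c y (stdVec k)) (hc.fderiv_apply 𝒟.hr' _)) :=
  pderivAlong_germ _ _ _

theorem sum_smul_stdVec (v : EuclideanSpace ℝ (Fin m)) : v = ∑ s, v s • stdVec s := by
  ext k
  simp [Finset.sum_apply, Pi.single_apply]

theorem pd_tgt (k : Fin m) (c : EuclideanSpace ℝ (Fin m) → ℂ) (hc : SmoothNearAt r c 𝒟.y₀) :
    𝒟.pd k (germ (𝒟.tgt c hc)) = ∑ s,
      germ (𝒟.tgt (fun y => fderiv ℝ c y (stdVec s)) (hc.fderiv_apply 𝒟.hr' _)) *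
        𝒟.pd k (germ (𝒟.fFun s)) := by
  simp only [pd, pderivAlong_germ, ← germ_mul, ← germ_sum]
  rw [germ_eq_iff]
  filter_upwards [𝒟.tendsto_image.eventually (hc.differentiableAt 𝒟.hr), 𝒟.smooth] with τ h₁ h₂
  have h₂' := h₂.differentiableAt (by simp)
  simp only [AddSubmonoidClass.coe_finsetSum, Finset.sum_apply]
  have e : fderiv ℝ (fun y => c (τ.1 y)) τ.2 (stdVec k) =
      fderiv ℝ c (τ.1 τ.2) (fderiv ℝ τ.1 τ.2 (stdVec k)) :=
    congrArg (fun L : _ →L[ℝ] ℂ => L (stdVec k)) (fderiv_comp τ.2 h₁ h₂')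
  refine e.trans ?_
  rw [sum_smul_stdVec (fderiv ℝ τ.1 τ.2 (stdVec k)), map_sum]
  refine Finset.sum_congr rfl fun s _ => ?_
  rw [map_smul, Complex.real_smul, mul_comm]
  exact congrArg _ (fderiv_coordFn_comp h₂' s _).symm

/-- The components of the source frame. -/
def z (i : FrameIdx n) (k : Fin m) : 𝒟.Gm := germ (𝒟.src (𝒟.Z.vec i k) (𝒟.Z.smooth_vec i k))

def h (k : Fin m) (i : FrameIdx n) : 𝒟.Gm := germ (𝒟.src (𝒟.Z.covec k i) (𝒟.Z.smooth_covec k i))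

def z' (i : FrameIdx n) (k : Fin m) : 𝒟.Gm := germ (𝒟.tgt (𝒟.Z'.vec i k) (𝒟.Z'.smooth_vec i k))

def h' (k : Fin m) (i : FrameIdx n) : 𝒟.Gm :=
  germ (𝒟.tgt (𝒟.Z'.covec k i) (𝒟.Z'.smooth_covec k i))

def f (k : Fin m) : 𝒟.Gm := germ (𝒟.fFun k)

theorem h_z (k l : Fin m) : ∑ i, 𝒟.h k i * 𝒟.z i l = if k = l then 1 else 0 := by
  have e : (if k = l then 1 else 0 : 𝒟.Gm) = germ (if k = l then 1 else 0) := by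
    split_ifs <;> rfl
  simp only [h, z, ← germ_mul, ← germ_sum]
  rw [e, germ_eq_iff]
  filter_upwards [𝒟.tendsto_point.eventually 𝒟.Z.covec_vec] with τ hτ
  simp only [AddSubmonoidClass.coe_finsetSum, Finset.sum_apply]
  refine (hτ k l).trans ?_
  split_ifs <;> rfl

theorem h'_z' (k l : Fin m) : ∑ i, 𝒟.h' k i * 𝒟.z' i l = if k = l then 1 else 0 := by
  have e : (if k = l then 1 else 0 : 𝒟.Gm) = germ (if k = l then 1 else 0) := by
    split_ifs <;> rfl
  simp only [h', z', ← germ_mul, ← germ_sum]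
  rw [e, germ_eq_iff]
  filter_upwards [𝒟.tendsto_image.eventually 𝒟.Z'.covec_vec] with τ hτ
  simp only [AddSubmonoidClass.coe_finsetSum, Finset.sum_apply]
  refine (hτ k l).trans ?_
  split_ifs <;> rfl

theorem z'_h' (i j : FrameIdx n) : ∑ k, 𝒟.z' i k * 𝒟.h' k j = if i = j then 1 else 0 := by
  have e : (if i = j then 1 else 0 : 𝒟.Gm) = germ (if i = j then 1 else 0) := by
    split_ifs <;> rfl
  simp only [h', z', ← germ_mul, ← germ_sum]
  rw [e, germ_eq_iff]
  filter_upwards [𝒟.tendsto_image.eventually 𝒟.Z'.vec_covec] with τ hτ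
  simp only [AddSubmonoidClass.coe_finsetSum, Finset.sum_apply]
  refine (hτ i j).trans ?_
  split_ifs <;> rfl

/-- The derivations along the source frame. -/
def D (i : FrameIdx n) : Derivation ℂ 𝒟.Gm 𝒟.Gm :=
  Derivation.mk' (∑ k, LinearMap.mulLeft ℂ (𝒟.z i k) ∘ₗ (𝒟.pd k : 𝒟.Gm →ₗ[ℂ] 𝒟.Gm))
    fun a b => by
      simp only [LinearMap.sum_apply, LinearMap.comp_apply, LinearMap.mulLeft_apply,
        Derivation.coeFn_coe, Derivation.leibniz, smul_eq_mul, Finset.mul_sum,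
        ← Finset.sum_add_distrib]
      exact Finset.sum_congr rfl fun _ _ => by ring

theorem D_apply (i : FrameIdx n) (φ : 𝒟.Gm) : 𝒟.D i φ = ∑ k, 𝒟.z i k * 𝒟.pd k φ := by
  simp [D]

/-- The matrix of the differential in the frames. -/
def A (i j : FrameIdx n) : 𝒟.Gm := ∑ s, 𝒟.D i (𝒟.f s) * 𝒟.h' s j

theorem D_f (i : FrameIdx n) (s : Fin m) : 𝒟.D i (𝒟.f s) = ∑ j, 𝒟.A i j * 𝒟.z' j s := by
  simp only [A, Finset.sum_mul]
  rw [Finset.sum_comm]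
  simp only [mul_assoc, ← Finset.mul_sum, h'_z']
  simp

theorem pd_eq (k : Fin m) (φ : 𝒟.Gm) : 𝒟.pd k φ = ∑ i, 𝒟.h k i * 𝒟.D i φ :=
  eq_sum_dual_frame (p := fun k => 𝒟.pd k φ) (fun i => 𝒟.D_apply i φ) 𝒟.h_z k

/-- The structure functions of the source frame. -/
def C (i j k : FrameIdx n) : 𝒟.Gm :=
  germ (𝒟.src (𝒟.Z.structFun i j k) (𝒟.Z.smooth_structFun 𝒟.hr' i j k))

/-- The structure functions of the target frame. -/
def C' (i j k : FrameIdx n) : 𝒟.Gm :=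
  germ (𝒟.tgt (𝒟.Z'.structFun i j k) (𝒟.Z'.smooth_structFun 𝒟.hr' i j k))

def dz' (s : Fin m) (j : FrameIdx n) (l : Fin m) : 𝒟.Gm :=
  germ (𝒟.tgt (fun y => fderiv ℝ (𝒟.Z'.vec j l) y (stdVec s))
    ((𝒟.Z'.smooth_vec j l).fderiv_apply 𝒟.hr' _))

/-- The structure functions are the components of the commutators of the frame fields; this puts
them in the form required by `frame_commutator`. -/
theorem C_eq (i j k : FrameIdx n) :
    𝒟.C i j k = ∑ l, (𝒟.D i (𝒟.z j l) - 𝒟.D j (𝒟.z i l)) * 𝒟.h l k := by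
  have e : ∀ i j l, 𝒟.D i (𝒟.z j l) = ∑ s, 𝒟.z i s * germ (𝒟.src
      (fun y => fderiv ℝ (𝒟.Z.vec j l) y (stdVec s))
      ((𝒟.Z.smooth_vec j l).fderiv_apply 𝒟.hr' _)) := fun i j l => by
    rw [D_apply]
    exact Finset.sum_congr rfl fun s _ =>
      congrArg (fun w => 𝒟.z i s * w) (𝒟.pd_src s _ (𝒟.Z.smooth_vec j l))
  simp only [e]
  simp only [z, h, ← germ_mul, ← germ_sum, ← germ_sub]
  refine congrArg germ (Subtype.ext (funext fun τ => ?_))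
  simp only [C, src, ComplexFrame.structFun, AddSubmonoidClass.coe_finsetSum, Finset.sum_apply,
    MulMemClass.coe_mul, AddSubgroupClass.coe_sub, Pi.mul_apply, Pi.sub_apply]

theorem C'_eq (i j k : FrameIdx n) : 𝒟.C' i j k = ∑ l, (∑ s, 𝒟.z' i s * 𝒟.dz' s j l -
    ∑ s, 𝒟.z' j s * 𝒟.dz' s i l) * 𝒟.h' l k := by
  simp only [dz', z', h', ← germ_mul, ← germ_sum, ← germ_sub]
  refine congrArg germ (Subtype.ext (funext fun τ => ?_))
  simp only [C', tgt, ComplexFrame.structFun, AddSubmonoidClass.coe_finsetSum, Finset.sum_apply,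
    MulMemClass.coe_mul, AddSubgroupClass.coe_sub, Pi.mul_apply, Pi.sub_apply]

theorem commutator (i j : FrameIdx n) (φ : 𝒟.Gm) :
    𝒟.D i (𝒟.D j φ) - 𝒟.D j (𝒟.D i φ) = ∑ k, 𝒟.C i j k * 𝒟.D k φ := by
  simp only [C_eq]
  exact frame_commutator 𝒟.pd_comm 𝒟.D_apply 𝒟.h_z i j φ

theorem D_tgt (i : FrameIdx n) (c : EuclideanSpace ℝ (Fin m) → ℂ) (hc : SmoothNearAt r c 𝒟.y₀) :
    𝒟.D i (germ (𝒟.tgt c hc)) = ∑ s,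
      germ (𝒟.tgt (fun y => fderiv ℝ c y (stdVec s)) (hc.fderiv_apply 𝒟.hr' _)) *
        𝒟.D i (𝒟.f s) := by
  simp only [D_apply, pd_tgt]
  exact sum_mul_sum_mul_comm _ _ _

theorem D_z' (i t : FrameIdx n) (q : Fin m) :
    𝒟.D i (𝒟.z' t q) = ∑ k, 𝒟.A i k * ∑ s, 𝒟.z' k s * 𝒟.dz' s t q := by
  rw [z', D_tgt]
  simp only [D_f]
  exact sum_mul_sum_mul_comm' _ _ _

theorem structure_eq (i j q : FrameIdx n) : 𝒟.D i (𝒟.A j q) - 𝒟.D j (𝒟.A i q) =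
    ∑ k, 𝒟.C i j k * 𝒟.A k q - ∑ k, ∑ l, 𝒟.A i k * 𝒟.A j l * 𝒟.C' k l q :=
  frame_structure_eq (f := 𝒟.f) (z := 𝒟.z') (h := 𝒟.h')
    (dz := fun k t q => ∑ s, 𝒟.z' k s * 𝒟.dz' s t q) 𝒟.commutator (fun _ _ => rfl) 𝒟.D_f 𝒟.z'_h'
    𝒟.D_z' 𝒟.C'_eq i j q

end CRGermData

namespace CRGermData

variable {n m : ℕ} {r : WithTop ℕ∞} (𝒟 : CRGermData n m r)

/-! ### The generators -/

/-- Coordinates of the source and target points. -/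
def Y₀ : Fin m ⊕ Fin m → smoothAlong 𝒟.l := Sum.elim 𝒟.xFun 𝒟.fFun

def y₀₀ : Fin m ⊕ Fin m → ℂ := Sum.elim (fun k => coordFn k 𝒟.x₀) (fun k => coordFn k 𝒟.y₀)

/-- The first partial derivatives of the map. -/
def dfFun (i : Fin m × Fin m) : smoothAlong 𝒟.l := pderivFun (stdVec i.1) (𝒟.fFun i.2)

/-- The second partial derivatives of the map. -/
def ddfFun (i : Fin m × Fin m × Fin m) : smoothAlong 𝒟.l :=
  pderivFun (stdVec i.1) (𝒟.dfFun i.2)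

/-- The coordinates of the `1`-jet. -/
def YJ₁ : (Fin m ⊕ Fin m) ⊕ (Fin m × Fin m) → smoothAlong 𝒟.l := Sum.elim 𝒟.Y₀ 𝒟.dfFun

def yJ₁ : (Fin m ⊕ Fin m) ⊕ (Fin m × Fin m) → ℂ :=
  Sum.elim 𝒟.y₀₀ fun i => coordFn i.2 (𝒟.B₁ (stdVec i.1))

/-- The coordinates of the `2`-jet. -/
def YJ₂ : ((Fin m ⊕ Fin m) ⊕ (Fin m × Fin m)) ⊕ (Fin m × Fin m × Fin m) → smoothAlong 𝒟.l :=
  Sum.elim 𝒟.YJ₁ 𝒟.ddfFun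

def yJ₂ : ((Fin m ⊕ Fin m) ⊕ (Fin m × Fin m)) ⊕ (Fin m × Fin m × Fin m) → ℂ :=
  Sum.elim 𝒟.yJ₁ fun i => coordFn i.2.2 (𝒟.B₂ (stdVec i.1) (stdVec i.2.1))

theorem continuous_coordFn (k : Fin m) : Continuous (coordFn (m := m) k) :=
  (contDiff_coordFn (r := 0) k).continuous

theorem dfFun_eq : ∀ᶠ τ in 𝒟.l, ∀ i, (𝒟.dfFun i).1 τ =
    coordFn i.2 (fderiv ℝ τ.1 τ.2 (stdVec i.1)) := by
  filter_upwards [𝒟.smooth] with τ h i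
  exact fderiv_coordFn_comp (h.differentiableAt (by simp)) _ _

theorem ddfFun_eq : ∀ᶠ τ in 𝒟.l, ∀ i, (𝒟.ddfFun i).1 τ =
    coordFn i.2.2 (fderiv ℝ (fderiv ℝ τ.1) τ.2 (stdVec i.1) (stdVec i.2.1)) := by
  filter_upwards [𝒟.isLocal.eventually_nhds 𝒟.dfFun_eq, 𝒟.smooth] with τ h₁ h₂ i
  have hd : DifferentiableAt ℝ (fderiv ℝ τ.1) τ.2 :=
    (h₂.fderiv_right (m := ∞) (by simp)).differentiableAt (by simp)
  have e : (fun y => (𝒟.dfFun i.2).1 (τ.1, y)) =ᶠ[𝓝 τ.2]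
      fun y => coordFn i.2.2 (fderiv ℝ τ.1 y (stdVec i.2.1)) := by
    filter_upwards [h₁] with y hy using hy i.2
  refine (congrArg (fun L : _ →L[ℝ] ℂ => L (stdVec i.1)) e.fderiv_eq).trans ?_
  refine (fderiv_coordFn_comp (g := fun y => fderiv ℝ τ.1 y (stdVec i.2.1))
    (hd.clm_apply (differentiableAt_const _)) i.2.2 (stdVec i.1)).trans ?_
  rw [fderiv_clm_apply hd (differentiableAt_const _)]
  simp [coordFn]

theorem tendsto_Y₀ (j : Fin m ⊕ Fin m) : Tendsto (𝒟.Y₀ j).1 𝒟.l (𝓝 (𝒟.y₀₀ j)) := by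
  rcases j with k | k
  · exact (continuous_coordFn k).continuousAt.tendsto.comp 𝒟.tendsto_point
  · exact (continuous_coordFn k).continuousAt.tendsto.comp 𝒟.tendsto_image

theorem tendsto_YJ₁ (j : (Fin m ⊕ Fin m) ⊕ (Fin m × Fin m)) :
    Tendsto (𝒟.YJ₁ j).1 𝒟.l (𝓝 (𝒟.yJ₁ j)) := by
  rcases j with j | i
  · exact 𝒟.tendsto_Y₀ j
  · have : Tendsto (fun τ => fderiv ℝ τ.1 τ.2 (stdVec i.1)) 𝒟.l (𝓝 (𝒟.B₁ (stdVec i.1))) :=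
      ((ContinuousLinearMap.apply ℝ _ (stdVec i.1)).continuous.tendsto _).comp 𝒟.tendsto_fderiv
    refine ((continuous_coordFn i.2).continuousAt.tendsto.comp this).congr' ?_
    filter_upwards [𝒟.dfFun_eq] with τ h using (h i).symm

theorem tendsto_YJ₂ (j : ((Fin m ⊕ Fin m) ⊕ (Fin m × Fin m)) ⊕ (Fin m × Fin m × Fin m)) :
    Tendsto (𝒟.YJ₂ j).1 𝒟.l (𝓝 (𝒟.yJ₂ j)) := by
  rcases j with j | i
  · exact 𝒟.tendsto_YJ₁ j
  · have h₁ : Tendsto (fun τ => fderiv ℝ (fderiv ℝ τ.1) τ.2 (stdVec i.1)) 𝒟.l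
        (𝓝 (𝒟.B₂ (stdVec i.1))) :=
      ((ContinuousLinearMap.apply ℝ _ (stdVec i.1)).continuous.tendsto _).comp
        𝒟.tendsto_fderiv_fderiv
    have h₂ : Tendsto (fun τ => fderiv ℝ (fderiv ℝ τ.1) τ.2 (stdVec i.1) (stdVec i.2.1)) 𝒟.l
        (𝓝 (𝒟.B₂ (stdVec i.1) (stdVec i.2.1))) :=
      ((ContinuousLinearMap.apply ℝ _ (stdVec i.2.1)).continuous.tendsto _).comp h₁
    refine ((continuous_coordFn i.2.2).continuousAt.tendsto.comp h₂).congr' ?_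
    filter_upwards [𝒟.ddfFun_eq] with τ h using (h i).symm

/-- Functions of the source and target points. -/
abbrev S₀ : Subalgebra ℂ 𝒟.Gm := functionsOf r 𝒟.Y₀ 𝒟.y₀₀

/-- Functions of the `1`-jet. -/
abbrev SJ₁ : Subalgebra ℂ 𝒟.Gm := functionsOf r 𝒟.YJ₁ 𝒟.yJ₁

/-- Functions of the `2`-jet. -/
abbrev SJ₂ : Subalgebra ℂ 𝒟.Gm := functionsOf r 𝒟.YJ₂ 𝒟.yJ₂

/-- Coordinates are carried as complex generators; taking real parts recovers the point and extends
functions of it smoothly to complex arguments. -/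
def ofCoords (e : Fin m → Fin m ⊕ Fin m) (w : Fin m ⊕ Fin m → ℂ) : EuclideanSpace ℝ (Fin m) :=
  WithLp.toLp 2 fun k => (w (e k)).re

theorem contDiff_ofCoords (e : Fin m → Fin m ⊕ Fin m) : ContDiff ℝ r (ofCoords e) :=
  (PiLp.contDiff_toLp).comp
    (contDiff_pi.2 fun k => Complex.reCLM.contDiff.comp (contDiff_apply ℝ ℂ (e k)))

theorem src_mem (c : EuclideanSpace ℝ (Fin m) → ℂ) (hc : SmoothNearAt r c 𝒟.x₀) :
    germ (𝒟.src c hc) ∈ 𝒟.S₀ :=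
  mem_functionsOf (G := fun w => c (ofCoords Sum.inl w))
    (SmoothNearAt.comp (F := ofCoords Sum.inl) hc (.of_contDiff (contDiff_ofCoords Sum.inl)))
    (Eventually.of_forall fun _ => rfl)

theorem tgt_mem (c : EuclideanSpace ℝ (Fin m) → ℂ) (hc : SmoothNearAt r c 𝒟.y₀) :
    germ (𝒟.tgt c hc) ∈ 𝒟.S₀ :=
  mem_functionsOf (G := fun w => c (ofCoords Sum.inr w))
    (SmoothNearAt.comp (F := ofCoords Sum.inr) hc (.of_contDiff (contDiff_ofCoords Sum.inr)))
    (Eventually.of_forall fun _ => rfl)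

theorem germConj_f (k : Fin m) : germConj (𝒟.f k) = 𝒟.f k :=
  germ_eq_iff.2 (Eventually.of_forall fun _ => Complex.conj_ofReal _)

theorem germConj_Y₀ (j : Fin m ⊕ Fin m) : germConj (germ (𝒟.Y₀ j)) = germ (𝒟.Y₀ j) := by
  rcases j with k | k <;>
  exact germ_eq_iff.2 (Eventually.of_forall fun _ => Complex.conj_ofReal _)

theorem germConj_pd (k : Fin m) (φ : 𝒟.Gm) : germConj (𝒟.pd k φ) = 𝒟.pd k (germConj φ) :=
  germConj_pderivAlong _ _ _

theorem germ_dfFun (i : Fin m × Fin m) : germ (𝒟.dfFun i) = 𝒟.pd i.1 (𝒟.f i.2) :=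
  (pderivAlong_germ _ _ _).symm

theorem germ_ddfFun (i : Fin m × Fin m × Fin m) :
    germ (𝒟.ddfFun i) = 𝒟.pd i.1 (𝒟.pd i.2.1 (𝒟.f i.2.2)) := by
  rw [← 𝒟.germ_dfFun i.2]
  exact (pderivAlong_germ _ _ _).symm

theorem germConj_YJ₁ (j : (Fin m ⊕ Fin m) ⊕ (Fin m × Fin m)) :
    germConj (germ (𝒟.YJ₁ j)) = germ (𝒟.YJ₁ j) := by
  rcases j with j | i
  · exact 𝒟.germConj_Y₀ j
  · change germConj (germ (𝒟.dfFun i)) = germ (𝒟.dfFun i)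
    rw [germ_dfFun, germConj_pd, germConj_f]

theorem S₀_le : 𝒟.S₀ ≤ 𝒟.SJ₁ := functionsOf_le 𝒟.tendsto_Y₀ 𝒟.tendsto_YJ₁ fun j =>
  germ_mem_functionsOf (Y := 𝒟.YJ₁) (.inl j)

theorem SJ₁_le : 𝒟.SJ₁ ≤ 𝒟.SJ₂ := functionsOf_le 𝒟.tendsto_YJ₁ 𝒟.tendsto_YJ₂ fun j =>
  germ_mem_functionsOf (Y := 𝒟.YJ₂) (.inl j)

theorem z_mem (i : FrameIdx n) (k : Fin m) : 𝒟.z i k ∈ 𝒟.S₀ := 𝒟.src_mem _ _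
theorem h_mem (k : Fin m) (i : FrameIdx n) : 𝒟.h k i ∈ 𝒟.S₀ := 𝒟.src_mem _ _
theorem z'_mem (i : FrameIdx n) (k : Fin m) : 𝒟.z' i k ∈ 𝒟.S₀ := 𝒟.tgt_mem _ _
theorem h'_mem (k : Fin m) (i : FrameIdx n) : 𝒟.h' k i ∈ 𝒟.S₀ := 𝒟.tgt_mem _ _

theorem f_mem (k : Fin m) : 𝒟.f k ∈ 𝒟.S₀ := germ_mem_functionsOf (Y := 𝒟.Y₀) (.inr k)

theorem D_mem_of_functionsOf {J : Type*} [Fintype J] {Y : J → smoothAlong 𝒟.l} {y : J → ℂ}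
    (hY : ∀ j, Tendsto (Y j).1 𝒟.l (𝓝 (y j))) (i : FrameIdx n) {S : Subalgebra ℂ 𝒟.Gm}
    (hS : functionsOf r Y y ≤ S) (h₁ : ∀ j, 𝒟.D i (germ (Y j)) ∈ S)
    (h₂ : ∀ j, 𝒟.D i (germConj (germ (Y j))) ∈ S) {φ : 𝒟.Gm} (hφ : φ ∈ functionsOf r Y y) :
    𝒟.D i φ ∈ S :=
  derivation_mem_of_functionsOf 𝒟.isLocal 𝒟.hr 𝒟.hr' hY stdVec (𝒟.z i) (𝒟.D i) (𝒟.D_apply i)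
    hS h₁ h₂ hφ

theorem D_mem_of_pd_mem (i : FrameIdx n) {S : Subalgebra ℂ 𝒟.Gm} (hS : 𝒟.S₀ ≤ S) {φ : 𝒟.Gm}
    (h : ∀ k, 𝒟.pd k φ ∈ S) : 𝒟.D i φ ∈ S := by
  rw [D_apply]
  exact sum_mem fun k _ => mul_mem (hS (𝒟.z_mem i k)) (h k)

theorem D_src_mem (i : FrameIdx n) (c : EuclideanSpace ℝ (Fin m) → ℂ)
    (hc : SmoothNearAt r c 𝒟.x₀) : 𝒟.D i (germ (𝒟.src c hc)) ∈ 𝒟.S₀ :=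
  𝒟.D_mem_of_pd_mem i le_rfl fun k => by
    rw [pd_src]
    exact 𝒟.src_mem _ _

theorem D_Y₀_mem (i : FrameIdx n) {S : Subalgebra ℂ 𝒟.Gm} (hS : 𝒟.S₀ ≤ S)
    (h : ∀ j, 𝒟.A i j ∈ S) (j : Fin m ⊕ Fin m) : 𝒟.D i (germ (𝒟.Y₀ j)) ∈ S := by
  rcases j with k | k
  · exact hS (𝒟.D_src_mem i (coordFn k) (.of_contDiff (contDiff_coordFn k)))
  · change 𝒟.D i (𝒟.f k) ∈ S
    rw [D_f]
    exact sum_mem fun j _ => mul_mem (h j) (hS (𝒟.z'_mem j k))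

theorem D_S₀_mem (i : FrameIdx n) {S : Subalgebra ℂ 𝒟.Gm} (hS : 𝒟.S₀ ≤ S)
    (h : ∀ j, 𝒟.A i j ∈ S) {φ : 𝒟.Gm} (hφ : φ ∈ 𝒟.S₀) : 𝒟.D i φ ∈ S :=
  𝒟.D_mem_of_functionsOf 𝒟.tendsto_Y₀ i hS (𝒟.D_Y₀_mem i hS h)
    (fun j => by rw [germConj_Y₀]; exact 𝒟.D_Y₀_mem i hS h j) hφ

theorem A_mem_SJ₁ (i j : FrameIdx n) : 𝒟.A i j ∈ 𝒟.SJ₁ :=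
  sum_mem fun s _ => mul_mem (𝒟.D_mem_of_pd_mem i 𝒟.S₀_le fun k => by
    rw [← 𝒟.germ_dfFun (k, s)]
    exact germ_mem_functionsOf (Y := 𝒟.YJ₁) (.inr (k, s))) (𝒟.S₀_le (𝒟.h'_mem s j))

theorem D_SJ₁_mem (i : FrameIdx n) {φ : 𝒟.Gm} (hφ : φ ∈ 𝒟.SJ₁) : 𝒟.D i φ ∈ 𝒟.SJ₂ := by
  have h : ∀ j, 𝒟.D i (germ (𝒟.YJ₁ j)) ∈ 𝒟.SJ₂ := by
    rintro (j | j)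
    · exact 𝒟.D_Y₀_mem i (𝒟.S₀_le.trans 𝒟.SJ₁_le) (fun j => 𝒟.SJ₁_le (𝒟.A_mem_SJ₁ i j)) j
    · change 𝒟.D i (germ (𝒟.dfFun j)) ∈ 𝒟.SJ₂
      refine 𝒟.D_mem_of_pd_mem i (𝒟.S₀_le.trans 𝒟.SJ₁_le) fun k => ?_
      rw [germ_dfFun, ← 𝒟.germ_ddfFun (k, j)]
      exact germ_mem_functionsOf (Y := 𝒟.YJ₂) (.inr (k, j))
  exact 𝒟.D_mem_of_functionsOf 𝒟.tendsto_YJ₁ i 𝒟.SJ₁_le h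
    (fun j => by rw [germConj_YJ₁]; exact h j) hφ

/-! ### The entries of the matrix of the differential -/

/-- The entries of the matrix of the differential, as functions. -/
def AFun (i j : FrameIdx n) : smoothAlong 𝒟.l :=
  ∑ s, (∑ k, 𝒟.src (𝒟.Z.vec i k) (𝒟.Z.smooth_vec i k) * 𝒟.dfFun (k, s)) *
    𝒟.tgt (𝒟.Z'.covec s j) (𝒟.Z'.smooth_covec s j)

theorem germ_AFun (i j : FrameIdx n) : germ (𝒟.AFun i j) = 𝒟.A i j := by
  simp only [AFun, germ_sum, germ_mul, germ_dfFun, A, D_apply]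
  rfl

theorem AFun_eq : ∀ᶠ τ in 𝒟.l, ∀ i j, (𝒟.AFun i j).1 τ =
    frameMatrix 𝒟.Z 𝒟.Z' τ.2 (τ.1 τ.2) (fderiv ℝ τ.1 τ.2) i j := by
  filter_upwards [𝒟.dfFun_eq] with τ h i j
  simp only [AFun, AddSubmonoidClass.coe_finsetSum, Finset.sum_apply, MulMemClass.coe_mul,
    Pi.mul_apply, h, frameMatrix]
  rfl

/-- The second order coordinate, as a function. -/
def rFun : smoothAlong 𝒟.l :=
  ∑ k, 𝒟.src (𝒟.Z.vec none k) (𝒟.Z.smooth_vec none k) * pderivFun (stdVec k) (𝒟.AFun none none)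

theorem germ_rFun : germ 𝒟.rFun = 𝒟.D none (𝒟.A none none) := by
  have : ∀ k, germ (pderivFun (stdVec k) (𝒟.AFun none none)) = 𝒟.pd k (𝒟.A none none) := fun k => by
    rw [← germ_AFun]
    exact (pderivAlong_germ _ _ _).symm
  simp only [rFun, germ_sum, germ_mul, D_apply, this]
  rfl

theorem germConj_z (i : FrameIdx n) (k : Fin m) : germConj (𝒟.z i k) = 𝒟.z i.bar k :=
  germ_eq_iff.2 (by
    filter_upwards [𝒟.tendsto_point.eventually 𝒟.Z.conj_vec] with τ h using h i k)

theorem germConj_h' (k : Fin m) (i : FrameIdx n) : germConj (𝒟.h' k i) = 𝒟.h' k i.bar :=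
  germ_eq_iff.2 (by
    filter_upwards [𝒟.tendsto_image.eventually 𝒟.Z'.conj_covec] with τ h using h k i)

theorem germConj_D (i : FrameIdx n) (φ : 𝒟.Gm) :
    germConj (𝒟.D i φ) = 𝒟.D i.bar (germConj φ) := by
  simp only [D_apply, map_sum, map_mul, germConj_z, germConj_pd]

/-- The map is real and both frames are stable under conjugation, so conjugation only exchanges the
two types of indices. Hence it permutes the entries used as generators, and the conjugate terms of
the chain rule bring nothing new. -/
theorem germConj_A (i j : FrameIdx n) : germConj (𝒟.A i j) = 𝒟.A i.bar j.bar := by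
  simp only [A, map_sum, map_mul, germConj_D, germConj_f, germConj_h']

theorem A_block_none (p : Bool) (α : Fin n) : 𝒟.A (some (p, α)) none = 0 := by
  rw [← germ_AFun]
  refine germ_eq_iff (G := 0).2 ?_
  filter_upwards [𝒟.AFun_eq, 𝒟.block_none] with τ h₁ h₂
  exact (h₁ _ _).trans (h₂ p α)

theorem A_block_not (p : Bool) (α β : Fin n) : 𝒟.A (some (p, α)) (some (!p, β)) = 0 := by
  rw [← germ_AFun]
  refine germ_eq_iff (G := 0).2 ?_
  filter_upwards [𝒟.AFun_eq, 𝒟.block_not] with τ h₁ h₂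
  exact (h₁ _ _).trans (h₂ p α β)

theorem tendsto_AFun (i j : FrameIdx n) :
    Tendsto (𝒟.AFun i j).1 𝒟.l (𝓝 (frameMatrix 𝒟.Z 𝒟.Z' 𝒟.x₀ 𝒟.y₀ 𝒟.B₁ i j)) := by
  have e : (𝒟.AFun i j).1 = fun τ => ∑ s, (∑ k, 𝒟.Z.vec i k τ.2 * (𝒟.dfFun (k, s)).1 τ) *
      𝒟.Z'.covec s j (τ.1 τ.2) := by
    funext τ
    simp only [AFun, AddSubmonoidClass.coe_finsetSum, Finset.sum_apply, MulMemClass.coe_mul,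
      Pi.mul_apply]
    rfl
  rw [e]
  refine tendsto_finsetSum _ fun s _ => Tendsto.mul (tendsto_finsetSum _ fun k _ =>
    Tendsto.mul ?_ (𝒟.tendsto_YJ₁ (.inr (k, s)))) ?_
  · exact (𝒟.Z.smooth_vec i k).contDiffAt.continuousAt.tendsto.comp 𝒟.tendsto_point
  · exact (𝒟.Z'.smooth_covec s j).contDiffAt.continuousAt.tendsto.comp 𝒟.tendsto_image

/-! ### The tower of function algebras -/

def Ya : (Fin m ⊕ Fin m) ⊕ ((Bool × Fin n × Fin n) ⊕ Unit) → smoothAlong 𝒟.l :=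
  Sum.elim 𝒟.Y₀ (Sum.elim (fun i => 𝒟.AFun (some (i.1, i.2.1)) (some (i.1, i.2.2)))
    fun _ => 𝒟.AFun none none)

def Y₁ : ((Fin m ⊕ Fin m) ⊕ ((Bool × Fin n × Fin n) ⊕ Unit)) ⊕ (Bool × Fin n) →
    smoothAlong 𝒟.l :=
  Sum.elim 𝒟.Ya fun i => 𝒟.AFun none (some i)

def Yh : (((Fin m ⊕ Fin m) ⊕ ((Bool × Fin n × Fin n) ⊕ Unit)) ⊕ (Bool × Fin n)) ⊕ Unit →
    smoothAlong 𝒟.l :=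
  Sum.elim 𝒟.Y₁ fun _ => 𝒟.rFun

theorem tendsto_of_mem_SJ₂ {F : smoothAlong 𝒟.l} (h : germ F ∈ 𝒟.SJ₂) :
    Tendsto F.1 𝒟.l (𝓝 (germLim (germ F))) := tendsto_germLim 𝒟.tendsto_YJ₂ h

theorem germ_Ya_mem (j) : germ (𝒟.Ya j) ∈ 𝒟.SJ₂ := by
  rcases j with j | i | u
  · exact 𝒟.SJ₁_le (𝒟.S₀_le (germ_mem_functionsOf j))
  · exact 𝒟.SJ₁_le (𝒟.germ_AFun _ _ ▸ 𝒟.A_mem_SJ₁ _ _)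
  · exact 𝒟.SJ₁_le (𝒟.germ_AFun _ _ ▸ 𝒟.A_mem_SJ₁ _ _)

theorem germ_Y₁_mem (j) : germ (𝒟.Y₁ j) ∈ 𝒟.SJ₂ := by
  rcases j with j | i
  · exact 𝒟.germ_Ya_mem j
  · exact 𝒟.SJ₁_le (𝒟.germ_AFun _ _ ▸ 𝒟.A_mem_SJ₁ _ _)

theorem germ_Yh_mem (j) : germ (𝒟.Yh j) ∈ 𝒟.SJ₂ := by
  rcases j with j | u
  · exact 𝒟.germ_Y₁_mem j
  · exact 𝒟.germ_rFun ▸ 𝒟.D_SJ₁_mem _ (𝒟.A_mem_SJ₁ _ _)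

theorem tendsto_Ya (j) : Tendsto (𝒟.Ya j).1 𝒟.l (𝓝 (germLim (germ (𝒟.Ya j)))) :=
  𝒟.tendsto_of_mem_SJ₂ (𝒟.germ_Ya_mem j)

theorem tendsto_Y₁ (j) : Tendsto (𝒟.Y₁ j).1 𝒟.l (𝓝 (germLim (germ (𝒟.Y₁ j)))) :=
  𝒟.tendsto_of_mem_SJ₂ (𝒟.germ_Y₁_mem j)

theorem tendsto_Yh (j) : Tendsto (𝒟.Yh j).1 𝒟.l (𝓝 (germLim (germ (𝒟.Yh j)))) :=
  𝒟.tendsto_of_mem_SJ₂ (𝒟.germ_Yh_mem j)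

/-- The base values are the limits of the generators, which exist since all generators lie in `SJ₂`.
The algebras `S₁` and `Sh` are formed in the same way. -/
abbrev Sa : Subalgebra ℂ 𝒟.Gm := functionsOf r 𝒟.Ya fun j => germLim (germ (𝒟.Ya j))

abbrev S₁ : Subalgebra ℂ 𝒟.Gm := functionsOf r 𝒟.Y₁ fun j => germLim (germ (𝒟.Y₁ j))

abbrev Sh : Subalgebra ℂ 𝒟.Gm := functionsOf r 𝒟.Yh fun j => germLim (germ (𝒟.Yh j))

theorem S₀_le_Sa : 𝒟.S₀ ≤ 𝒟.Sa := functionsOf_le 𝒟.tendsto_Y₀ 𝒟.tendsto_Ya fun j =>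
  germ_mem_functionsOf (Y := 𝒟.Ya) (.inl j)

theorem Sa_le : 𝒟.Sa ≤ 𝒟.S₁ := functionsOf_le 𝒟.tendsto_Ya 𝒟.tendsto_Y₁ fun j =>
  germ_mem_functionsOf (Y := 𝒟.Y₁) (.inl j)

theorem S₁_le : 𝒟.S₁ ≤ 𝒟.Sh := functionsOf_le 𝒟.tendsto_Y₁ 𝒟.tendsto_Yh fun j =>
  germ_mem_functionsOf (Y := 𝒟.Yh) (.inl j)

/-- The additional generator `T u` is a first derivative of an entry of the differential, so the
whole tower depends on the 2-jet only. -/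
theorem Sh_le : 𝒟.Sh ≤ 𝒟.SJ₂ := functionsOf_le 𝒟.tendsto_Yh 𝒟.tendsto_YJ₂ 𝒟.germ_Yh_mem

theorem a_mem (p : Bool) (α β : Fin n) : 𝒟.A (some (p, α)) (some (p, β)) ∈ 𝒟.Sa :=
  𝒟.germ_AFun _ _ ▸ germ_mem_functionsOf (Y := 𝒟.Ya) (.inr (.inl (p, α, β)))

theorem u_mem : 𝒟.A none none ∈ 𝒟.Sa :=
  𝒟.germ_AFun _ _ ▸ germ_mem_functionsOf (Y := 𝒟.Ya) (.inr (.inr ()))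

theorem c_mem (p : Bool) (γ : Fin n) : 𝒟.A none (some (p, γ)) ∈ 𝒟.S₁ :=
  𝒟.germ_AFun _ _ ▸ germ_mem_functionsOf (Y := 𝒟.Y₁) (.inr (p, γ))

theorem r_mem : 𝒟.D none (𝒟.A none none) ∈ 𝒟.Sh :=
  𝒟.germ_rFun ▸ germ_mem_functionsOf (Y := 𝒟.Yh) (.inr ())

theorem A_some_mem (p : Bool) (α : Fin n) (j : FrameIdx n) : 𝒟.A (some (p, α)) j ∈ 𝒟.Sa := by
  rcases j with _ | ⟨q, β⟩
  · rw [A_block_none]; exact zero_mem _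
  · by_cases h : q = p
    · subst h; exact 𝒟.a_mem _ _ _
    · obtain rfl : q = !p := by cases p <;> cases q <;> simp_all
      rw [A_block_not]; exact zero_mem _

theorem A_none_mem (j : FrameIdx n) : 𝒟.A none j ∈ 𝒟.S₁ := by
  rcases j with _ | ⟨q, β⟩
  · exact 𝒟.Sa_le 𝒟.u_mem
  · exact 𝒟.c_mem q β

theorem D_Sa_mem (i : FrameIdx n) {S : Subalgebra ℂ 𝒟.Gm} (hS : 𝒟.Sa ≤ S)
    (h₀ : ∀ j, 𝒟.A i j ∈ S)
    (h₁ : ∀ q β γ, 𝒟.D i (𝒟.A (some (q, β)) (some (q, γ))) ∈ S)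
    (h₂ : 𝒟.D i (𝒟.A none none) ∈ S) : ∀ s ∈ 𝒟.Sa, 𝒟.D i s ∈ S := by
  refine fun s hs => 𝒟.D_mem_of_functionsOf 𝒟.tendsto_Ya i hS ?_ ?_ hs
  · rintro (j | j | j)
    · exact 𝒟.D_Y₀_mem i (𝒟.S₀_le_Sa.trans hS) h₀ j
    · exact 𝒟.germ_AFun _ _ ▸ h₁ j.1 j.2.1 j.2.2
    · exact 𝒟.germ_AFun _ _ ▸ h₂
  · rintro (j | j | j)
    · change 𝒟.D i (germConj (germ (𝒟.Y₀ j))) ∈ S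
      rw [germConj_Y₀]
      exact 𝒟.D_Y₀_mem i (𝒟.S₀_le_Sa.trans hS) h₀ j
    · change 𝒟.D i (germConj (germ (𝒟.AFun _ _))) ∈ S
      rw [germ_AFun, germConj_A]
      exact h₁ (!j.1) j.2.1 j.2.2
    · change 𝒟.D i (germConj (germ (𝒟.AFun _ _))) ∈ S
      rw [germ_AFun, germConj_A]
      exact h₂

/-- The differential algebra of a family of CR maps. -/
def tower : CRTower n 𝒟.Gm where
  D := 𝒟.D
  C := 𝒟.C
  C' := 𝒟.C'
  A := 𝒟.A
  commutator := 𝒟.commutator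
  structure_eq := 𝒟.structure_eq
  C_antisymm i j k := by
    rw [← sub_eq_zero, sub_neg_eq_add, C, C, ← germ_add]
    refine (germ_eq_iff (G := 0)).2 (Eventually.of_forall fun τ => ?_)
    exact (congrArg (· + _) (𝒟.Z.structFun_antisymm i j k τ.2)).trans (neg_add_cancel _)
  C'_antisymm i j k := by
    rw [← sub_eq_zero, sub_neg_eq_add, C', C', ← germ_add]
    refine (germ_eq_iff (G := 0)).2 (Eventually.of_forall fun τ => ?_)
    exact (congrArg (· + _) (𝒟.Z'.structFun_antisymm i j k (τ.1 τ.2))).trans (neg_add_cancel _)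
  block_none := 𝒟.A_block_none
  block_not := 𝒟.A_block_not
  Sa := 𝒟.Sa
  S1 := 𝒟.S₁
  Sh := 𝒟.Sh
  Sa_le := 𝒟.Sa_le
  S1_le := 𝒟.S₁_le
  C_mem _ _ _ := 𝒟.S₀_le_Sa (𝒟.src_mem _ _)
  C'_mem _ _ _ := 𝒟.S₀_le_Sa (𝒟.tgt_mem _ _)
  D_C_mem p α _ _ _ := 𝒟.D_S₀_mem _ 𝒟.S₀_le_Sa (𝒟.A_some_mem p α) (𝒟.src_mem _ _)
  D_C'_mem p α _ _ _ := 𝒟.D_S₀_mem _ 𝒟.S₀_le_Sa (𝒟.A_some_mem p α) (𝒟.tgt_mem _ _)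
  D_none_C_mem _ _ _ :=
    𝒟.D_S₀_mem _ (𝒟.S₀_le_Sa.trans 𝒟.Sa_le) 𝒟.A_none_mem (𝒟.src_mem _ _)
  D_none_C'_mem _ _ _ :=
    𝒟.D_S₀_mem _ (𝒟.S₀_le_Sa.trans 𝒟.Sa_le) 𝒟.A_none_mem (𝒟.tgt_mem _ _)
  a_mem := 𝒟.a_mem
  u_mem := 𝒟.u_mem
  c_mem := 𝒟.c_mem
  r_mem := 𝒟.r_mem
  chain_some p α _ hS := 𝒟.D_Sa_mem _ hS fun j => hS (𝒟.A_some_mem p α j)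
  chain_none _ hS := 𝒟.D_Sa_mem _ (𝒟.Sa_le.trans hS) fun j => hS (𝒟.A_none_mem j)
  chain_one i S hS h₁ h₂ s hs := by
    refine 𝒟.D_mem_of_functionsOf 𝒟.tendsto_Y₁ i hS ?_ ?_ hs
    · rintro (j | j)
      · exact h₁ _ (germ_mem_functionsOf j)
      · exact 𝒟.germ_AFun _ _ ▸ h₂ j.1 j.2
    · rintro (j | j)
      · refine h₁ _ ?_
        rcases j with j | j | j
        · change germConj (germ (𝒟.Y₀ j)) ∈ 𝒟.Sa
          rw [germConj_Y₀]
          exact 𝒟.S₀_le_Sa (germ_mem_functionsOf (Y := 𝒟.Y₀) j)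
        · change germConj (germ (𝒟.AFun _ _)) ∈ 𝒟.Sa
          rw [germ_AFun, germConj_A]
          exact 𝒟.a_mem (!j.1) j.2.1 j.2.2
        · change germConj (germ (𝒟.AFun _ _)) ∈ 𝒟.Sa
          rw [germ_AFun, germConj_A]
          exact 𝒟.u_mem
      · change 𝒟.D i (germConj (germ (𝒟.AFun _ _))) ∈ S
        rw [germ_AFun, germConj_A]
        exact h₂ (!j.1) j.2
  chain_h i S hS h₁ h₂ s hs := by
    refine 𝒟.D_mem_of_functionsOf 𝒟.tendsto_Yh i hS ?_ ?_ hs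
    · rintro (j | j)
      · exact h₁ _ (germ_mem_functionsOf j)
      · exact 𝒟.germ_rFun ▸ h₂
    · rintro (j | j)
      · refine h₁ _ ?_
        rcases j with (j | j | j) | j
        · change germConj (germ (𝒟.Y₀ j)) ∈ 𝒟.S₁
          rw [germConj_Y₀]
          exact 𝒟.Sa_le (𝒟.S₀_le_Sa (germ_mem_functionsOf (Y := 𝒟.Y₀) j))
        · change germConj (germ (𝒟.AFun _ _)) ∈ 𝒟.S₁
          rw [germ_AFun, germConj_A]
          exact 𝒟.Sa_le (𝒟.a_mem (!j.1) j.2.1 j.2.2)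
        · change germConj (germ (𝒟.AFun _ _)) ∈ 𝒟.S₁
          rw [germ_AFun, germConj_A]
          exact 𝒟.Sa_le 𝒟.u_mem
        · change germConj (germ (𝒟.AFun _ _)) ∈ 𝒟.S₁
          rw [germ_AFun, germConj_A]
          exact 𝒟.c_mem (!j.1) j.2
      · change 𝒟.D i (germConj (germ 𝒟.rFun)) ∈ S
        rw [germ_rFun, germConj_D, germConj_A]
        exact h₂
  ev := germEval 𝒟.tendsto_Ya
  isUnit_of_ev := isUnit_of_germEval 𝒟.tendsto_Ya
  ev_a p α β := by
    refine Eq.trans ?_ (𝒟.base_diag p α β)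
    have := 𝒟.tendsto_AFun (some (p, α)) (some (p, β))
    simp only [← germ_AFun]
    exact germEval_eq 𝒟.tendsto_Ya _ this
  ev_u := by
    refine Eq.trans ?_ 𝒟.base_none
    have := 𝒟.tendsto_AFun none none
    simp only [← germ_AFun]
    exact germEval_eq 𝒟.tendsto_Ya _ this
  levi_nondegenerate := by
    refine fun h => 𝒟.levi_nondegenerate (Eq.trans ?_ h)
    refine congrArg Matrix.det (Matrix.ext fun α β => Eq.symm ?_)
    exact germEval_eq (F := 𝒟.src (𝒟.Z.structFun (some (false, α)) (some (true, β)) none)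
      (𝒟.Z.smooth_structFun 𝒟.hr' _ _ _)) 𝒟.tendsto_Ya _
      ((𝒟.Z.smooth_structFun 𝒟.hr' _ _ _).contDiffAt.continuousAt.tendsto.comp 𝒟.tendsto_point)

/-- The third derivatives are functions of the `2`-jet. -/
theorem third_derivative_mem [NeZero n] (i j k s : Fin m) :
    𝒟.pd i (𝒟.pd j (𝒟.pd k (𝒟.f s))) ∈ 𝒟.SJ₂ := by
  have h₀ : 𝒟.S₀ ≤ 𝒟.Sh := 𝒟.S₀_le_Sa.trans (𝒟.Sa_le.trans 𝒟.S₁_le)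
  -- Partial derivatives are combinations of frame derivatives with coframe coefficients, so `Sh` is
  -- closed under them; starting from the components of the map, derivatives of every order stay
  -- there.
  have h : ∀ (k : Fin m) (φ : 𝒟.Gm), φ ∈ 𝒟.Sh → 𝒟.pd k φ ∈ 𝒟.Sh := fun k φ hφ => by
    rw [pd_eq]
    exact sum_mem fun i _ => mul_mem (h₀ (𝒟.h_mem k i)) (𝒟.tower.D_Sh_mem i hφ)
  exact 𝒟.Sh_le (h i _ (h j _ (h k _ (h₀ (𝒟.f_mem s)))))

end CRGermData

/-! ### Change of frames -/

namespace ComplexFrame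

variable {n m : ℕ} {r : WithTop ℕ∞} {x₀ y₀ : EuclideanSpace ℝ (Fin m)}

theorem _root_.FrameIdx.bar_bar (i : FrameIdx n) : i.bar.bar = i := by
  rcases i with _ | ⟨p, α⟩ <;> simp [FrameIdx.bar]

theorem _root_.FrameIdx.sum_bar {R : Type*} [AddCommMonoid R] (F : FrameIdx n → R) :
    ∑ i : FrameIdx n, F i.bar = ∑ i, F i :=
  Function.Bijective.sum_comp
    (Function.Involutive.bijective (f := (FrameIdx.bar : FrameIdx n → FrameIdx n))
      FrameIdx.bar_bar) F

/-- The frame obtained by a constant change of basis. -/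
def change (Z : ComplexFrame n m r x₀) (N N' : Matrix (FrameIdx n) (FrameIdx n) ℂ)
    (h : N * N' = 1) (hN : ∀ i j, (starRingEnd ℂ) (N i j) = N i.bar j.bar)
    (hN' : ∀ i j, (starRingEnd ℂ) (N' i j) = N' i.bar j.bar) : ComplexFrame n m r x₀ where
  vec i k y := ∑ j, N i j * Z.vec j k y
  covec k i y := ∑ j, Z.covec k j y * N' j i
  smooth_vec i k := SmoothNearAt.sum fun j _ => (SmoothNearAt.const _).mul (Z.smooth_vec j k)
  smooth_covec k i := SmoothNearAt.sum fun j _ => (Z.smooth_covec k j).mul (SmoothNearAt.const _)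
  vec_covec := by
    filter_upwards [Z.vec_covec] with y hy i j
    have e : (Matrix.of fun i k => ∑ j, N i j * Z.vec j k y) *
        (Matrix.of fun k i => ∑ j, Z.covec k j y * N' j i) = 1 := by
      have h₁ : (Matrix.of fun i k => ∑ j, N i j * Z.vec j k y) =
        N * Matrix.of fun i k => Z.vec i k y := rfl
      have h₂ : (Matrix.of fun k i => ∑ j, Z.covec k j y * N' j i) =
        (Matrix.of fun k i => Z.covec k i y) * N' := rfl
      have h₃ : (Matrix.of fun i k => Z.vec i k y) * (Matrix.of fun k i => Z.covec k i y) = 1 := by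
        ext i j
        simp [Matrix.mul_apply, hy, Matrix.one_apply]
      rw [h₁, h₂, Matrix.mul_assoc, ← Matrix.mul_assoc _ _ N', h₃, Matrix.one_mul, h]
    simpa [Matrix.mul_apply, Matrix.one_apply] using congrFun (congrFun e i) j
  covec_vec := by
    filter_upwards [Z.covec_vec] with y hy k l
    have e : (Matrix.of fun k i => ∑ j, Z.covec k j y * N' j i) *
        (Matrix.of fun i k => ∑ j, N i j * Z.vec j k y) = 1 := by
      have h₁ : (Matrix.of fun i k => ∑ j, N i j * Z.vec j k y) =
        N * Matrix.of fun i k => Z.vec i k y := rfl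
      have h₂ : (Matrix.of fun k i => ∑ j, Z.covec k j y * N' j i) =
        (Matrix.of fun k i => Z.covec k i y) * N' := rfl
      have h₃ : (Matrix.of fun k i => Z.covec k i y) * (Matrix.of fun i k => Z.vec i k y) = 1 := by
        ext i j
        simp [Matrix.mul_apply, hy, Matrix.one_apply]
      rw [h₁, h₂, Matrix.mul_assoc, ← Matrix.mul_assoc N', mul_eq_one_comm.1 h,
        Matrix.one_mul, h₃]
    simpa [Matrix.mul_apply, Matrix.one_apply] using congrFun (congrFun e k) l
  conj_vec := by
    filter_upwards [Z.conj_vec] with y hy i k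
    simp only [map_sum, map_mul, hN, hy]
    exact FrameIdx.sum_bar fun j => N i.bar j * Z.vec j k y
  conj_covec := by
    filter_upwards [Z.conj_covec] with y hy k i
    simp only [map_sum, map_mul, hN', hy]
    exact FrameIdx.sum_bar fun j => Z.covec k j y * N' j i.bar

theorem frameMatrix_change (Z : ComplexFrame n m r x₀) (Z' : ComplexFrame n m r y₀)
    (N N' : Matrix (FrameIdx n) (FrameIdx n) ℂ)
    (h : N * N' = 1) (hN : ∀ i j, (starRingEnd ℂ) (N i j) = N i.bar j.bar)
    (hN' : ∀ i j, (starRingEnd ℂ) (N' i j) = N' i.bar j.bar) (x y : EuclideanSpace ℝ (Fin m))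
    (B : EuclideanSpace ℝ (Fin m) →L[ℝ] EuclideanSpace ℝ (Fin m)) (i j : FrameIdx n) :
    frameMatrix Z (Z'.change N N' h hN hN') x y B i j =
      ∑ k, frameMatrix Z Z' x y B i k * N' k j := by
  simp only [frameMatrix, change, Finset.sum_mul, Finset.mul_sum]
  rw [Finset.sum_comm]
  simp only [Finset.sum_mul, Finset.mul_sum, mul_assoc]

theorem conj_frameMatrix (Z : ComplexFrame n m r x₀) (Z' : ComplexFrame n m r y₀)
    (B : EuclideanSpace ℝ (Fin m) →L[ℝ] EuclideanSpace ℝ (Fin m)) (i j : FrameIdx n) :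
    (starRingEnd ℂ) (frameMatrix Z Z' x₀ y₀ B i j) = frameMatrix Z Z' x₀ y₀ B i.bar j.bar := by
  simp only [frameMatrix, map_sum, map_mul, Z.conj_vec.self_of_nhds, Z'.conj_covec.self_of_nhds,
    Complex.conj_ofReal]

theorem frameMatrix_mul (Z : ComplexFrame n m r x₀) (Z' : ComplexFrame n m r y₀)
    (B B' : EuclideanSpace ℝ (Fin m) →L[ℝ] EuclideanSpace ℝ (Fin m)) (h : B'.comp B = .id ℝ _) :
    Matrix.of (frameMatrix Z Z' x₀ y₀ B) * Matrix.of (frameMatrix Z' Z y₀ x₀ B') = 1 := by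
  let b (B : EuclideanSpace ℝ (Fin m) →L[ℝ] EuclideanSpace ℝ (Fin m)) : Matrix (Fin m) (Fin m) ℂ :=
    Matrix.of fun k s => ((B (stdVec k) s : ℝ) : ℂ)
  have h₁ : ∀ {x₀ y₀ : EuclideanSpace ℝ (Fin m)} (Z : ComplexFrame n m r x₀)
      (Z' : ComplexFrame n m r y₀) B, Matrix.of (frameMatrix Z Z' x₀ y₀ B) =
      (Matrix.of fun i k => Z.vec i k x₀) * b B * Matrix.of fun k i => Z'.covec k i y₀ :=
    fun _ _ _ => rfl
  have h₂ : (Matrix.of fun k i => Z'.covec k i y₀) * (Matrix.of fun i k => Z'.vec i k y₀) = 1 := by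
    ext i j
    simp [Matrix.mul_apply, Z'.covec_vec.self_of_nhds, Matrix.one_apply]
  have h₃ : (Matrix.of fun i k => Z.vec i k x₀) * (Matrix.of fun k i => Z.covec k i x₀) = 1 := by
    ext i j
    simp [Matrix.mul_apply, Z.vec_covec.self_of_nhds, Matrix.one_apply]
  have h₄ : b B * b B' = 1 := by
    ext k l
    have := congrArg (fun L : _ →L[ℝ] EuclideanSpace ℝ (Fin m) => L (stdVec k) l) h
    simp only [ContinuousLinearMap.comp_apply, ContinuousLinearMap.id_apply] at this
    rw [CRGermData.sum_smul_stdVec (B (stdVec k)), map_sum] at this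
    simp only [map_smul, WithLp.ofLp_sum, Finset.sum_apply, PiLp.smul_apply, smul_eq_mul] at this
    simp only [b, Matrix.mul_apply, Matrix.of_apply, Matrix.one_apply, ← Complex.ofReal_mul,
      ← Complex.ofReal_sum, this]
    simp [Pi.single_apply, eq_comm, apply_ite (Complex.ofReal)]
  rw [h₁, h₁, Matrix.mul_assoc, Matrix.mul_assoc, Matrix.mul_assoc,
    ← Matrix.mul_assoc _ _ (b B' * _), h₂, Matrix.one_mul, ← Matrix.mul_assoc (b B), h₄,
    Matrix.one_mul, h₃]

end ComplexFrame

/-- The block diagonal part of a matrix. -/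
def blockPart {n : ℕ} (A : Matrix (FrameIdx n) (FrameIdx n) ℂ) :
    Matrix (FrameIdx n) (FrameIdx n) ℂ
  | none, none => A none none
  | some (p, α), some (q, β) => if p = q then A (some (p, α)) (some (q, β)) else 0
  | _, _ => 0

theorem conj_blockPart {n : ℕ} {A : Matrix (FrameIdx n) (FrameIdx n) ℂ}
    (h : ∀ i j, (starRingEnd ℂ) (A i j) = A i.bar j.bar) (i j : FrameIdx n) :
    (starRingEnd ℂ) (blockPart A i j) = blockPart A i.bar j.bar := by
  rcases i with _ | ⟨p, α⟩ <;> rcases j with _ | ⟨q, β⟩ <;>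
    simp [blockPart, FrameIdx.bar, h, apply_ite (starRingEnd ℂ)]

/-- For a block triangular matrix the diagonal blocks of the inverse invert the diagonal blocks,
although `B` itself is not assumed triangular. -/
theorem blockPart_mul_blockPart {n : ℕ} {A B : Matrix (FrameIdx n) (FrameIdx n) ℂ} (h : A * B = 1)
    (h₁ : ∀ p α, A (some (p, α)) none = 0)
    (h₂ : ∀ p α β, A (some (p, α)) (some (!p, β)) = 0) : blockPart A * blockPart B = 1 := by
  have hu : B none none * A none none = 1 := by
    have h' : B * A = 1 := mul_eq_one_comm.1 h
    have := congrFun (congrFun h' none) none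
    simpa [Matrix.mul_apply, Fintype.sum_option, h₁] using this
  have ha : ∀ p α β, ∑ γ, A (some (p, α)) (some (p, γ)) * B (some (p, γ)) (some (p, β)) =
      if α = β then 1 else 0 := fun p α β => by
    have := congrFun (congrFun h (some (p, α))) (some (p, β))
    simp only [Matrix.mul_apply, Fintype.sum_option, h₁, zero_mul, zero_add,
      Fintype.sum_prod_type, Matrix.one_apply, Option.some.injEq, Prod.mk.injEq, true_and] at this
    have h₂' := h₂ p α
    cases p
    · have h₃ : ∀ β, A (some (false, α)) (some (true, β)) = 0 := h₂'
      simpa [Fintype.sum_bool, h₃] using this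
    · have h₃ : ∀ β, A (some (true, α)) (some (false, β)) = 0 := h₂'
      simpa [Fintype.sum_bool, h₃] using this
  ext i j
  rcases i with _ | ⟨p, α⟩ <;> rcases j with _ | ⟨q, β⟩
  · simp [Matrix.mul_apply, Fintype.sum_option, blockPart, mul_comm (A none none), hu]
  · simp [Matrix.mul_apply, Fintype.sum_option, blockPart]
  · simp [Matrix.mul_apply, Fintype.sum_option, blockPart]
  · have := ha p α β
    cases p <;> cases q <;>
    simp [Matrix.mul_apply, Fintype.sum_option, Fintype.sum_prod_type, Fintype.sum_bool, blockPart,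
      this, Matrix.one_apply]

/-! ### Jets of maps in coordinates -/

section CoordinateJets

variable {m : ℕ}

/-- The coordinates of the `2`-jet of a map between coordinate spaces. -/
def coordJet₂ (τ : (EuclideanSpace ℝ (Fin m) → EuclideanSpace ℝ (Fin m)) ×
    EuclideanSpace ℝ (Fin m)) : JetCoord m 2 :=
  (τ.2, fun i => iteratedFDeriv ℝ (i : ℕ) τ.1 τ.2)

/-- The values of the components of the derivatives in a `2`-jet. -/
def jetVal (i : Fin 3) (v : Fin (i : ℕ) → EuclideanSpace ℝ (Fin m)) :
    JetCoord m 2 →L[ℝ] EuclideanSpace ℝ (Fin m) :=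
  (ContinuousMultilinearMap.apply ℝ _ _ v).comp
    ((ContinuousLinearMap.proj i).comp (ContinuousLinearMap.snd ℝ _ _))

theorem jetVal_apply (i : Fin 3) (v : Fin (i : ℕ) → EuclideanSpace ℝ (Fin m))
    (lam : JetCoord m 2) : jetVal i v lam = lam.2 i v := rfl

def jetComponent (i : Fin 3) : JetCoord m 2 →L[ℝ]
    EuclideanSpace ℝ (Fin m) [×(i : ℕ)]→L[ℝ] EuclideanSpace ℝ (Fin m) :=
  (ContinuousLinearMap.proj i).comp (ContinuousLinearMap.snd ℝ _ _)

/-- The first derivative in a `2`-jet. -/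
def jetFst : JetCoord m 2 →L[ℝ] EuclideanSpace ℝ (Fin m) →L[ℝ] EuclideanSpace ℝ (Fin m) :=
  (continuousMultilinearCurryFin1 ℝ (EuclideanSpace ℝ (Fin m))
    (EuclideanSpace ℝ (Fin m))).toContinuousLinearEquiv.toContinuousLinearMap.comp
    (jetComponent 1)

theorem jetFst_apply (lam : JetCoord m 2) (v : EuclideanSpace ℝ (Fin m)) :
    jetFst lam v = lam.2 1 (fun _ => v) := rfl

/-- The second derivative in a `2`-jet. -/
def jetSnd : JetCoord m 2 →L[ℝ] EuclideanSpace ℝ (Fin m) →L[ℝ] EuclideanSpace ℝ (Fin m) →L[ℝ]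
    EuclideanSpace ℝ (Fin m) :=
  (ContinuousLinearMap.compL ℝ (EuclideanSpace ℝ (Fin m)) _ _
    (continuousMultilinearCurryFin1 ℝ (EuclideanSpace ℝ (Fin m))
      (EuclideanSpace ℝ (Fin m))).toContinuousLinearEquiv.toContinuousLinearMap).comp
  ((continuousMultilinearCurryLeftEquiv ℝ (fun _ : Fin 2 => EuclideanSpace ℝ (Fin m))
    (EuclideanSpace ℝ (Fin m))).toContinuousLinearEquiv.toContinuousLinearMap.comp
    (jetComponent 2))

theorem jetSnd_apply (lam : JetCoord m 2) (v w : EuclideanSpace ℝ (Fin m)) :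
    jetSnd lam v w = lam.2 2 ![v, w] := by
  refine Eq.trans (b := lam.2 2 (Fin.cons v fun _ => w)) rfl ?_
  congr 1
  ext i
  fin_cases i <;> rfl

variable {g : EuclideanSpace ℝ (Fin m) → EuclideanSpace ℝ (Fin m)} {x : EuclideanSpace ℝ (Fin m)}

theorem jetFst_coordJet₂ : jetFst (coordJet₂ (g, x)) = fderiv ℝ g x := by
  ext1 v
  rw [jetFst_apply]
  exact iteratedFDeriv_one_apply _

theorem jetSnd_coordJet₂ : jetSnd (coordJet₂ (g, x)) = fderiv ℝ (fderiv ℝ g) x := by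
  ext1 v
  ext1 w
  rw [jetSnd_apply]
  exact iteratedFDeriv_two_apply _ _ _

theorem jetVal_zero_coordJet₂ : jetVal 0 0 (coordJet₂ (g, x)) = g x :=
  iteratedFDeriv_zero_apply (𝕜 := ℝ) (f := g) (x := x) 0

theorem continuousAt_coordJet₂ (h : ContDiffAt ℝ ∞ g x) :
    ContinuousAt (fun y => coordJet₂ (g, y)) x :=
  (continuousAt_id (x := x)).prodMk (continuousAt_pi.2 fun i =>
    (h.iteratedFDeriv_right (m := 0) (i := (i : ℕ)) (by simpa using ENat.LEInfty.out)).continuousAt)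

/-- The multilinear map with the given coefficients. -/
def multilinearOfCoeff (c : (Fin 3 → Fin m) → Fin m → ℝ) :
    EuclideanSpace ℝ (Fin m) [×3]→L[ℝ] EuclideanSpace ℝ (Fin m) :=
  ∑ idx, ∑ s, c idx s • ((ContinuousMultilinearMap.mkPiAlgebra ℝ (Fin 3)
    ℝ).compContinuousLinearMap fun i => (EuclideanSpace.proj (idx i) :
      EuclideanSpace ℝ (Fin m) →L[ℝ] ℝ)).smulRight (stdVec s)

theorem multilinearOfCoeff_eq (T : EuclideanSpace ℝ (Fin m) [×3]→L[ℝ] EuclideanSpace ℝ (Fin m)) :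
    multilinearOfCoeff (fun idx s => T (fun i => stdVec (idx i)) s) = T := by
  refine ContinuousMultilinearMap.toMultilinearMap_injective
    (Module.Basis.ext_multilinear (fun _ => (EuclideanSpace.basisFun (Fin m) ℝ).toBasis) fun v => ?_)
  simp only [OrthonormalBasis.coe_toBasis, EuclideanSpace.basisFun_apply]
  simp only [multilinearOfCoeff, ContinuousMultilinearMap.coe_coe,
    sum_apply, smul_apply,
    ContinuousMultilinearMap.smulRight_apply,
    ContinuousMultilinearMap.compContinuousLinearMap_apply,
    ContinuousMultilinearMap.mkPiAlgebra_apply, PiLp.proj_apply]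
  rw [Finset.sum_eq_single v]
  · simp [← CRGermData.sum_smul_stdVec]
  · intro idx _ h
    obtain ⟨i, hi⟩ := Function.ne_iff.1 h
    refine Finset.sum_eq_zero fun s _ => ?_
    rw [Finset.prod_eq_zero (Finset.mem_univ i) (by simp [hi]), zero_smul, smul_zero]
  · simp

theorem smoothNearAt_multilinearOfCoeff {V : Type*} [NormedAddCommGroup V] [NormedSpace ℝ V]
    {r : WithTop ℕ∞} {v₀ : V} {c : V → (Fin 3 → Fin m) → Fin m → ℝ}
    (h : ∀ idx s, SmoothNearAt r (fun v => c v idx s) v₀) :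
    SmoothNearAt r (fun v => multilinearOfCoeff (c v)) v₀ :=
  SmoothNearAt.sum fun idx _ => SmoothNearAt.sum fun s _ => by
    filter_upwards [h idx s] with y hy using hy.smul contDiffAt_const

end CoordinateJets

/-! ### The complete system in coordinates -/

section CompleteSystem

variable {n m : ℕ} {r : WithTop ℕ∞} {x₀ y₀ : EuclideanSpace ℝ (Fin m)}

/-- The map `g` is smooth near `x`, and its differential has a block triangular matrix. -/
def IsAdaptedNear (Z : ComplexFrame n m r x₀) (Z' : ComplexFrame n m r y₀)
    (g : EuclideanSpace ℝ (Fin m) → EuclideanSpace ℝ (Fin m)) (x : EuclideanSpace ℝ (Fin m)) :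
    Prop :=
  ∀ᶠ y in 𝓝 x, ContDiffAt ℝ ∞ g y ∧
    (∀ p α, frameMatrix Z Z' y (g y) (fderiv ℝ g y) (some (p, α)) none = 0) ∧
    ∀ p α β, frameMatrix Z Z' y (g y) (fderiv ℝ g y) (some (p, α)) (some (!p, β)) = 0

/-- The filter of all adapted maps near a given `2`-jet. -/
def jetFilter (Z : ComplexFrame n m r x₀) (Z' : ComplexFrame n m r y₀) (lam₀ : JetCoord m 2) :
    Filter ((EuclideanSpace ℝ (Fin m) → EuclideanSpace ℝ (Fin m)) × EuclideanSpace ℝ (Fin m)) :=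
  comap coordJet₂ (𝓝 lam₀) ⊓ 𝓟 {τ | IsAdaptedNear Z Z' τ.1 τ.2}

variable (Z : ComplexFrame n m r x₀) (Z' : ComplexFrame n m r y₀) (lam₀ : JetCoord m 2)

/-- The dictionary between germs and jets: holding along the filter means holding for all adapted
maps whose 2-jet is near `lam₀`, uniformly in the map. -/
theorem eventually_jetFilter_iff {p : (EuclideanSpace ℝ (Fin m) → EuclideanSpace ℝ (Fin m)) ×
    EuclideanSpace ℝ (Fin m) → Prop} : (∀ᶠ τ in jetFilter Z Z' lam₀, p τ) ↔
      ∀ᶠ lam in 𝓝 lam₀, ∀ τ, coordJet₂ τ = lam → IsAdaptedNear Z Z' τ.1 τ.2 → p τ := by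
  rw [jetFilter, eventually_inf_principal, eventually_comap]
  rfl

theorem isAdaptedNear_of_jetFilter :
    ∀ᶠ τ in jetFilter Z Z' lam₀, IsAdaptedNear Z Z' τ.1 τ.2 :=
  (eventually_jetFilter_iff Z Z' lam₀).2 (Eventually.of_forall fun _ _ _ h => h)

/-- The 2-jet of a fixed smooth map depends continuously on the point, and adaptedness near a point
persists at nearby points. -/
theorem isLocalFilter_jetFilter : IsLocalFilter (jetFilter Z Z' lam₀) := by
  intro s hs
  obtain hs' := (eventually_jetFilter_iff Z Z' lam₀ (p := (· ∈ s))).1 hs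
  refine (eventually_jetFilter_iff Z Z' lam₀).2 ?_
  filter_upwards [eventually_eventually_nhds.2 hs'] with lam h τ hτ had
  subst hτ
  have hc : Tendsto (fun y => coordJet₂ (τ.1, y)) (𝓝 τ.2) (𝓝 (coordJet₂ τ)) :=
    continuousAt_coordJet₂ had.self_of_nhds.1
  filter_upwards [hc.eventually h, eventually_eventually_nhds.2 had] with y hy hy'
  exact hy _ rfl hy'

theorem tendsto_coordJet₂ : Tendsto coordJet₂ (jetFilter Z Z' lam₀) (𝓝 lam₀) :=
  tendsto_comap.mono_left inf_le_left

theorem tendsto_jetFst : Tendsto (fun τ => fderiv ℝ τ.1 τ.2) (jetFilter Z Z' lam₀)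
    (𝓝 (jetFst lam₀)) := by
  have := (jetFst.continuous.tendsto lam₀).comp (tendsto_coordJet₂ Z Z' lam₀)
  refine this.congr fun τ => jetFst_coordJet₂

theorem tendsto_jetSnd : Tendsto (fun τ => fderiv ℝ (fderiv ℝ τ.1) τ.2) (jetFilter Z Z' lam₀)
    (𝓝 (jetSnd lam₀)) := by
  have := (jetSnd.continuous.tendsto lam₀).comp (tendsto_coordJet₂ Z Z' lam₀)
  refine this.congr fun τ => jetSnd_coordJet₂

theorem tendsto_jetPoint (h : lam₀.1 = x₀) : Tendsto (fun τ => τ.2) (jetFilter Z Z' lam₀)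
    (𝓝 x₀) :=
  h ▸ (continuous_fst.tendsto lam₀).comp (tendsto_coordJet₂ Z Z' lam₀)

theorem tendsto_jetImage (h : lam₀.2 0 0 = y₀) :
    Tendsto (fun τ => τ.1 τ.2) (jetFilter Z Z' lam₀) (𝓝 y₀) := by
  have := ((jetVal 0 0).continuous.tendsto lam₀).comp (tendsto_coordJet₂ Z Z' lam₀)
  rw [jetVal_apply, h] at this
  exact this.congr fun τ => jetVal_zero_coordJet₂

theorem tendsto_frameMatrix (h : lam₀.1 = x₀) (h' : lam₀.2 0 0 = y₀) (i j : FrameIdx n) :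
    Tendsto (fun τ => frameMatrix Z Z' τ.2 (τ.1 τ.2) (fderiv ℝ τ.1 τ.2) i j)
      (jetFilter Z Z' lam₀) (𝓝 (frameMatrix Z Z' x₀ y₀ (jetFst lam₀) i j)) := by
  refine tendsto_finsetSum _ fun s _ => Tendsto.mul (tendsto_finsetSum _ fun k _ =>
    Tendsto.mul ?_ ?_) ?_
  · exact (Z.smooth_vec i k).contDiffAt.continuousAt.tendsto.comp (tendsto_jetPoint Z Z' lam₀ h)
  · have : Tendsto (fun τ => fderiv ℝ τ.1 τ.2 (stdVec k)) (jetFilter Z Z' lam₀)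
        (𝓝 (jetFst lam₀ (stdVec k))) :=
      ((ContinuousLinearMap.apply ℝ _ (stdVec k)).continuous.tendsto _).comp
        (tendsto_jetFst Z Z' lam₀)
    exact (CRGermData.continuous_coordFn s).continuousAt.tendsto.comp this
  · exact (Z'.smooth_covec s j).contDiffAt.continuousAt.tendsto.comp
      (tendsto_jetImage Z Z' lam₀ h')

end CompleteSystem

/-! ### Third derivatives as functions of the 2-jet, in coordinates -/

section CompleteSystem

variable {n m : ℕ} {r : WithTop ℕ∞} {x₀ y₀ : EuclideanSpace ℝ (Fin m)}
  (Z : ComplexFrame n m r x₀) (Z' : ComplexFrame n m r y₀) (lam₀ : JetCoord m 2)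

open CRGermData

/-- The jet `lam₀` need not come from a CR map, but it is a limit of jets of adapted maps and
vanishing of entries passes to the limit. -/
theorem frameMatrix_block_none [(jetFilter Z Z' lam₀).NeBot] (h : lam₀.1 = x₀)
    (h' : lam₀.2 0 0 = y₀) (p : Bool) (α : Fin n) :
    frameMatrix Z Z' x₀ y₀ (jetFst lam₀) (some (p, α)) none = 0 :=
  tendsto_nhds_unique (tendsto_frameMatrix Z Z' lam₀ h h' _ _) (tendsto_const_nhds.congr' (by
    filter_upwards [isAdaptedNear_of_jetFilter Z Z' lam₀] with τ hτ
    exact (hτ.self_of_nhds.2.1 p α).symm))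

theorem frameMatrix_block_not [(jetFilter Z Z' lam₀).NeBot] (h : lam₀.1 = x₀)
    (h' : lam₀.2 0 0 = y₀) (p : Bool) (α β : Fin n) :
    frameMatrix Z Z' x₀ y₀ (jetFst lam₀) (some (p, α)) (some (!p, β)) = 0 :=
  tendsto_nhds_unique (tendsto_frameMatrix Z Z' lam₀ h h' _ _) (tendsto_const_nhds.congr' (by
    filter_upwards [isAdaptedNear_of_jetFilter Z Z' lam₀] with τ hτ
    exact (hτ.self_of_nhds.2.2 p α β).symm))

/-- The germ data of all adapted maps near a given invertible `2`-jet, where the target frame is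
normalised so that the block diagonal part of the differential is the identity. -/
theorem exists_crGermData (hr : ∞ ≤ r) (hr' : r + 1 ≤ r) [hl : (jetFilter Z Z' lam₀).NeBot]
    (h : lam₀.1 = x₀) (h' : lam₀.2 0 0 = y₀)
    (hinv : ∃ B : EuclideanSpace ℝ (Fin m) →L[ℝ] EuclideanSpace ℝ (Fin m), B.comp (jetFst lam₀) = ContinuousLinearMap.id ℝ _)
    (hlevi : (Matrix.of fun α β =>
      Z.structFun (some (false, α)) (some (true, β)) none x₀).det ≠ 0) :
    ∃ 𝒟 : CRGermData n m r, 𝒟.l = jetFilter Z Z' lam₀ ∧ 𝒟.x₀ = x₀ ∧ 𝒟.y₀ = y₀ ∧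
      𝒟.B₁ = jetFst lam₀ ∧ 𝒟.B₂ = jetSnd lam₀ := by
  obtain ⟨B, hB⟩ := hinv
  set A : Matrix (FrameIdx n) (FrameIdx n) ℂ :=
    Matrix.of (frameMatrix Z Z' x₀ y₀ (jetFst lam₀)) with hA
  set A' : Matrix (FrameIdx n) (FrameIdx n) ℂ := Matrix.of (frameMatrix Z' Z y₀ x₀ B) with hA'
  have h₁ : ∀ p α, A (some (p, α)) none = 0 := frameMatrix_block_none Z Z' lam₀ h h'
  have h₂ : ∀ p α β, A (some (p, α)) (some (!p, β)) = 0 := frameMatrix_block_not Z Z' lam₀ h h'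
  -- `A'` is the matrix of the inverse differential. Changing the target frame by the constant
  -- matrix `blockPart A` multiplies the differential on the right by `blockPart A'`, which
  -- normalises its diagonal blocks at the base point and preserves the triangular shape.
  have hN : blockPart A * blockPart A' = 1 :=
    blockPart_mul_blockPart (ComplexFrame.frameMatrix_mul Z Z' _ _ hB) h₁ h₂
  have hc := conj_blockPart (A := A) (ComplexFrame.conj_frameMatrix Z Z' (jetFst lam₀))
  have hc' := conj_blockPart (A := A') (ComplexFrame.conj_frameMatrix Z' Z B)
  have hchange := ComplexFrame.frameMatrix_change Z Z' _ _ hN hc hc'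
  refine ⟨{
    hr := hr
    hr' := hr'
    x₀ := x₀
    y₀ := y₀
    Z := Z
    Z' := Z'.change _ _ hN hc hc'
    B₁ := jetFst lam₀
    B₂ := jetSnd lam₀
    l := jetFilter Z Z' lam₀
    isLocal := isLocalFilter_jetFilter Z Z' lam₀
    neBot := hl
    smooth := by
      filter_upwards [isAdaptedNear_of_jetFilter Z Z' lam₀] with τ hτ using hτ.self_of_nhds.1
    tendsto_point := tendsto_jetPoint Z Z' lam₀ h
    tendsto_image := tendsto_jetImage Z Z' lam₀ h'
    tendsto_fderiv := tendsto_jetFst Z Z' lam₀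
    tendsto_fderiv_fderiv := tendsto_jetSnd Z Z' lam₀
    block_none := by
      filter_upwards [isAdaptedNear_of_jetFilter Z Z' lam₀] with τ hτ p α
      rw [hchange]
      simp [Fintype.sum_option, hτ.self_of_nhds.2.1, blockPart]
    block_not := by
      filter_upwards [isAdaptedNear_of_jetFilter Z Z' lam₀] with τ hτ p α β
      rw [hchange, Fintype.sum_option, hτ.self_of_nhds.2.1, zero_mul, zero_add]
      refine Finset.sum_eq_zero fun i _ => ?_
      obtain ⟨q, γ⟩ := i
      by_cases hq : q = !p
      · rw [hq, hτ.self_of_nhds.2.2, zero_mul]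
      · simp [blockPart, hq]
    base_diag := fun p α β => by
      have e := congrFun (congrFun hN (some (p, α))) (some (p, β))
      rw [hchange]
      refine Eq.trans ?_ (e.trans (by simp [Matrix.one_apply]))
      rw [Matrix.mul_apply]
      refine Finset.sum_congr rfl fun i _ => ?_
      rcases i with _ | ⟨q, γ⟩
      · exact (congrArg (· * _) (h₁ p α)).trans (by simp [blockPart])
      · by_cases hq : p = q
        · simp [blockPart, hq, hA]
        · simp [blockPart, hq, Ne.symm hq]
    base_none := by
      have e := congrFun (congrFun hN none) none
      rw [hchange]
      refine Eq.trans ?_ (e.trans (by simp [Matrix.one_apply]))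
      rw [Matrix.mul_apply]
      refine Finset.sum_congr rfl fun i _ => ?_
      rcases i with _ | ⟨q, γ⟩
      · rfl
      · simp [blockPart]
    levi_nondegenerate := hlevi }, rfl, rfl, rfl, rfl, rfl⟩

/-- The complex coordinates of a `2`-jet. -/
def jetCoords (lam : JetCoord m 2) :
    ((Fin m ⊕ Fin m) ⊕ (Fin m × Fin m)) ⊕ (Fin m × Fin m × Fin m) → ℂ :=
  Sum.elim (Sum.elim (Sum.elim (fun k => coordFn k lam.1) fun k => coordFn k (lam.2 0 0))
    fun i => coordFn i.2 (jetFst lam (stdVec i.1)))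
    fun i => coordFn i.2.2 (jetSnd lam (stdVec i.1) (stdVec i.2.1))

theorem contDiff_jetCoords : ContDiff ℝ r (jetCoords (m := m)) := by
  refine contDiff_pi.2 fun j => ?_
  rcases j with ((k | k) | i) | i
  · exact (contDiff_coordFn k).comp contDiff_fst
  · exact (contDiff_coordFn k).comp (jetVal (m := m) 0 0).contDiff
  · exact (contDiff_coordFn i.2).comp
      ((ContinuousLinearMap.apply ℝ _ (stdVec i.1)).contDiff.comp (jetFst (m := m)).contDiff)
  · have : (fun lam : JetCoord m 2 => coordFn i.2.2 (jetSnd lam (stdVec i.1) (stdVec i.2.1))) =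
        fun lam => coordFn i.2.2 (jetVal 2 ![stdVec i.1, stdVec i.2.1] lam) :=
      funext fun lam => by rw [jetSnd_apply, jetVal_apply]
    change ContDiff ℝ r fun lam : JetCoord m 2 =>
      coordFn i.2.2 (jetSnd lam (stdVec i.1) (stdVec i.2.1))
    rw [this]
    exact (contDiff_coordFn i.2.2).comp
      (jetVal (m := m) 2 ![stdVec i.1, stdVec i.2.1]).contDiff

theorem _root_.CRGermData.yJ₂_eq (𝒟 : CRGermData n m r) (h₁ : 𝒟.x₀ = lam₀.1)
    (h₂ : 𝒟.y₀ = lam₀.2 0 0) (h₃ : 𝒟.B₁ = jetFst lam₀) (h₄ : 𝒟.B₂ = jetSnd lam₀) :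
    𝒟.yJ₂ = jetCoords lam₀ := by
  simp only [yJ₂, yJ₁, y₀₀, jetCoords, h₁, h₂, h₃, h₄]

theorem _root_.CRGermData.YJ₂_eq (𝒟 : CRGermData n m r) :
    ∀ᶠ τ in 𝒟.l, (fun j => (𝒟.YJ₂ j).1 τ) = jetCoords (coordJet₂ τ) := by
  filter_upwards [𝒟.dfFun_eq, 𝒟.ddfFun_eq] with τ h₁ h₂
  funext j
  rcases j with ((k | k) | i) | i
  · rfl
  · exact congrArg (coordFn k) jetVal_zero_coordJet₂.symm
  · refine (h₁ i).trans ?_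
    rw [← jetFst_coordJet₂]
    rfl
  · refine (h₂ i).trans ?_
    rw [← jetSnd_coordJet₂]
    rfl

theorem _root_.CRGermData.pderivFun_ddfFun_eq (𝒟 : CRGermData n m r) (idx : Fin 3 → Fin m)
    (s : Fin m) : ∀ᶠ τ in 𝒟.l, (pderivFun (stdVec (idx 0)) (𝒟.ddfFun (idx 1, idx 2, s))).1 τ =
      coordFn s (iteratedFDeriv ℝ 3 τ.1 τ.2 fun i => stdVec (idx i)) := by
  filter_upwards [𝒟.isLocal.eventually_nhds 𝒟.ddfFun_eq, 𝒟.smooth] with τ h₁ h₂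
  have hd : DifferentiableAt ℝ (iteratedFDeriv ℝ 2 τ.1) τ.2 :=
    (h₂.iteratedFDeriv_right (m := ∞) (i := 2) le_rfl).differentiableAt (by simp)
  have e : (fun y => (𝒟.ddfFun (idx 1, idx 2, s)).1 (τ.1, y)) =ᶠ[𝓝 τ.2]
      fun y => coordFn s (iteratedFDeriv ℝ 2 τ.1 y ![stdVec (idx 1), stdVec (idx 2)]) := by
    filter_upwards [h₁] with y hy
    rw [hy, iteratedFDeriv_two_apply]
    rfl
  refine (congrArg (fun L : _ →L[ℝ] ℂ => L (stdVec (idx 0))) e.fderiv_eq).trans ?_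
  have hd' : HasFDerivAt (fun y => iteratedFDeriv ℝ 2 τ.1 y ![stdVec (idx 1), stdVec (idx 2)])
      ((ContinuousMultilinearMap.apply ℝ (fun _ : Fin 2 => EuclideanSpace ℝ (Fin m))
        (EuclideanSpace ℝ (Fin m)) ![stdVec (idx 1), stdVec (idx 2)]).comp
        (fderiv ℝ (iteratedFDeriv ℝ 2 τ.1) τ.2)) τ.2 :=
    (ContinuousMultilinearMap.apply ℝ (fun _ : Fin 2 => EuclideanSpace ℝ (Fin m))
      (EuclideanSpace ℝ (Fin m)) ![stdVec (idx 1), stdVec (idx 2)]).hasFDerivAt.comp τ.2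
        hd.hasFDerivAt
  refine (fderiv_coordFn_comp hd'.differentiableAt s (stdVec (idx 0))).trans ?_
  rw [hd'.fderiv, iteratedFDeriv_succ_apply_left]
  have : Fin.tail (fun i => stdVec (idx i)) =
    (![stdVec (idx 1), stdVec (idx 2)] : Fin 2 → EuclideanSpace ℝ (Fin m)) := by
    ext i
    fin_cases i <;> rfl
  rw [this]
  rfl

/-- In coordinates, the third derivatives of adapted maps are functions of their `2`-jets. -/
theorem exists_third_derivative_eq [NeZero n] (hr : ∞ ≤ r) (hr' : r + 1 ≤ r)
    (h : lam₀.1 = x₀) (h' : lam₀.2 0 0 = y₀)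
    (hinv : ∃ B : EuclideanSpace ℝ (Fin m) →L[ℝ] EuclideanSpace ℝ (Fin m), B.comp (jetFst lam₀) = ContinuousLinearMap.id ℝ _)
    (hlevi : (Matrix.of fun α β =>
      Z.structFun (some (false, α)) (some (true, β)) none x₀).det ≠ 0) :
    ∃ G : JetCoord m 2 → EuclideanSpace ℝ (Fin m) [×3]→L[ℝ] EuclideanSpace ℝ (Fin m),
      SmoothNearAt r G lam₀ ∧ ∀ᶠ lam in 𝓝 lam₀, ∀ τ, coordJet₂ τ = lam →
        IsAdaptedNear Z Z' τ.1 τ.2 → iteratedFDeriv ℝ 3 τ.1 τ.2 = G lam := by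
  -- If no adapted map has a 2-jet near `lam₀`, the condition is void and any `G` serves.
  rcases eq_or_neBot (jetFilter Z Z' lam₀) with hbot | hl
  · refine ⟨fun _ => 0, .const _, (eventually_jetFilter_iff Z Z' lam₀ (p := fun τ =>
      iteratedFDeriv ℝ 3 τ.1 τ.2 = 0)).1 ?_ |>.mono fun lam hlam τ h₁ h₂ => hlam τ h₁ h₂⟩
    rw [hbot]
    exact eventually_bot
  obtain ⟨𝒟, hD, h₁, h₂, h₃, h₄⟩ := exists_crGermData Z Z' lam₀ hr hr' h h' hinv hlevi
  have hy := 𝒟.yJ₂_eq lam₀ (h₁.trans h.symm) (h₂.trans h'.symm) h₃ h₄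
  have key : ∀ idx : Fin 3 → Fin m, ∀ s, ∃ G, SmoothNearAt r G (jetCoords lam₀) ∧
      ∀ᶠ τ in jetFilter Z Z' lam₀,
        coordFn s (iteratedFDeriv ℝ 3 τ.1 τ.2 fun i => stdVec (idx i)) =
          G (jetCoords (coordJet₂ τ)) := by
    intro idx s
    have := 𝒟.third_derivative_mem (idx 0) (idx 1) (idx 2) s
    rw [← 𝒟.germ_ddfFun (idx 1, idx 2, s)] at this
    obtain ⟨G, hG, hG'⟩ := exists_of_mem_functionsOf
      (F := pderivFun (stdVec (idx 0)) (𝒟.ddfFun (idx 1, idx 2, s)))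
      (by rw [← pderivAlong_germ 𝒟.isLocal]; exact this)
    refine ⟨G, hy ▸ hG, ?_⟩
    rw [← hD]
    filter_upwards [hG', 𝒟.YJ₂_eq, 𝒟.pderivFun_ddfFun_eq idx s] with τ e₁ e₂ e₃
    rw [← e₃, e₁, e₂]
  choose G hG hG' using key
  -- The `G idx s` are complex valued; on jets of maps their values are real coordinates, so taking
  -- real parts loses nothing.
  refine ⟨fun lam => multilinearOfCoeff fun idx s => (G idx s (jetCoords lam)).re,
    smoothNearAt_multilinearOfCoeff fun idx s => ?_,
    (eventually_jetFilter_iff Z Z' lam₀ (p := fun τ => iteratedFDeriv ℝ 3 τ.1 τ.2 =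
      multilinearOfCoeff fun idx s => (G idx s (jetCoords (coordJet₂ τ))).re)).1 ?_ |>.mono
        fun lam hlam τ h₁ h₂ => ?_⟩
  · filter_upwards [(hG idx s).comp (.of_contDiff contDiff_jetCoords)] with lam hlam
    exact Complex.reCLM.contDiff.contDiffAt.comp lam hlam
  · filter_upwards [eventually_all.2 fun idx => eventually_all.2 fun s => hG' idx s] with τ hτ
    simp only [← hτ, coordFn, Complex.ofReal_re]
    exact (multilinearOfCoeff_eq _).symm
  · subst h₁
    exact hlam τ rfl h₂

end CompleteSystem

/-! ### Real frames -/

/-- A real frame near a point of a coordinate space, indexed by `FrameIdx n`, together with its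
dual coframe. -/
structure RealFrame (n m : ℕ) (r : WithTop ℕ∞) (x₀ : EuclideanSpace ℝ (Fin m)) where
  vec : FrameIdx n → EuclideanSpace ℝ (Fin m) → EuclideanSpace ℝ (Fin m)
  covec : Fin m → FrameIdx n → EuclideanSpace ℝ (Fin m) → ℝ
  smooth_vec : ∀ i, SmoothNearAt r (vec i) x₀
  smooth_covec : ∀ k i, SmoothNearAt r (covec k i) x₀
  vec_covec : ∀ᶠ y in 𝓝 x₀, ∀ i j, ∑ k, vec i y k * covec k j y = if i = j then 1 else 0
  covec_vec : ∀ᶠ y in 𝓝 x₀, ∀ k l, ∑ i, covec k i y * vec i y l = if k = l then 1 else 0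

theorem contDiffAt_det {V ι : Type*} [NormedAddCommGroup V] [NormedSpace ℝ V] [Fintype ι]
    [DecidableEq ι] {r : WithTop ℕ∞} {A : V → Matrix ι ι ℝ} {y : V}
    (h : ∀ i j, ContDiffAt ℝ r (fun y => A y i j) y) : ContDiffAt ℝ r (fun y => (A y).det) y := by
  simp only [Matrix.det_apply]
  exact ContDiffAt.sum fun σ _ => ContDiffAt.const_smul _ (contDiffAt_prod fun i _ => h _ _)

theorem contDiffAt_inv_apply {V ι : Type*} [NormedAddCommGroup V] [NormedSpace ℝ V] [Fintype ι]
    [DecidableEq ι] {r : WithTop ℕ∞} {A : V → Matrix ι ι ℝ} {y : V}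
    (h : ∀ i j, ContDiffAt ℝ r (fun y => A y i j) y) (hy : (A y).det ≠ 0) (i j : ι) :
    ContDiffAt ℝ r (fun y => (A y)⁻¹ i j) y := by
  simp only [Matrix.inv_def, Ring.inverse_eq_inv', Matrix.smul_apply, smul_eq_mul,
    Matrix.adjugate_apply]
  refine ((contDiffAt_det h).inv hy).mul (contDiffAt_det fun k l => ?_)
  by_cases hk : k = j
  · subst hk
    simpa using contDiffAt_const
  · simpa [Matrix.updateRow_ne hk] using h k l

theorem card_frameIdx (n : ℕ) : Fintype.card (FrameIdx n) = 2 * n + 1 := by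
  simp [FrameIdx]

/-- A smooth family of vectors that are linearly independent at a point is a frame near it. -/
theorem exists_realFrame {n m : ℕ} (hm : 2 * n + 1 = m) {r : WithTop ℕ∞}
    {x₀ : EuclideanSpace ℝ (Fin m)}
    {R : FrameIdx n → EuclideanSpace ℝ (Fin m) → EuclideanSpace ℝ (Fin m)}
    (hR : ∀ i, SmoothNearAt r (R i) x₀) (hind : LinearIndependent ℝ fun i => R i x₀) :
    ∃ F : RealFrame n m r x₀, F.vec = R := by
  let ε : FrameIdx n ≃ Fin m := Fintype.equivOfCardEq (by rw [card_frameIdx, Fintype.card_fin, hm])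
  let A : EuclideanSpace ℝ (Fin m) → Matrix (FrameIdx n) (FrameIdx n) ℝ :=
    fun y => Matrix.of fun i j => R i y (ε j)
  have hA : ∀ᶠ y in 𝓝 x₀, ∀ i j, ContDiffAt ℝ r (fun y => A y i j) y := by
    filter_upwards [eventually_all.2 hR] with y hy i j
    exact (EuclideanSpace.proj (ε j) : EuclideanSpace ℝ (Fin m) →L[ℝ] ℝ).contDiff.contDiffAt.comp y
      (hy i)
  have hdet₀ : (A x₀).det ≠ 0 := by
    have : LinearIndependent ℝ (A x₀).row := by
      have e : (A x₀).row = fun i => ((EuclideanSpace.equiv (Fin m) ℝ).toLinearEquiv.trans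
          (LinearEquiv.funCongrLeft ℝ ℝ ε)) (R i x₀) := rfl
      rw [e]
      exact hind.map' _ (LinearEquiv.ker _)
    have hu := Matrix.linearIndependent_rows_iff_isUnit.1 this
    exact ((Matrix.isUnit_iff_isUnit_det _).1 hu).ne_zero
  have hdet : ∀ᶠ y in 𝓝 x₀, (A y).det ≠ 0 :=
    ((contDiffAt_det hA.self_of_nhds).continuousAt).eventually_ne hdet₀
  refine ⟨⟨R, fun k i y => (A y)⁻¹ (ε.symm k) i, hR, fun k i => ?_, ?_, ?_⟩, rfl⟩
  · filter_upwards [hA, hdet] with y h₁ h₂ using contDiffAt_inv_apply h₁ h₂ _ _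
  · filter_upwards [hdet] with y hy i j
    have e := congrFun (congrFun (Matrix.mul_nonsing_inv (A y) (isUnit_iff_ne_zero.2 hy)) i) j
    rw [Matrix.mul_apply, Matrix.one_apply, ← ε.symm.sum_comp] at e
    simpa [A] using e
  · filter_upwards [hdet] with y hy k l
    have e := congrFun (congrFun (Matrix.nonsing_inv_mul (A y) (isUnit_iff_ne_zero.2 hy))
      (ε.symm k)) (ε.symm l)
    rw [Matrix.mul_apply, Matrix.one_apply] at e
    simpa [A] using e

namespace RealFrame

variable {n m : ℕ} {r : WithTop ℕ∞} {x₀ y₀ : EuclideanSpace ℝ (Fin m)} (F : RealFrame n m r x₀)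

/-- The imaginary unit, with the sign for the vectors of type `(1,0)` and `(0,1)`. -/
def unit (p : Bool) : ℂ := bif p then Complex.I else -Complex.I

theorem conj_unit (p : Bool) : (starRingEnd ℂ) (unit p) = unit (!p) := by
  cases p <;> simp [unit]

/-- The components of the complex frame. -/
def cvec : FrameIdx n → Fin m → EuclideanSpace ℝ (Fin m) → ℂ
  | none, k, y => (F.vec none y k : ℂ)
  | some (p, α), k, y => (F.vec (some (false, α)) y k : ℂ) + unit p * F.vec (some (true, α)) y k

/-- The components of the complex coframe. -/
def ccovec : Fin m → FrameIdx n → EuclideanSpace ℝ (Fin m) → ℂ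
  | k, none, y => (F.covec k none y : ℂ)
  | k, some (p, α), y => (1 / 2 : ℂ) *
    ((F.covec k (some (false, α)) y : ℂ) - unit p * F.covec k (some (true, α)) y)

theorem smoothNearAt_vec_apply (i : FrameIdx n) (k : Fin m) :
    SmoothNearAt r (fun y => ((F.vec i y k : ℝ) : ℂ)) x₀ := by
  filter_upwards [F.smooth_vec i] with y hy
  exact (CRGermData.contDiff_coordFn k).contDiffAt.comp y hy

theorem smoothNearAt_covec_ofReal (k : Fin m) (i : FrameIdx n) :
    SmoothNearAt r (fun y => ((F.covec k i y : ℝ) : ℂ)) x₀ := by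
  filter_upwards [F.smooth_covec k i] with y hy
  exact Complex.ofRealCLM.contDiff.contDiffAt.comp y hy

theorem sum_cvec_mul_ccovec {y : EuclideanSpace ℝ (Fin m)}
    (h : ∀ i j, ∑ k, F.vec i y k * F.covec k j y = if i = j then 1 else 0) (i j : FrameIdx n) :
    ∑ k, F.cvec i k y * F.ccovec k j y = if i = j then 1 else 0 := by
  have h' : ∀ i j, ∑ k, (F.vec i y k : ℂ) * (F.covec k j y : ℂ) = if i = j then 1 else 0 :=
    fun i j => by
      have := congrArg (Complex.ofReal) (h i j)
      push_cast at this
      exact this.trans (by split_ifs <;> simp)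
  rcases i with _ | ⟨p, α⟩ <;> rcases j with _ | ⟨q, β⟩
  · simp [cvec, ccovec, h']
  · have e : ∑ k, F.cvec none k y * F.ccovec k (some (q, β)) y =
        1 / 2 * (∑ k, (F.vec none y k : ℂ) * (F.covec k (some (false, β)) y : ℂ) -
          unit q * ∑ k, (F.vec none y k : ℂ) * (F.covec k (some (true, β)) y : ℂ)) := by
      simp only [Finset.mul_sum, ← Finset.sum_sub_distrib]
      exact Finset.sum_congr rfl fun k _ => by simp only [cvec, ccovec]; ring
    rw [e, h', h']
    simp
  · have e : ∑ k, F.cvec (some (p, α)) k y * F.ccovec k none y =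
        ∑ k, (F.vec (some (false, α)) y k : ℂ) * (F.covec k none y : ℂ) +
          unit p * ∑ k, (F.vec (some (true, α)) y k : ℂ) * (F.covec k none y : ℂ) := by
      simp only [Finset.mul_sum, ← Finset.sum_add_distrib]
      exact Finset.sum_congr rfl fun k _ => by simp only [cvec, ccovec]; ring
    rw [e, h', h']
    simp
  · have e : ∑ k, F.cvec (some (p, α)) k y * F.ccovec k (some (q, β)) y =
        1 / 2 * (∑ k, (F.vec (some (false, α)) y k : ℂ) * (F.covec k (some (false, β)) y : ℂ) -
          unit q * ∑ k, (F.vec (some (false, α)) y k : ℂ) * (F.covec k (some (true, β)) y : ℂ) +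
          unit p * ∑ k, (F.vec (some (true, α)) y k : ℂ) * (F.covec k (some (false, β)) y : ℂ) -
          unit p * unit q *
            ∑ k, (F.vec (some (true, α)) y k : ℂ) * (F.covec k (some (true, β)) y : ℂ)) := by
      simp only [Finset.mul_sum, ← Finset.sum_add_distrib, ← Finset.sum_sub_distrib]
      exact Finset.sum_congr rfl fun k _ => by simp only [cvec, ccovec]; ring
    rw [e, h', h', h', h']
    by_cases hαβ : α = β
    · cases p <;> cases q <;> simp [unit, hαβ] <;> norm_num
    · simp [hαβ]

theorem sum_ccovec_mul_cvec {y : EuclideanSpace ℝ (Fin m)}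
    (h : ∀ k l, ∑ i, F.covec k i y * F.vec i y l = if k = l then 1 else 0) (k l : Fin m) :
    ∑ i, F.ccovec k i y * F.cvec i l y = if k = l then 1 else 0 := by
  have h' := congrArg (Complex.ofReal) (h k l)
  push_cast at h'
  refine Eq.trans ?_ (h'.trans (by split_ifs <;> simp))
  simp only [sum_frameIdx false, cvec, ccovec]
  congr 1
  simp only [Bool.not_false, ← Finset.sum_add_distrib]
  refine Finset.sum_congr rfl fun α _ => ?_
  simp only [unit, cond_true, cond_false]
  linear_combination (-(F.covec k (some (true, α)) y : ℂ) * (F.vec (some (true, α)) y l : ℂ)) *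
    Complex.I_mul_I

/-- The complex frame `T, X_α - i Y_α, X_α + i Y_α` given by a real frame `T, X_α, Y_α`. -/
def toComplex : ComplexFrame n m r x₀ where
  vec := F.cvec
  covec := F.ccovec
  smooth_vec i k := by
    rcases i with _ | ⟨p, α⟩
    · exact F.smoothNearAt_vec_apply none k
    · exact (F.smoothNearAt_vec_apply _ k).add
        ((SmoothNearAt.const _).mul (F.smoothNearAt_vec_apply _ k))
  smooth_covec k i := by
    rcases i with _ | ⟨p, α⟩
    · exact F.smoothNearAt_covec_ofReal k none
    · exact (SmoothNearAt.const _).mul ((F.smoothNearAt_covec_ofReal k _).sub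
        ((SmoothNearAt.const _).mul (F.smoothNearAt_covec_ofReal k _)))
  vec_covec := by
    filter_upwards [F.vec_covec] with y hy using F.sum_cvec_mul_ccovec hy
  covec_vec := by
    filter_upwards [F.covec_vec] with y hy using F.sum_ccovec_mul_cvec hy
  conj_vec := Eventually.of_forall fun y i k => by
    rcases i with _ | ⟨p, α⟩ <;> simp [cvec, FrameIdx.bar, conj_unit]
  conj_covec := Eventually.of_forall fun y k i => by
    rcases i with _ | ⟨p, α⟩ <;> simp [ccovec, FrameIdx.bar, conj_unit, Complex.conj_ofNat]

theorem sum_coord_mul (L : EuclideanSpace ℝ (Fin m) →L[ℝ] EuclideanSpace ℝ (Fin m))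
    (v : EuclideanSpace ℝ (Fin m)) (s : Fin m) :
    ∑ k, (v k : ℂ) * ((L (stdVec k) s : ℝ) : ℂ) = (L v s : ℝ) := by
  conv_rhs => rw [CRGermData.sum_smul_stdVec v, map_sum]
  simp

theorem sum_cvec_mul (L : EuclideanSpace ℝ (Fin m) →L[ℝ] EuclideanSpace ℝ (Fin m)) (p : Bool)
    (α : Fin n) (x : EuclideanSpace ℝ (Fin m)) (s : Fin m) :
    ∑ k, F.cvec (some (p, α)) k x * ((L (stdVec k) s : ℝ) : ℂ) =
      (L (F.vec (some (false, α)) x) s : ℝ) + unit p * (L (F.vec (some (true, α)) x) s : ℝ) := by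
  simp only [cvec, add_mul, Finset.sum_add_distrib, mul_assoc, ← Finset.mul_sum, sum_coord_mul]

/-- A map commuting with the complex structures sends `X_α + εY_α` to a combination of the `X'_β +
εY'_β` with coefficients `s_β - ε t_β`, where `ε = ±i`; hence the block shape. -/
theorem frameMatrix_toComplex (F' : RealFrame n m r y₀) {x y : EuclideanSpace ℝ (Fin m)}
    (hy : ∀ i j, ∑ k, F'.vec i y k * F'.covec k j y = if i = j then 1 else 0)
    {L : EuclideanSpace ℝ (Fin m) →L[ℝ] EuclideanSpace ℝ (Fin m)} {α : Fin n} {s t : Fin n → ℝ}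
    (h₁ : L (F.vec (some (false, α)) x) =
      ∑ β, (s β • F'.vec (some (false, β)) y + t β • F'.vec (some (true, β)) y))
    (h₂ : L (F.vec (some (true, α)) x) =
      ∑ β, (s β • F'.vec (some (true, β)) y - t β • F'.vec (some (false, β)) y)) (p : Bool)
    (j : FrameIdx n) : frameMatrix F.toComplex F'.toComplex x y L (some (p, α)) j =
      ∑ β, ((s β : ℂ) - unit p * t β) * if some (p, β) = j then 1 else 0 := by
  have hu : unit p * unit p = -1 := by cases p <;> simp [unit]
  have e : ∀ k, (L (F.vec (some (false, α)) x) k : ℝ) +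
      unit p * (L (F.vec (some (true, α)) x) k : ℝ) =
        ∑ β, ((s β : ℂ) - unit p * t β) * F'.cvec (some (p, β)) k y := fun k => by
    rw [h₁, h₂]
    simp only [WithLp.ofLp_sum, Finset.sum_apply, PiLp.add_apply, PiLp.sub_apply, PiLp.smul_apply,
      smul_eq_mul, Complex.ofReal_sum, Finset.mul_sum, ← Finset.sum_add_distrib]
    refine Finset.sum_congr rfl fun β _ => ?_
    simp only [cvec]
    push_cast
    linear_combination (t β * F'.vec (some (true, β)) y k : ℂ) * hu
  change ∑ k, (∑ l, F.cvec (some (p, α)) l x * ((L (stdVec l) k : ℝ) : ℂ)) * F'.ccovec k j y = _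
  simp only [sum_cvec_mul, e, Finset.sum_mul]
  rw [Finset.sum_comm]
  simp only [mul_assoc, ← Finset.mul_sum, F'.sum_cvec_mul_ccovec hy]

end RealFrame

/-! ### Complex structures on real vector spaces -/

section ComplexStructure

variable {V : Type*} [AddCommGroup V] [Module ℝ V] [FiniteDimensional ℝ V]

/-- `J` turns `V` into a complex vector space, and a complex basis together with its multiples by
`i` is a real basis. -/
theorem exists_adapted_basis (J : V →ₗ[ℝ] V) (hJ : ∀ v, J (J v) = -v) :
    ∃ (n : ℕ) (b : Module.Basis (Fin 2 × Fin n) ℝ V), ∀ j, b (1, j) = J (b (0, j)) := by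
  let φ : ℂ →ₐ[ℝ] Module.End ℝ V := Complex.liftAux J (by ext v; simp [hJ])
  let _ : Module ℂ V := Module.compHom V φ.toRingHom
  have hsmul : ∀ (z : ℂ) (v : V), z • v = φ z v := fun _ _ => rfl
  have : IsScalarTower ℝ ℂ V := ⟨fun a z v => by
    rw [hsmul, hsmul, map_smul]; rfl⟩
  have : Module.Finite ℂ V := Module.Finite.of_restrictScalars_finite ℝ ℂ V
  let b := Module.finBasis ℂ V
  refine ⟨Module.finrank ℂ V, Complex.basisOneI.smulTower b, fun j => ?_⟩
  rw [Module.Basis.smulTower_apply, Module.Basis.smulTower_apply]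
  simp only [Complex.coe_basisOneI, Matrix.cons_val_one, Matrix.cons_val_zero, one_smul]
  rw [hsmul]
  simp [φ]

end ComplexStructure

/-! ### Vector fields in charts -/

section ChartFields

variable {m : ℕ} {M : Type*} [TopologicalSpace M] [ChartedSpace (EuclideanSpace ℝ (Fin m)) M]

variable (m) in
/-- The differential of the chart at `p₀`. -/
def chartDeriv (p₀ q : M) : TangentSpace (𝓡 m) q →L[ℝ] EuclideanSpace ℝ (Fin m) :=
  mfderiv (𝓡 m) 𝓘(ℝ, EuclideanSpace ℝ (Fin m)) (extChartAt (𝓡 m) p₀) q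

variable (m) in
/-- A vector field in the chart at `p₀`. -/
def chartField (p₀ : M) (V : ∀ q : M, TangentSpace (𝓡 m) q) (x : EuclideanSpace ℝ (Fin m)) :
    EuclideanSpace ℝ (Fin m) :=
  chartDeriv m p₀ ((chartAt (EuclideanSpace ℝ (Fin m)) p₀).symm x)
    (V ((chartAt (EuclideanSpace ℝ (Fin m)) p₀).symm x))

theorem chartField_chartAt (p₀ : M) (V : ∀ q : M, TangentSpace (𝓡 m) q) {q : M}
    (hq : q ∈ (chartAt (EuclideanSpace ℝ (Fin m)) p₀).source) :
    chartField m p₀ V (chartAt _ p₀ q) = chartDeriv m p₀ q (V q) := by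
  rw [chartField, OpenPartialHomeomorph.left_inv _ hq]

theorem tendsto_chartAt_symm (p₀ : M) : Tendsto (chartAt (EuclideanSpace ℝ (Fin m)) p₀).symm
    (𝓝 (chartAt _ p₀ p₀)) (𝓝 p₀) := by
  have := (chartAt (EuclideanSpace ℝ (Fin m)) p₀).symm.continuousAt
    (x := chartAt (EuclideanSpace ℝ (Fin m)) p₀ p₀) (by simp)
  simpa [ContinuousAt] using this

variable [IsManifold (𝓡 m) ∞ M]

theorem isInvertible_chartDeriv {p₀ q : M}
    (hq : q ∈ (chartAt (EuclideanSpace ℝ (Fin m)) p₀).source) :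
    (chartDeriv m p₀ q).IsInvertible :=
  isInvertible_mfderiv_extChartAt (by simpa using hq)

theorem chartDeriv_injective {p₀ q : M}
    (hq : q ∈ (chartAt (EuclideanSpace ℝ (Fin m)) p₀).source) :
    Function.Injective (chartDeriv m p₀ q) := by
  obtain ⟨L, hL⟩ := isInvertible_chartDeriv hq
  rw [← hL]
  exact L.injective

/-- The differential of the chart at `p₀` is the fibre coordinate of the tangent bundle
trivialization at `p₀`, so smoothness of a section is smoothness of this expression. -/
theorem smoothNearAt_chartField {r : WithTop ℕ∞} [IsManifold (𝓡 m) r M]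
    [IsManifold (𝓡 m) (r + 1) M] {p₀ : M} {V : ∀ q : M, TangentSpace (𝓡 m) q}
    (hV : ∀ᶠ q in 𝓝 p₀, ContMDiffAt (𝓡 m) (𝓡 m).tangent r
      (fun q => (⟨q, V q⟩ : TangentBundle (𝓡 m) M)) q) :
    SmoothNearAt r (chartField m p₀ V) (chartAt _ p₀ p₀) := by
  have hs : ∀ᶠ q in 𝓝 p₀, q ∈ (chartAt (EuclideanSpace ℝ (Fin m)) p₀).source :=
    chart_source_mem_nhds _ _
  filter_upwards [(tendsto_chartAt_symm p₀).eventually hV,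
    (tendsto_chartAt_symm p₀).eventually (eventually_eventually_nhds.2 hs),
    chart_target_mem_nhds (EuclideanSpace ℝ (Fin m)) p₀] with x h₁ h₂ h₃
  have := TangentBundle.contMDiffVectorBundle (I := 𝓡 m) (M := M) (n := r)
  have h₄ := ((trivializationAt (EuclideanSpace ℝ (Fin m)) (TangentSpace (𝓡 m))
    p₀).contMDiffAt_section_iff (IB := 𝓡 m) (n := r) (s := V) (by simpa using h₂.self_of_nhds)).1 h₁
  have h₅ : ContMDiffAt (𝓡 m) 𝓘(ℝ, EuclideanSpace ℝ (Fin m)) r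
      (fun q => chartDeriv m p₀ q (V q)) ((chartAt (EuclideanSpace ℝ (Fin m)) p₀).symm x) := by
    refine h₄.congr_of_eventuallyEq ?_
    filter_upwards [h₂] with q hq
    have := TangentBundle.continuousLinearMapAt_trivializationAt (I := 𝓡 m) (𝕜 := ℝ) hq
    rw [chartDeriv, ← this, Bundle.Trivialization.continuousLinearMapAt_apply,
      Bundle.Trivialization.linearMapAt_apply, if_pos (by simpa using hq)]
  have h₆ : ContMDiffAt (𝓡 m) (𝓡 m) r (chartAt (EuclideanSpace ℝ (Fin m)) p₀).symm x :=
    contMDiffOn_chart_symm.contMDiffAt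
      ((chartAt (EuclideanSpace ℝ (Fin m)) p₀).open_target.mem_nhds h₃)
  exact (h₅.comp x h₆).contDiffAt

theorem mlieBracket_eq_lieBracket (p₀ : M) (V W : ∀ q : M, TangentSpace (𝓡 m) q) :
    chartDeriv m p₀ p₀ (VectorField.mlieBracket (𝓡 m) V W p₀) =
      VectorField.lieBracket ℝ (chartField m p₀ V) (chartField m p₀ W) (chartAt _ p₀ p₀) := by
  have e : ∀ V : ∀ q : M, TangentSpace (𝓡 m) q,
      VectorField.mpullbackWithin 𝓘(ℝ, EuclideanSpace ℝ (Fin m)) (𝓡 m)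
        (extChartAt (𝓡 m) p₀).symm V (Set.range (𝓡 m)) =ᶠ[𝓝 (chartAt _ p₀ p₀)]
          chartField m p₀ V := fun V => by
    filter_upwards [chart_target_mem_nhds (EuclideanSpace ℝ (Fin m)) p₀] with x hx
    have hx' : x ∈ (extChartAt (𝓡 m) p₀).target := by simpa using hx
    rw [VectorField.mpullbackWithin_apply]
    have h₁ := mfderiv_extChartAt_comp_mfderivWithin_extChartAt_symm hx'
    have h₂ := mfderivWithin_extChartAt_symm_comp_mfderiv_extChartAt hx'
    exact congrArg (fun L : TangentSpace (𝓡 m) ((extChartAt (𝓡 m) p₀).symm x) →L[ℝ]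
      EuclideanSpace ℝ (Fin m) => L (V ((extChartAt (𝓡 m) p₀).symm x)))
      (ContinuousLinearMap.inverse_eq h₂ h₁)
  obtain ⟨A, hA⟩ := isInvertible_chartDeriv (m := m) (mem_chart_source _ p₀)
  have hA' : (chartDeriv m p₀ p₀).inverse = A.symm := by rw [← hA, ContinuousLinearMap.inverse_equiv]
  have hu : (extChartAt (𝓡 m) p₀).symm ⁻¹' Set.univ ∩ Set.range (𝓡 m) = Set.univ := by simp
  have h : VectorField.mlieBracket (𝓡 m) V W p₀ =
      A.symm (VectorField.lieBracketWithin ℝ (chartField m p₀ V) (chartField m p₀ W) Set.univ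
        (chartAt _ p₀ p₀)) := by
    rw [← VectorField.mlieBracketWithin_univ, VectorField.mlieBracketWithin_apply, hu]
    refine (congrArg (fun L : EuclideanSpace ℝ (Fin m) →L[ℝ] TangentSpace (𝓡 m) p₀ => L _)
      hA').trans (congrArg A.symm ?_)
    exact Filter.EventuallyEq.lieBracketWithin_vectorField_eq_of_mem
      ((e V).filter_mono nhdsWithin_le_nhds) ((e W).filter_mono nhdsWithin_le_nhds) trivial
  rw [h, ← hA, VectorField.lieBracketWithin_univ]
  exact A.apply_symm_apply _

theorem fderiv_chart_comp {M' : Type*} [TopologicalSpace M']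
    [ChartedSpace (EuclideanSpace ℝ (Fin m)) M'] [IsManifold (𝓡 m) ∞ M'] {f : M → M'} {p₀ q : M}
    {q₀ : M'} (hf : MDifferentiableAt (𝓡 m) (𝓡 m) f q)
    (hq : q ∈ (chartAt (EuclideanSpace ℝ (Fin m)) p₀).source)
    (hq' : f q ∈ (chartAt (EuclideanSpace ℝ (Fin m)) q₀).source) (v : TangentSpace (𝓡 m) q) :
    fderiv ℝ (chartAt (EuclideanSpace ℝ (Fin m)) q₀ ∘ f ∘ (chartAt (EuclideanSpace ℝ (Fin m)) p₀).symm) (chartAt _ p₀ q)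
      (chartDeriv m p₀ q v) = chartDeriv m q₀ (f q) (mfderiv (𝓡 m) (𝓡 m) f q v) := by
  have h₁ : MDifferentiableAt 𝓘(ℝ, EuclideanSpace ℝ (Fin m)) (𝓡 m)
      (chartAt (EuclideanSpace ℝ (Fin m)) p₀).symm (chartAt _ p₀ q) :=
    mdifferentiableAt_atlas_symm (chart_mem_atlas _ _) (OpenPartialHomeomorph.map_source _ hq)
  have h₂ : MDifferentiableAt (𝓡 m) 𝓘(ℝ, EuclideanSpace ℝ (Fin m))
      (extChartAt (𝓡 m) q₀) (f q) := mdifferentiableAt_extChartAt hq'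
  have h₃ : MDifferentiableAt (𝓡 m) 𝓘(ℝ, EuclideanSpace ℝ (Fin m))
      (extChartAt (𝓡 m) p₀) q := mdifferentiableAt_extChartAt hq
  set G := chartAt (EuclideanSpace ℝ (Fin m)) q₀ ∘ f ∘ (chartAt (EuclideanSpace ℝ (Fin m)) p₀).symm with hG
  have h₄ : MDifferentiableAt 𝓘(ℝ, EuclideanSpace ℝ (Fin m)) 𝓘(ℝ, EuclideanSpace ℝ (Fin m))
      G (extChartAt (𝓡 m) p₀ q) := by
    have e : (chartAt (EuclideanSpace ℝ (Fin m)) p₀).symm (chartAt _ p₀ q) = q :=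
      OpenPartialHomeomorph.left_inv _ hq
    refine MDifferentiableAt.comp (I' := 𝓡 m) (chartAt _ p₀ q) ?_
      (MDifferentiableAt.comp (I' := 𝓡 m) (chartAt _ p₀ q) ?_ h₁)
    · simp only [Function.comp_apply, e]; simpa using! h₂
    · rw [e]; exact hf
  have e₁ : G ∘ extChartAt (𝓡 m) p₀ =ᶠ[𝓝 q] extChartAt (𝓡 m) q₀ ∘ f := by
    filter_upwards [(chartAt (EuclideanSpace ℝ (Fin m)) p₀).open_source.mem_nhds hq] with y hy
    simp [hG, OpenPartialHomeomorph.left_inv _ hy]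
  have e₂ := hasMFDerivAt_unique (h₄.hasMFDerivAt.comp q h₃.hasMFDerivAt)
    ((h₂.hasMFDerivAt.comp q hf.hasMFDerivAt).congr_of_eventuallyEq e₁)
  have e₃ := congrArg (fun L : TangentSpace (𝓡 m) q →L[ℝ] EuclideanSpace ℝ (Fin m) => L v) e₂
  rw [mfderiv_eq_fderiv] at e₃
  exact e₃

end ChartFields

/-! ### Adapted frames of almost CR structures -/

section AdaptedFrames

theorem LinearIndependent.congr_fun {ι E : Type*} [AddCommGroup E] [Module ℝ E] {v w : ι → E}
    (hv : LinearIndependent ℝ v) (h : ∀ i, v i = w i) : LinearIndependent ℝ w :=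
  (funext h : v = w) ▸ hv

variable {n m : ℕ} {r : WithTop ℕ∞} {M : Type*} [TopologicalSpace M]
  [ChartedSpace (EuclideanSpace ℝ (Fin m)) M] [IsManifold (𝓡 m) ∞ M]

theorem AlmostCRStructure.J_sum (S : AlmostCRStructure m r M) {q : M} {n : ℕ}
    {X Y : Fin n → TangentSpace (𝓡 m) q} (h : ∀ α, ∃ h : X α ∈ S.H q, Y α = S.J q ⟨X α, h⟩)
    (s t : Fin n → ℝ) (w : S.H q)
    (hw : (w : TangentSpace (𝓡 m) q) = ∑ β, (s β • X β + t β • Y β)) :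
    (S.J q w : TangentSpace (𝓡 m) q) = ∑ β, (s β • Y β - t β • X β) := by
  choose hX hY using h
  have e : w = ∑ β, (s β • (⟨X β, hX β⟩ : S.H q) + t β • S.J q ⟨X β, hX β⟩) := by
    ext1
    rw [hw, Submodule.coe_sum]
    exact Finset.sum_congr rfl fun β _ => by simp [hY]
  rw [e, map_sum, Submodule.coe_sum]
  refine Finset.sum_congr rfl fun β _ => ?_
  rw [map_add, map_smul, map_smul, S.J_J, hY]
  simp [sub_eq_add_neg]

/-- A real frame `X_α, Y_α = J X_α` of `H` near a point, completed to a frame of the tangent bundle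
in the chart at this point. -/
structure AdaptedFrame (S : AlmostCRStructure m r M) (n : ℕ) (p₀ : M) where
  X : Fin n → ∀ q : M, TangentSpace (𝓡 m) q
  Y : Fin n → ∀ q : M, TangentSpace (𝓡 m) q
  smooth_X : ∀ᶠ q in 𝓝 p₀, ∀ α, ContMDiffAt (𝓡 m) (𝓡 m).tangent r
    (fun q => (⟨q, X α q⟩ : TangentBundle (𝓡 m) M)) q
  smooth_Y : ∀ᶠ q in 𝓝 p₀, ∀ α, ContMDiffAt (𝓡 m) (𝓡 m).tangent r
    (fun q => (⟨q, Y α q⟩ : TangentBundle (𝓡 m) M)) q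
  horizontal : ∀ᶠ q in 𝓝 p₀, ∀ α, ∃ h : X α q ∈ S.H q, Y α q = S.J q ⟨X α q, h⟩
  frame : RealFrame n m r (chartAt (EuclideanSpace ℝ (Fin m)) p₀ p₀)
  vec_false : ∀ α, frame.vec (some (false, α)) = chartField m p₀ (X α)
  vec_true : ∀ α, frame.vec (some (true, α)) = chartField m p₀ (Y α)

instance (q : M) : FiniteDimensional ℝ (TangentSpace (𝓡 m) q) :=
  inferInstanceAs (FiniteDimensional ℝ (EuclideanSpace ℝ (Fin m)))

/-- An adapted basis of `H` at `p₀` is extended with constant coefficients in a local frame of `H`;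
applying `J` gives the other half, smooth since `J` preserves smooth sections. -/
theorem AlmostCRStructure.exists_horizontal_fields [IsManifold (𝓡 m) (r + 1) M]
    (S : AlmostCRStructure m r M) (hS : S.IsHypersurfaceType) (hn : 2 * n + 1 = m) (p₀ : M) :
    ∃ X Y : Fin n → ∀ q : M, TangentSpace (𝓡 m) q,
      (∀ᶠ q in 𝓝 p₀, ∀ α, ContMDiffAt (𝓡 m) (𝓡 m).tangent r
        (fun q => (⟨q, X α q⟩ : TangentBundle (𝓡 m) M)) q) ∧
      (∀ᶠ q in 𝓝 p₀, ∀ α, ContMDiffAt (𝓡 m) (𝓡 m).tangent r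
        (fun q => (⟨q, Y α q⟩ : TangentBundle (𝓡 m) M)) q) ∧
      (∀ᶠ q in 𝓝 p₀, ∀ α, ∃ h : X α q ∈ S.H q, Y α q = S.J q ⟨X α q, h⟩) ∧
      LinearIndependent ℝ (fun i : Bool × Fin n => bif i.1 then Y i.2 p₀ else X i.2 p₀) := by
  classical
  obtain ⟨n', b, hb⟩ := exists_adapted_basis (S.J p₀) (S.J_J p₀)
  obtain rfl : n' = n := by
    have h₁ := Module.finrank_eq_card_basis b
    have h₂ := hS p₀
    simp only [Fintype.card_prod, Fintype.card_fin] at h₁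
    omega
  obtain ⟨U, hU, hp, k, X₀, hX₀, hspan⟩ := S.exists_frame p₀
  have hc : ∀ α, ∃ c : Fin k → ℝ, ∑ j, c j • X₀ j p₀ = b (0, α) := fun α => by
    have : (b (0, α) : TangentSpace (𝓡 m) p₀) ∈
        Submodule.span ℝ (Set.range fun j => X₀ j p₀) := by
      rw [(hspan p₀ hp).2]
      exact (b (0, α)).2
    exact (Submodule.mem_span_range_iff_exists_fun ℝ).1 this
  choose c hc using hc
  have hXH : ∀ α, ∀ q ∈ U, ∑ j, c α j • X₀ j q ∈ S.H q := fun α q hq => by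
    rw [← (hspan q hq).2]
    exact sum_mem fun j _ => Submodule.smul_mem _ _ (Submodule.subset_span ⟨j, rfl⟩)
  let X : Fin n' → ∀ q : M, TangentSpace (𝓡 m) q := fun α q => ∑ j, c α j • X₀ j q
  -- The value `0` is only a filler off `U`, where `X α q` may fail to lie in `H`.
  let Y : Fin n' → ∀ q : M, TangentSpace (𝓡 m) q := fun α q =>
    if h : X α q ∈ S.H q then S.J q ⟨X α q, h⟩ else 0
  have hY : ∀ α, ∀ q ∈ U, ∃ h : X α q ∈ S.H q, Y α q = S.J q ⟨X α q, h⟩ := fun α q hq =>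
    ⟨hXH α q hq, dif_pos (hXH α q hq)⟩
  have := TangentBundle.contMDiffVectorBundle (I := 𝓡 m) (M := M) (n := r)
  have hXs : ∀ α, ContMDiffOn (𝓡 m) (𝓡 m).tangent r
      (fun q => (⟨q, X α q⟩ : TangentBundle (𝓡 m) M)) U := fun α =>
    ContMDiffOn.sum_section fun j _ => (hX₀ j).const_smul_section
  have hYs : ∀ α, ContMDiffOn (𝓡 m) (𝓡 m).tangent r
      (fun q => (⟨q, Y α q⟩ : TangentBundle (𝓡 m) M)) U := fun α =>
    S.contMDiffOn_J U hU (X α) (Y α) (hY α) (hXs α)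
  have hXp : ∀ α, X α p₀ = b (0, α) := hc
  have hYp : ∀ α, Y α p₀ = b (1, α) := fun α => by
    obtain ⟨h, e⟩ := hY α p₀ hp
    rw [e, hb]
    congr 2
    exact Subtype.ext (hXp α)
  refine ⟨X, Y, ?_, ?_, ?_, ?_⟩
  · filter_upwards [hU.mem_nhds hp] with q hq α using (hXs α).contMDiffAt (hU.mem_nhds hq)
  · filter_upwards [hU.mem_nhds hp] with q hq α using (hYs α).contMDiffAt (hU.mem_nhds hq)
  · filter_upwards [hU.mem_nhds hp] with q hq α using hY α q hq
  · have h₁ : LinearIndependent ℝ fun i => (b i : TangentSpace (𝓡 m) p₀) :=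
      b.linearIndependent.map' (S.H p₀).subtype (Submodule.ker_subtype _)
    let φ : Bool × Fin n' → Fin 2 × Fin n' := fun i => (bif i.1 then 1 else 0, i.2)
    have hφ : Function.Injective φ := by
      rintro ⟨p, α⟩ ⟨q, β⟩ h
      cases p <;> cases q <;> simp_all [φ]
    have h₂ := h₁.comp φ hφ
    refine h₂.congr_fun ?_
    rintro ⟨p, α⟩
    cases p
    · exact (hXp α).symm
    · exact (hYp α).symm

theorem exists_linearIndependent_option {ι E : Type*} [Fintype ι] [AddCommGroup E] [Module ℝ E]
    [FiniteDimensional ℝ E] {v : ι → E} (hv : LinearIndependent ℝ v)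
    (h : Fintype.card ι < Module.finrank ℝ E) :
    ∃ w : E, LinearIndependent ℝ (fun i : Option ι => i.elim w v) := by
  have hne : Submodule.span ℝ (Set.range v) ≠ ⊤ := fun e => by
    have := finrank_span_eq_card hv
    rw [e, finrank_top] at this
    omega
  obtain ⟨w, -, hw⟩ := SetLike.exists_of_lt (lt_top_iff_ne_top.2 hne)
  exact ⟨w, ((linearIndependent_option' (v := v)).2 ⟨hv, hw⟩).congr_fun fun i => by cases i <;> rfl⟩

theorem AlmostCRStructure.exists_adaptedFrame [IsManifold (𝓡 m) r M] [IsManifold (𝓡 m) (r + 1) M]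
    (S : AlmostCRStructure m r M) (hS : S.IsHypersurfaceType) (hn : 2 * n + 1 = m) (p₀ : M) :
    Nonempty (AdaptedFrame S n p₀) := by
  obtain ⟨X, Y, hX, hY, hh, hind⟩ := S.exists_horizontal_fields hS hn p₀
  have hp := mem_chart_source (EuclideanSpace ℝ (Fin m)) p₀
  have hind' : LinearIndependent ℝ (fun i : Bool × Fin n =>
      bif i.1 then chartField m p₀ (Y i.2) (chartAt _ p₀ p₀)
        else chartField m p₀ (X i.2) (chartAt _ p₀ p₀)) := by
    have := hind.map' (chartDeriv m p₀ p₀).toLinearMap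
      (LinearMap.ker_eq_bot.2 (chartDeriv_injective hp))
    refine this.congr_fun ?_
    rintro ⟨p, α⟩
    cases p
    · exact (chartField_chartAt p₀ (X α) hp).symm
    · exact (chartField_chartAt p₀ (Y α) hp).symm
  obtain ⟨T, hT⟩ := exists_linearIndependent_option hind' (by
    simp only [Fintype.card_prod, Fintype.card_bool, Fintype.card_fin, finrank_euclideanSpace]
    omega)
  -- The transversal field is constant in the chart; only its independence from `H` at `p₀` matters.
  obtain ⟨F, hF⟩ := exists_realFrame hn (r := r) (x₀ := chartAt (EuclideanSpace ℝ (Fin m)) p₀ p₀)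
    (R := fun i y => i.elim T fun i => bif i.1 then chartField m p₀ (Y i.2) y
      else chartField m p₀ (X i.2) y) (fun i => by
        rcases i with _ | ⟨_ | _, α⟩
        · exact .const _
        · exact smoothNearAt_chartField (hX.mono fun q hq => hq α)
        · exact smoothNearAt_chartField (hY.mono fun q hq => hq α)) (by
    refine hT.congr_fun ?_
    rintro (_ | ⟨_ | _, α⟩) <;> rfl)
  exact ⟨⟨X, Y, hX, hY, hh, F, fun α => by rw [hF]; rfl, fun α => by rw [hF]; rfl⟩⟩

namespace AdaptedFrame

variable {S : AlmostCRStructure m r M} {p₀ : M} (A : AdaptedFrame S n p₀)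

theorem eventually_chart (p₀ : M) {p : EuclideanSpace ℝ (Fin m) → Prop}
    (h : ∀ᶠ y in 𝓝 (chartAt (EuclideanSpace ℝ (Fin m)) p₀ p₀), p y) :
    ∀ᶠ q in 𝓝 p₀, p (chartAt _ p₀ q) :=
  (((chartAt (EuclideanSpace ℝ (Fin m)) p₀).continuousAt (by simp)).tendsto).eventually h

/-- The vectors `X_α`, `Y_α` span `H`. -/
theorem exists_coeff (hS : S.IsHypersurfaceType) (hn : 2 * n + 1 = m) :
    ∀ᶠ q in 𝓝 p₀, ∀ w : S.H q, ∃ s t : Fin n → ℝ,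
      (w : TangentSpace (𝓡 m) q) = ∑ β, (s β • A.X β q + t β • A.Y β q) := by
  filter_upwards [A.horizontal, eventually_chart p₀ A.frame.vec_covec,
    chart_source_mem_nhds (EuclideanSpace ℝ (Fin m)) p₀] with q hh hd hq w
  choose hX hY using hh
  let v : Bool × Fin n → S.H q := fun i => bif i.1 then S.J q ⟨A.X i.2 q, hX i.2⟩
    else ⟨A.X i.2 q, hX i.2⟩
  have hv : ∀ i, chartDeriv m p₀ q (v i) = A.frame.vec (some i) (chartAt _ p₀ q) := by
    rintro ⟨_ | _, α⟩
    · rw [A.vec_false, chartField_chartAt _ _ hq]; rfl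
    · rw [A.vec_true, chartField_chartAt _ _ hq, hY]; rfl
  have hind : LinearIndependent ℝ v := by
    rw [Fintype.linearIndependent_iff]
    intro g hg j
    have h₁ : ∑ i, g i • A.frame.vec (some i) (chartAt _ p₀ q) = 0 := by
      have := congrArg (fun u : S.H q => chartDeriv m p₀ q u) hg
      simpa [hv] using this
    have h₂ : ∑ k, (∑ i, g i • A.frame.vec (some i) (chartAt _ p₀ q)) k *
        A.frame.covec k (some j) (chartAt _ p₀ q) = 0 := by
      rw [h₁]; simp
    simp only [WithLp.ofLp_sum, Finset.sum_apply, PiLp.smul_apply, smul_eq_mul,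
      Finset.sum_mul] at h₂
    rw [Finset.sum_comm] at h₂
    simpa [mul_assoc, ← Finset.mul_sum, hd] using h₂
  have hcard : Fintype.card (Bool × Fin n) = Module.finrank ℝ (S.H q) := by
    have := hS q
    simp only [Fintype.card_prod, Fintype.card_bool, Fintype.card_fin]
    omega
  have hspan := hind.span_eq_top_of_card_eq_finrank' hcard
  have hw : w ∈ Submodule.span ℝ (Set.range v) := hspan ▸ Submodule.mem_top
  obtain ⟨c, hc⟩ := (Submodule.mem_span_range_iff_exists_fun ℝ).1 hw
  refine ⟨fun β => c (false, β), fun β => c (true, β), ?_⟩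
  rw [← hc, Fintype.sum_prod_type, Fintype.sum_bool, ← Finset.sum_add_distrib, Submodule.coe_sum]
  refine Finset.sum_congr rfl fun β _ => ?_
  rw [add_comm]
  simp [v, hY]

end AdaptedFrame

end AdaptedFrames

/-! ### Real and imaginary parts in a complexified vector space -/

section Complexification

variable {V W : Type*} [AddCommGroup V] [Module ℝ V] [AddCommGroup W] [Module ℝ W]

/-- The real part of a vector in the complexification. -/
def tensorRe : ℂ ⊗[ℝ] V →ₗ[ℝ] V :=
  (TensorProduct.lid ℝ V).toLinearMap ∘ₗ LinearMap.rTensor V Complex.reLm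

/-- The imaginary part of a vector in the complexification. -/
def tensorIm : ℂ ⊗[ℝ] V →ₗ[ℝ] V :=
  (TensorProduct.lid ℝ V).toLinearMap ∘ₗ LinearMap.rTensor V Complex.imLm

@[simp] theorem tensorRe_tmul (z : ℂ) (v : V) : tensorRe (z ⊗ₜ[ℝ] v) = z.re • v := by
  simp [tensorRe]

@[simp] theorem tensorIm_tmul (z : ℂ) (v : V) : tensorIm (z ⊗ₜ[ℝ] v) = z.im • v := by
  simp [tensorIm]

theorem tensor_re_add_im (w : ℂ ⊗[ℝ] V) :
    (1 : ℂ) ⊗ₜ[ℝ] tensorRe w + Complex.I ⊗ₜ[ℝ] tensorIm w = w := by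
  induction w using TensorProduct.induction_on with
  | zero => simp
  | tmul z v =>
    rw [tensorRe_tmul, tensorIm_tmul, TensorProduct.tmul_smul, TensorProduct.tmul_smul,
      TensorProduct.smul_tmul', TensorProduct.smul_tmul', ← TensorProduct.add_tmul]
    congr 1
    apply Complex.ext <;> simp
  | add x y hx hy =>
    conv_rhs => rw [← hx, ← hy]
    simp only [map_add, TensorProduct.tmul_add]
    abel

theorem tensor_ext {a b a' b' : V} (h : (1 : ℂ) ⊗ₜ[ℝ] a + Complex.I ⊗ₜ[ℝ] b =
    (1 : ℂ) ⊗ₜ[ℝ] a' + Complex.I ⊗ₜ[ℝ] b') : a = a' ∧ b = b' := by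
  refine ⟨?_, ?_⟩
  · simpa using congrArg tensorRe h
  · simpa using congrArg tensorIm h

theorem mem_eigenspace_baseChange_iff (J : V →ₗ[ℝ] V) (a b : V) :
    (1 : ℂ) ⊗ₜ[ℝ] a + Complex.I ⊗ₜ[ℝ] b ∈
      Module.End.eigenspace (J.baseChange ℂ) Complex.I ↔ J a = -b ∧ J b = a := by
  rw [Module.End.mem_eigenspace_iff]
  have h₁ : (J.baseChange ℂ) ((1 : ℂ) ⊗ₜ[ℝ] a + Complex.I ⊗ₜ[ℝ] b) =
      (1 : ℂ) ⊗ₜ[ℝ] J a + Complex.I ⊗ₜ[ℝ] J b := by simp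
  have h₂ : Complex.I • ((1 : ℂ) ⊗ₜ[ℝ] a + Complex.I ⊗ₜ[ℝ] b) =
      (1 : ℂ) ⊗ₜ[ℝ] (-b) + Complex.I ⊗ₜ[ℝ] a := by
    rw [smul_add, TensorProduct.smul_tmul', TensorProduct.smul_tmul', smul_eq_mul, smul_eq_mul,
      mul_one, Complex.I_mul_I, TensorProduct.neg_tmul, TensorProduct.tmul_neg, add_comm]
  rw [h₁, h₂]
  exact ⟨tensor_ext, fun h => by rw [h.1, h.2]⟩

end Complexification

/-! ### Vectors of type `(1,0)` by real and imaginary parts -/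

section AlmostCR

variable {n m : ℕ} {r : WithTop ℕ∞} {M : Type*} [TopologicalSpace M]
  [ChartedSpace (EuclideanSpace ℝ (Fin m)) M] [IsManifold (𝓡 m) ∞ M]
  (S : AlmostCRStructure m r M)

/-- The eigenvector condition is `J a = -b` and `J b = a`; the second follows from the first by `J²
= -1`. -/
theorem AlmostCRStructure.mem_H10_iff {q : M} (a b : TangentSpace (𝓡 m) q) :
    (1 : ℂ) ⊗ₜ[ℝ] a + Complex.I ⊗ₜ[ℝ] b ∈ S.H10 q ↔
      ∃ h : a ∈ S.H q, b = -(S.J q ⟨a, h⟩ : TangentSpace (𝓡 m) q) := by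
  have hmap : ∀ u v : S.H q, ((S.H q).subtype.baseChange ℂ)
      ((1 : ℂ) ⊗ₜ[ℝ] u + Complex.I ⊗ₜ[ℝ] v) =
        (1 : ℂ) ⊗ₜ[ℝ] (u : TangentSpace (𝓡 m) q) + Complex.I ⊗ₜ[ℝ] (v : TangentSpace (𝓡 m) q) :=
    fun u v => by simp
  constructor
  · rintro ⟨w, hw, e⟩
    rw [← tensor_re_add_im w] at hw e
    rw [hmap] at e
    obtain ⟨h₁, h₂⟩ := tensor_ext e
    subst h₁ h₂
    refine ⟨(tensorRe w).2, ?_⟩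
    have := ((mem_eigenspace_baseChange_iff _ _ _).1 hw).1
    rw [Subtype.coe_eta, this]
    simp
  · rintro ⟨h, rfl⟩
    refine ⟨(1 : ℂ) ⊗ₜ[ℝ] (⟨a, h⟩ : S.H q) + Complex.I ⊗ₜ[ℝ] (-(S.J q ⟨a, h⟩)), ?_, ?_⟩
    · refine (mem_eigenspace_baseChange_iff _ _ _).2 ⟨by simp, by simp [S.J_J]⟩
    · rw [hmap]
      simp

theorem AlmostCRStructure.mem_complexH {q : M} {a b : TangentSpace (𝓡 m) q} (ha : a ∈ S.H q)
    (hb : b ∈ S.H q) : (1 : ℂ) ⊗ₜ[ℝ] a + Complex.I ⊗ₜ[ℝ] b ∈ S.complexH q :=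
  add_mem (Submodule.tmul_mem_baseChange_of_mem _ ha) (Submodule.tmul_mem_baseChange_of_mem _ hb)

end AlmostCR

/-! ### CR diffeomorphisms in adapted frames -/

section CRMaps

variable {n m : ℕ} {r : WithTop ℕ∞} {M M' : Type*}
  [TopologicalSpace M] [ChartedSpace (EuclideanSpace ℝ (Fin m)) M] [IsManifold (𝓡 m) ∞ M]
  [TopologicalSpace M'] [ChartedSpace (EuclideanSpace ℝ (Fin m)) M'] [IsManifold (𝓡 m) ∞ M']

theorem contDiffAt_atlas_comp {f : M → M'} {q : M} (hf : ContMDiffAt (𝓡 m) (𝓡 m) ∞ f q)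
    {e : OpenPartialHomeomorph M (EuclideanSpace ℝ (Fin m))}
    (he : e ∈ atlas (EuclideanSpace ℝ (Fin m)) M)
    {e' : OpenPartialHomeomorph M' (EuclideanSpace ℝ (Fin m))}
    (he' : e' ∈ atlas (EuclideanSpace ℝ (Fin m)) M') (hq : q ∈ e.source)
    (hq' : f q ∈ e'.source) : ContDiffAt ℝ ∞ (e' ∘ f ∘ e.symm) (e q) := by
  have h₁ : ContMDiffAt (𝓡 m) (𝓡 m) ∞ e.symm (e q) :=
    (contMDiffOn_symm_of_mem_maximalAtlas (IsManifold.subset_maximalAtlas he)).contMDiffAt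
      (e.open_target.mem_nhds (e.map_source hq))
  have h₂ : ContMDiffAt (𝓡 m) (𝓡 m) ∞ e' (f q) :=
    (contMDiffOn_of_mem_maximalAtlas (IsManifold.subset_maximalAtlas he')).contMDiffAt
      (e'.open_source.mem_nhds hq')
  have h₃ : e.symm (e q) = q := e.left_inv hq
  have h₄ : ContMDiffAt (𝓡 m) (𝓡 m) ∞ (f ∘ e.symm) (e q) :=
    ContMDiffAt.comp (e q) (h₃.symm ▸ hf) h₁
  have h₅ : (f ∘ e.symm) (e q) = f q := congrArg f h₃
  exact (ContMDiffAt.comp (e q) (h₅.symm ▸ h₂) h₄).contDiffAt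

/-- The differential maps `X_α` to some `∑ (s_β X'_β + t_β Y'_β)`, and commuting with `J` determines
the image of `Y_α = J X_α`. The neighbourhoods depend on the two frames alone, which keeps the final
statement uniform in `f`. -/
theorem isAdaptedNear_of_isCRDiffeo {S : AlmostCRStructure m r M} {S' : AlmostCRStructure m r M'}
    (hS' : S'.IsHypersurfaceType) (hn : 2 * n + 1 = m) {p₀ : M} {q₀ : M'}
    (A : AdaptedFrame S n p₀) (A' : AdaptedFrame S' n q₀) :
    ∃ U ∈ 𝓝 p₀, ∃ U' ∈ 𝓝 q₀, ∀ f : PartialDiffeomorph (𝓡 m) (𝓡 m) M M' ∞, IsCRDiffeo S S' f →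
      ∀ p ∈ f.source, p ∈ U → f p ∈ U' →
        IsAdaptedNear A.frame.toComplex A'.frame.toComplex
          (chartAt (EuclideanSpace ℝ (Fin m)) q₀ ∘ f ∘
            (chartAt (EuclideanSpace ℝ (Fin m)) p₀).symm) (chartAt _ p₀ p) := by
  have h₁ : ∀ᶠ q in 𝓝 p₀, q ∈ (chartAt (EuclideanSpace ℝ (Fin m)) p₀).source ∧
      ∀ α, ∃ h : A.X α q ∈ S.H q, A.Y α q = S.J q ⟨A.X α q, h⟩ :=
    Filter.Eventually.and (chart_source_mem_nhds (EuclideanSpace ℝ (Fin m)) p₀) A.horizontal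
  have h₂ : ∀ᶠ q in 𝓝 q₀, q ∈ (chartAt (EuclideanSpace ℝ (Fin m)) q₀).source ∧
      (∀ i j, ∑ k, A'.frame.vec i (chartAt _ q₀ q) k * A'.frame.covec k j (chartAt _ q₀ q) =
        if i = j then 1 else 0) ∧
      (∀ α, ∃ h : A'.X α q ∈ S'.H q, A'.Y α q = S'.J q ⟨A'.X α q, h⟩) ∧
      ∀ w : S'.H q, ∃ s t : Fin n → ℝ,
        (w : TangentSpace (𝓡 m) q) = ∑ β, (s β • A'.X β q + t β • A'.Y β q) :=
    Filter.Eventually.and (chart_source_mem_nhds (EuclideanSpace ℝ (Fin m)) q₀)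
      ((AdaptedFrame.eventually_chart q₀ A'.frame.vec_covec).and
        (A'.horizontal.and (A'.exists_coeff hS' hn)))
  obtain ⟨U, hU, hUo, hpU⟩ := eventually_nhds_iff.1 h₁
  obtain ⟨U', hU', hUo', hqU'⟩ := eventually_nhds_iff.1 h₂
  refine ⟨U, hUo.mem_nhds hpU, U', hUo'.mem_nhds hqU', fun f hf p hp hpU hpU' => ?_⟩
  have hpc := (hU p hpU).1
  have hcont : Tendsto (chartAt (EuclideanSpace ℝ (Fin m)) p₀).symm
      (𝓝 (chartAt (EuclideanSpace ℝ (Fin m)) p₀ p)) (𝓝 p) := by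
    have := (chartAt (EuclideanSpace ℝ (Fin m)) p₀).symm.continuousAt
      (x := chartAt (EuclideanSpace ℝ (Fin m)) p₀ p)
      ((chartAt (EuclideanSpace ℝ (Fin m)) p₀).map_source hpc)
    rwa [ContinuousAt, OpenPartialHomeomorph.left_inv _ hpc] at this
  have hsm : ∀ q ∈ f.source, ContMDiffAt (𝓡 m) (𝓡 m) ∞ f q := fun q hq =>
    f.contMDiffOn_toFun.contMDiffAt (f.open_source.mem_nhds hq)
  have hev : ∀ᶠ q in 𝓝 p, q ∈ f.source ∧ q ∈ U ∧ f q ∈ U' :=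
    Filter.Eventually.and (f.open_source.mem_nhds hp)
      (Filter.Eventually.and (hUo.mem_nhds hpU)
        ((hsm p hp).continuousAt.tendsto.eventually (hUo'.mem_nhds hpU')))
  rw [IsAdaptedNear]
  filter_upwards [hcont.eventually hev, (chartAt (EuclideanSpace ℝ (Fin m))
    p₀).open_target.mem_nhds ((chartAt (EuclideanSpace ℝ (Fin m)) p₀).map_source hpc)]
    with y ⟨hq, hqU, hqU'⟩ hy
  obtain ⟨q, hqy, rfl⟩ : ∃ q, q = (chartAt (EuclideanSpace ℝ (Fin m)) p₀).symm y ∧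
      chartAt (EuclideanSpace ℝ (Fin m)) p₀ q = y :=
    ⟨_, rfl, OpenPartialHomeomorph.right_inv _ hy⟩
  rw [← hqy] at hq hqU hqU'
  obtain ⟨hqs, hqh⟩ := hU q hqU
  obtain ⟨hqs', hdual, hqh', hspan⟩ := hU' _ hqU'
  have hg : (chartAt (EuclideanSpace ℝ (Fin m)) q₀ ∘ f ∘
      (chartAt (EuclideanSpace ℝ (Fin m)) p₀).symm) (chartAt _ p₀ q) =
        chartAt (EuclideanSpace ℝ (Fin m)) q₀ (f q) := by
    simp only [Function.comp_apply, OpenPartialHomeomorph.left_inv _ hqs]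
  have hmat : ∀ α, ∃ s t : Fin n → ℝ, ∀ p j, frameMatrix A.frame.toComplex A'.frame.toComplex
      (chartAt _ p₀ q) (chartAt _ q₀ (f q)) (fderiv ℝ (chartAt (EuclideanSpace ℝ (Fin m)) q₀ ∘ f ∘
        (chartAt (EuclideanSpace ℝ (Fin m)) p₀).symm) (chartAt _ p₀ q)) (some (p, α)) j =
          ∑ β, ((s β : ℂ) - RealFrame.unit p * t β) * if some (p, β) = j then 1 else 0 := by
    intro α
    obtain ⟨hX, hY⟩ := hqh α
    obtain ⟨hf₁, hf₂⟩ := hf q hq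
    have hw := (hf₁ _).2 ⟨_, hX, rfl⟩
    obtain ⟨s, t, hst⟩ := hspan ⟨_, hw⟩
    have hJ := S'.J_sum hqh' s t ⟨_, hw⟩ hst
    have hJ' := hf₂ ⟨_, hX⟩ ⟨_, hw⟩ rfl
    rw [hJ, ← hY] at hJ'
    have hmd := (hsm q hq).mdifferentiableAt (by simp)
    have hvec : ∀ β, A'.frame.vec (some (false, β)) (chartAt _ q₀ (f q)) =
        chartDeriv m q₀ (f q) (A'.X β (f q)) := fun β => by
      rw [A'.vec_false, chartField_chartAt _ _ hqs']
    have hvec' : ∀ β, A'.frame.vec (some (true, β)) (chartAt _ q₀ (f q)) =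
        chartDeriv m q₀ (f q) (A'.Y β (f q)) := fun β => by
      rw [A'.vec_true, chartField_chartAt _ _ hqs']
    refine ⟨s, t, RealFrame.frameMatrix_toComplex A.frame A'.frame hdual ?_ ?_⟩
    · rw [A.vec_false, chartField_chartAt _ _ hqs, fderiv_chart_comp hmd hqs hqs']
      simp only [hvec, hvec', ← map_smul, ← map_add, ← map_sum]
      exact congrArg _ hst
    · rw [A.vec_true, chartField_chartAt _ _ hqs, fderiv_chart_comp hmd hqs hqs', hJ']
      simp only [hvec, hvec', ← map_smul, ← map_sub, ← map_sum]
  rw [hg]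
  refine ⟨contDiffAt_atlas_comp (hsm q hq) (chart_mem_atlas _ _) (chart_mem_atlas _ _) hqs hqs',
    fun p α => ?_, fun p α β => ?_⟩
  · obtain ⟨s, t, h⟩ := hmat α
    rw [h]
    simp
  · obtain ⟨s, t, h⟩ := hmat α
    rw [h]
    simp

end CRMaps

/-! ### The Levi form in adapted frames -/

section ContactDeriv

variable {n m : ℕ} {r : WithTop ℕ∞} {x : EuclideanSpace ℝ (Fin m)}

/-- The component along a covector `θ` of the derivative of the complex vector field `W` in the
direction `P`. -/
def contactDeriv (θ : Fin m → ℂ) (x : EuclideanSpace ℝ (Fin m)) (P : Fin m → ℂ)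
    (W : Fin m → EuclideanSpace ℝ (Fin m) → ℂ) : ℂ :=
  ∑ l, (∑ s, P s * fderiv ℝ (W l) x (stdVec s)) * θ l

theorem contactDeriv_eq (θ : Fin m → ℂ) (P : Fin m → ℂ)
    (W : Fin m → EuclideanSpace ℝ (Fin m) → ℂ) :
    contactDeriv θ x P W = ∑ s, P s * ∑ l, fderiv ℝ (W l) x (stdVec s) * θ l := by
  simp only [contactDeriv, Finset.sum_mul, Finset.mul_sum]
  rw [Finset.sum_comm]
  exact Finset.sum_congr rfl fun s _ => Finset.sum_congr rfl fun l _ => by ring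

/-- The complex vector field with the given real and imaginary parts. -/
def complexField (V W : EuclideanSpace ℝ (Fin m) → EuclideanSpace ℝ (Fin m)) (l : Fin m)
    (y : EuclideanSpace ℝ (Fin m)) : ℂ :=
  (V y l : ℂ) + Complex.I * (W y l : ℂ)

theorem hasFDerivAt_complexField {V W : EuclideanSpace ℝ (Fin m) → EuclideanSpace ℝ (Fin m)}
    (hV : DifferentiableAt ℝ V x) (hW : DifferentiableAt ℝ W x) (l : Fin m) :
    HasFDerivAt (complexField V W l)
      ((Complex.ofRealCLM.comp (EuclideanSpace.proj l)).comp (fderiv ℝ V x) +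
        Complex.I • (Complex.ofRealCLM.comp (EuclideanSpace.proj l)).comp (fderiv ℝ W x)) x := by
  let π : EuclideanSpace ℝ (Fin m) →L[ℝ] ℂ := Complex.ofRealCLM.comp (EuclideanSpace.proj l)
  have h₁ : HasFDerivAt (fun y => π (V y)) (π.comp (fderiv ℝ V x)) x :=
    π.hasFDerivAt.comp x hV.hasFDerivAt
  have h₂ : HasFDerivAt (fun y => π (W y)) (π.comp (fderiv ℝ W x)) x :=
    π.hasFDerivAt.comp x hW.hasFDerivAt
  exact h₁.add (h₂.const_mul Complex.I)

theorem fderiv_complexField {V W : EuclideanSpace ℝ (Fin m) → EuclideanSpace ℝ (Fin m)}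
    (hV : DifferentiableAt ℝ V x) (hW : DifferentiableAt ℝ W x) (l : Fin m)
    (v : EuclideanSpace ℝ (Fin m)) : fderiv ℝ (complexField V W l) x v =
      ((fderiv ℝ V x v l : ℝ) : ℂ) + Complex.I * ((fderiv ℝ W x v l : ℝ) : ℂ) := by
  rw [(hasFDerivAt_complexField hV hW l).fderiv]
  rfl

theorem sum_complexField_mul {V W : EuclideanSpace ℝ (Fin m) → EuclideanSpace ℝ (Fin m)}
    (L : EuclideanSpace ℝ (Fin m) →L[ℝ] EuclideanSpace ℝ (Fin m)) (l : Fin m) :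
    ∑ s, complexField V W s x * ((L (stdVec s) l : ℝ) : ℂ) =
      ((L (V x) l : ℝ) : ℂ) + Complex.I * ((L (W x) l : ℝ) : ℂ) := by
  simp only [complexField, add_mul, Finset.sum_add_distrib, mul_assoc, ← Finset.mul_sum,
    RealFrame.sum_coord_mul]

theorem contactDeriv_sub_contactDeriv (θ : Fin m → ℂ)
    {V₁ V₂ W₁ W₂ : EuclideanSpace ℝ (Fin m) → EuclideanSpace ℝ (Fin m)}
    (hV₁ : DifferentiableAt ℝ V₁ x) (hV₂ : DifferentiableAt ℝ V₂ x)
    (hW₁ : DifferentiableAt ℝ W₁ x) (hW₂ : DifferentiableAt ℝ W₂ x) :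
    contactDeriv θ x (fun s => complexField V₁ V₂ s x) (complexField W₁ W₂) -
      contactDeriv θ x (fun s => complexField W₁ W₂ s x) (complexField V₁ V₂) =
    ∑ l, (((VectorField.lieBracket ℝ V₁ W₁ x - VectorField.lieBracket ℝ V₂ W₂ x) l : ℂ) +
      Complex.I *
        ((VectorField.lieBracket ℝ V₁ W₂ x + VectorField.lieBracket ℝ V₂ W₁ x) l : ℂ)) * θ l := by
  simp only [contactDeriv, ← Finset.sum_sub_distrib]
  refine Finset.sum_congr rfl fun l _ => ?_
  simp only [fderiv_complexField hV₁ hV₂, fderiv_complexField hW₁ hW₂, mul_add,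
    mul_left_comm _ Complex.I, Finset.sum_add_distrib, ← Finset.mul_sum, sum_complexField_mul,
    VectorField.lieBracket_eq, PiLp.sub_apply, PiLp.add_apply, Complex.ofReal_sub,
    Complex.ofReal_add]
  linear_combination ((fderiv ℝ W₂ x (V₂ x) l : ℂ) - (fderiv ℝ V₂ x (W₂ x) l : ℂ)) * θ l *
    Complex.I_mul_I

/-- Tensoriality: the covector `θ` annihilates the fields `Z β`, so the terms in which the
coefficients are differentiated vanish. -/
theorem contactDeriv_sum_right (θ : Fin m → ℂ) (P : Fin m → ℂ)
    {W : Fin m → EuclideanSpace ℝ (Fin m) → ℂ} {c : Fin n → EuclideanSpace ℝ (Fin m) → ℂ}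
    {Z : Fin n → Fin m → EuclideanSpace ℝ (Fin m) → ℂ}
    (hc : ∀ β, DifferentiableAt ℝ (c β) x) (hZ : ∀ β l, DifferentiableAt ℝ (Z β l) x)
    (hθ : ∀ β, ∑ l, Z β l x * θ l = 0)
    (hW : ∀ᶠ y in 𝓝 x, ∀ l, W l y = ∑ β, c β y * Z β l y) :
    contactDeriv θ x P W = ∑ β, c β x * contactDeriv θ x P (Z β) := by
  have hd : ∀ l v, fderiv ℝ (W l) x v =
      ∑ β, (c β x * fderiv ℝ (Z β l) x v + fderiv ℝ (c β) x v * Z β l x) := fun l v => by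
    have e : W l =ᶠ[𝓝 x] fun y => ∑ β, c β y * Z β l y := hW.mono fun y hy => hy l
    rw [e.fderiv_eq, fderiv_fun_sum fun β _ => (hc β).fun_mul (hZ β l),
      sum_apply]
    refine Finset.sum_congr rfl fun β _ => ?_
    rw [fderiv_fun_mul (hc β) (hZ β l)]
    simp [mul_comm]
  have h : ∀ s, ∑ l, fderiv ℝ (W l) x (stdVec s) * θ l =
      ∑ β, c β x * ∑ l, fderiv ℝ (Z β l) x (stdVec s) * θ l := fun s => by
    have h₀ : ∑ β, fderiv ℝ (c β) x (stdVec s) * ∑ l, Z β l x * θ l = 0 := by simp [hθ]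
    rw [← add_zero (∑ β, c β x * _), ← h₀, ← Finset.sum_add_distrib]
    simp only [hd, Finset.mul_sum, Finset.sum_mul, ← Finset.sum_add_distrib]
    rw [Finset.sum_comm]
    exact Finset.sum_congr rfl fun β _ => Finset.sum_congr rfl fun l _ => by ring
  simp only [contactDeriv_eq, h, Finset.mul_sum]
  rw [Finset.sum_comm]
  exact Finset.sum_congr rfl fun β _ => Finset.sum_congr rfl fun s _ =>
    Finset.sum_congr rfl fun l _ => by ring

theorem contactDeriv_sum_left (θ : Fin m → ℂ) {κ : Type*} [Fintype κ] (c : κ → ℂ)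
    (P : κ → Fin m → ℂ) (W : Fin m → EuclideanSpace ℝ (Fin m) → ℂ) :
    contactDeriv θ x (fun s => ∑ β, c β * P β s) W = ∑ β, c β * contactDeriv θ x (P β) W := by
  simp only [contactDeriv_eq, Finset.sum_mul, mul_assoc]
  rw [Finset.sum_comm]
  simp only [Finset.mul_sum]

theorem ComplexFrame.contactDeriv_sub_contactDeriv {x₀ : EuclideanSpace ℝ (Fin m)}
    (Z : ComplexFrame n m r x₀) (i j k : FrameIdx n) :
    contactDeriv (fun l => Z.covec l k x₀) x₀ (fun s => Z.vec i s x₀) (Z.vec j) -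
      contactDeriv (fun l => Z.covec l k x₀) x₀ (fun s => Z.vec j s x₀) (Z.vec i) =
        Z.structFun i j k x₀ := by
  simp only [contactDeriv, ComplexFrame.structFun, ← Finset.sum_sub_distrib, ← sub_mul]

/-- The transversal component of the bracket of two fields that are combinations of the frame. -/
theorem ComplexFrame.contactDeriv_bracket {x₀ : EuclideanSpace ℝ (Fin m)}
    (Z : ComplexFrame n m r x₀) (hr : ∞ ≤ r) (p q : Bool)
    {V W : Fin m → EuclideanSpace ℝ (Fin m) → ℂ} {c d : Fin n → EuclideanSpace ℝ (Fin m) → ℂ}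
    (hc : ∀ β, DifferentiableAt ℝ (c β) x₀) (hd : ∀ β, DifferentiableAt ℝ (d β) x₀)
    (hV : ∀ᶠ y in 𝓝 x₀, ∀ l, V l y = ∑ β, c β y * Z.vec (some (p, β)) l y)
    (hW : ∀ᶠ y in 𝓝 x₀, ∀ l, W l y = ∑ β, d β y * Z.vec (some (q, β)) l y) :
    contactDeriv (fun l => Z.covec l none x₀) x₀ (fun s => V s x₀) W -
      contactDeriv (fun l => Z.covec l none x₀) x₀ (fun s => W s x₀) V =
        ∑ α, ∑ β, c α x₀ * d β x₀ * Z.structFun (some (p, α)) (some (q, β)) none x₀ := by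
  have hZ : ∀ i l, DifferentiableAt ℝ (Z.vec i l) x₀ := fun i l =>
    ((Z.smooth_vec i l).differentiableAt hr).self_of_nhds
  have hθ : ∀ p β, ∑ l, Z.vec (some (p, β)) l x₀ * Z.covec l none x₀ = 0 := fun p β => by
    simpa using Z.vec_covec.self_of_nhds (some (p, β)) none
  have hV' : (fun s => V s x₀) = fun s => ∑ β, c β x₀ * Z.vec (some (p, β)) s x₀ :=
    funext hV.self_of_nhds
  have hW' : (fun s => W s x₀) = fun s => ∑ β, d β x₀ * Z.vec (some (q, β)) s x₀ :=
    funext hW.self_of_nhds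
  rw [contactDeriv_sum_right _ _ hd (fun β => hZ _) (hθ q) hW,
    contactDeriv_sum_right _ _ hc (fun β => hZ _) (hθ p) hV, hV', hW']
  simp only [contactDeriv_sum_left _ _ fun β s => Z.vec (some (_, β)) s x₀,
    ← Z.contactDeriv_sub_contactDeriv, Finset.mul_sum, mul_sub, Finset.sum_sub_distrib]
  congr 1
  · rw [Finset.sum_comm]
    exact Finset.sum_congr rfl fun α _ => Finset.sum_congr rfl fun β _ => by ring
  · exact Finset.sum_congr rfl fun α _ => Finset.sum_congr rfl fun β _ => by ring

end ContactDeriv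

/-! ### Levi nondegeneracy as nonvanishing of a determinant -/

section Levi

variable {n m : ℕ} {r : WithTop ℕ∞} {M : Type*} [TopologicalSpace M]
  [ChartedSpace (EuclideanSpace ℝ (Fin m)) M] [IsManifold (𝓡 m) ∞ M]
  {S : AlmostCRStructure m r M} {p₀ : M}

theorem differentiableAt_chartField {V : ∀ q : M, TangentSpace (𝓡 m) q}
    (hV : ∀ᶠ q in 𝓝 p₀, ContMDiffAt (𝓡 m) (𝓡 m).tangent ∞
      (fun q => (⟨q, V q⟩ : TangentBundle (𝓡 m) M)) q) :
    DifferentiableAt ℝ (chartField m p₀ V) (chartAt _ p₀ p₀) := by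
  have : IsManifold (𝓡 m) (∞ + 1) M := ‹IsManifold (𝓡 m) ∞ M›
  exact ((smoothNearAt_chartField hV).differentiableAt le_rfl).self_of_nhds

/-- A complex vector field in the chart at `p₀`. -/
def ComplexVectorField.inChart (X : ComplexVectorField m M) (p₀ : M) :
    Fin m → EuclideanSpace ℝ (Fin m) → ℂ :=
  complexField (chartField m p₀ X.re) (chartField m p₀ X.im)

theorem ComplexVectorField.differentiableAt_inChart {X : ComplexVectorField m M}
    (hX : X.SmoothNear p₀) (l : Fin m) :
    DifferentiableAt ℝ (X.inChart p₀ l) (chartAt _ p₀ p₀) := by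
  exact (hasFDerivAt_complexField (differentiableAt_chartField (hX.mono fun q hq => hq.1))
    (differentiableAt_chartField (hX.mono fun q hq => hq.2)) l).differentiableAt

theorem ComplexVectorField.inChart_conj (X : ComplexVectorField m M) (l : Fin m)
    (y : EuclideanSpace ℝ (Fin m)) :
    X.conj.inChart p₀ l y = (starRingEnd ℂ) (X.inChart p₀ l y) := by
  simp [inChart, complexField, conj, chartField]

/-- The transversal component of the bracket of two complex vector fields, in the chart. -/
theorem ComplexVectorField.contactDeriv_bracket (θ : Fin m → ℂ) {X Y : ComplexVectorField m M}
    (hX : X.SmoothNear p₀) (hY : Y.SmoothNear p₀) :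
    contactDeriv θ (chartAt _ p₀ p₀) (fun s => X.inChart p₀ s (chartAt _ p₀ p₀)) (Y.inChart p₀) -
      contactDeriv θ (chartAt _ p₀ p₀) (fun s => Y.inChart p₀ s (chartAt _ p₀ p₀)) (X.inChart p₀) =
    ∑ l, ((chartDeriv m p₀ p₀ ((X.bracket Y).re p₀) l : ℂ) +
      Complex.I * (chartDeriv m p₀ p₀ ((X.bracket Y).im p₀) l : ℂ)) * θ l := by
  simp only [inChart]
  rw [contactDeriv_sub_contactDeriv θ
    (differentiableAt_chartField (hX.mono fun q hq => hq.1))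
    (differentiableAt_chartField (hX.mono fun q hq => hq.2))
    (differentiableAt_chartField (hY.mono fun q hq => hq.1))
    (differentiableAt_chartField (hY.mono fun q hq => hq.2))]
  simp only [bracket, map_sub, map_add, mlieBracket_eq_lieBracket]

/-- `(s + it)(X - iY)` has real part `sX + tY` and imaginary part `tX - sY`. -/
theorem AdaptedFrame.inChart_eq_sum (A : AdaptedFrame S n p₀) {X : ComplexVectorField m M} {q : M}
    (hq : q ∈ (chartAt (EuclideanSpace ℝ (Fin m)) p₀).source) {s t : Fin n → ℝ}
    (hre : X.re q = ∑ β, (s β • A.X β q + t β • A.Y β q))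
    (him : X.im q = ∑ β, (t β • A.X β q - s β • A.Y β q)) (l : Fin m) :
    X.inChart p₀ l (chartAt _ p₀ q) = ∑ β, ((s β : ℂ) + Complex.I * t β) *
      A.frame.toComplex.vec (some (false, β)) l (chartAt _ p₀ q) := by
  simp only [ComplexVectorField.inChart, complexField, chartField_chartAt _ _ hq, hre, him,
    RealFrame.toComplex, RealFrame.cvec, A.vec_false, A.vec_true, map_sum, map_add, map_sub,
    map_smul, WithLp.ofLp_sum, Finset.sum_apply, PiLp.add_apply, PiLp.sub_apply, PiLp.smul_apply,
    smul_eq_mul, Complex.ofReal_sum, Complex.ofReal_add, Complex.ofReal_sub, Complex.ofReal_mul,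
    Finset.mul_sum, ← Finset.sum_add_distrib, RealFrame.unit, cond_false]
  refine Finset.sum_congr rfl fun β _ => ?_
  linear_combination (chartDeriv m p₀ q (A.Y β q) l : ℂ) * t β * Complex.I_mul_I

/-- The coefficients are obtained by pairing with the dual coframe, hence are differentiable; that
they suffice is pointwise linear algebra. -/
theorem AlmostCRStructure.exists_inChart_eq (A : AdaptedFrame S n p₀) (hS : S.IsHypersurfaceType)
    (hn : 2 * n + 1 = m) (hr : ∞ ≤ r) {X : ComplexVectorField m M} (hX : S.IsSection10Near X p₀) :
    ∃ c : Fin n → EuclideanSpace ℝ (Fin m) → ℂ,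
      (∀ β, DifferentiableAt ℝ (c β) (chartAt _ p₀ p₀)) ∧
      ∀ᶠ y in 𝓝 (chartAt (EuclideanSpace ℝ (Fin m)) p₀ p₀), ∀ l,
        X.inChart p₀ l y = ∑ β, c β y * A.frame.toComplex.vec (some (false, β)) l y := by
  refine ⟨fun β y => ∑ l, X.inChart p₀ l y * A.frame.toComplex.covec l (some (false, β)) y,
    fun β => DifferentiableAt.fun_sum fun l _ =>
      (ComplexVectorField.differentiableAt_inChart hX.1 l).fun_mul
      ((A.frame.toComplex.smooth_covec l _).differentiableAt hr).self_of_nhds, ?_⟩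
  have hs : ∀ᶠ q in 𝓝 p₀, q ∈ (chartAt (EuclideanSpace ℝ (Fin m)) p₀).source :=
    chart_source_mem_nhds _ _
  filter_upwards [(tendsto_chartAt_symm p₀).eventually (hs.and (hX.2.and
    (A.horizontal.and (A.exists_coeff hS hn)))), A.frame.toComplex.vec_covec,
    chart_target_mem_nhds (EuclideanSpace ℝ (Fin m)) p₀] with y h h₄ hy
  have hy' := (chartAt (EuclideanSpace ℝ (Fin m)) p₀).right_inv hy
  generalize (chartAt (EuclideanSpace ℝ (Fin m)) p₀).symm y = q at h hy'
  subst hy'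
  obtain ⟨hq, h₁, h₂, h₃⟩ := h
  obtain ⟨hre, him⟩ := (S.mem_H10_iff _ _).1 h₁
  obtain ⟨s, t, hst⟩ := h₃ ⟨_, hre⟩
  have key := A.inChart_eq_sum hq hst (him.trans (by
    rw [S.J_sum h₂ s t ⟨_, hre⟩ hst, ← Finset.sum_neg_distrib]
    exact Finset.sum_congr rfl fun β _ => neg_sub _ _))
  intro l
  rw [key]
  refine Finset.sum_congr rfl fun β _ => congrArg (· * _) ?_
  simp only [key, Finset.sum_mul, mul_assoc]
  rw [Finset.sum_comm]
  simp only [← Finset.mul_sum, h₄]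
  simp

theorem AdaptedFrame.mem_H_of_sum_covec (A : AdaptedFrame S n p₀) {w : TangentSpace (𝓡 m) p₀}
    (hw : ∑ l, chartDeriv m p₀ p₀ w l * A.frame.covec l none (chartAt _ p₀ p₀) = 0) :
    w ∈ S.H p₀ := by
  have hp := mem_chart_source (EuclideanSpace ℝ (Fin m)) p₀
  let g : FrameIdx n → ℝ := fun i =>
    ∑ l, chartDeriv m p₀ p₀ w l * A.frame.covec l i (chartAt _ p₀ p₀)
  have h : chartDeriv m p₀ p₀ w = ∑ i, g i • A.frame.vec i (chartAt _ p₀ p₀) := by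
    ext l
    simp only [WithLp.ofLp_sum, Finset.sum_apply, PiLp.smul_apply, smul_eq_mul, g, Finset.sum_mul,
      mul_assoc]
    rw [Finset.sum_comm]
    simp [← Finset.mul_sum, A.frame.covec_vec.self_of_nhds]
  have h₀ : g none = 0 := hw
  have h₁ : chartDeriv m p₀ p₀ w = chartDeriv m p₀ p₀
      (∑ α, (g (some (false, α)) • A.X α p₀ + g (some (true, α)) • A.Y α p₀)) := by
    rw [h, sum_frameIdx false, h₀]
    simp only [A.vec_false, A.vec_true, chartField_chartAt _ _ hp, map_sum, map_add, map_smul,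
      Bool.not_false, Finset.sum_add_distrib]
    simp
  rw [chartDeriv_injective hp h₁]
  refine Submodule.sum_mem _ fun α _ => ?_
  obtain ⟨hX, hY⟩ := A.horizontal.self_of_nhds α
  rw [hY]
  exact add_mem (Submodule.smul_mem _ _ hX) (Submodule.smul_mem _ _ (Subtype.coe_prop _))

/-- The section of `H^{1,0}` with constant coefficients in an adapted frame. -/
def AdaptedFrame.constSection (A : AdaptedFrame S n p₀) (s t : Fin n → ℝ) :
    ComplexVectorField m M where
  re q := ∑ β, (s β • A.X β q + t β • A.Y β q)
  im q := ∑ β, (t β • A.X β q - s β • A.Y β q)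

theorem AdaptedFrame.isSection10Near_constSection (A : AdaptedFrame S n p₀) (hr : ∞ ≤ r)
    (s t : Fin n → ℝ) : S.IsSection10Near (A.constSection s t) p₀ := by
  constructor
  · filter_upwards [A.smooth_X, A.smooth_Y] with q hX hY
    have : IsManifold (𝓡 m) (∞ + 1) M := ‹IsManifold (𝓡 m) ∞ M›
    have := TangentBundle.contMDiffVectorBundle (I := 𝓡 m) (M := M) (n := ∞)
    refine ⟨?_, ?_⟩
    · exact ContMDiffAt.sum_section (s := Finset.univ)
        (t := fun β q => s β • A.X β q + t β • A.Y β q) fun β _ =>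
          ((hX β).of_le hr).const_smul_section.add_section ((hY β).of_le hr).const_smul_section
    · exact ContMDiffAt.sum_section (s := Finset.univ)
        (t := fun β q => t β • A.X β q - s β • A.Y β q) fun β _ =>
          ((hX β).of_le hr).const_smul_section.sub_section ((hY β).of_le hr).const_smul_section
  · filter_upwards [A.horizontal] with q h
    have hre : (A.constSection s t).re q ∈ S.H q := by
      refine Submodule.sum_mem (t := Finset.univ) (f := fun β => s β • A.X β q + t β • A.Y β q) _
        fun α _ => ?_
      obtain ⟨hX, hY⟩ := h α
      rw [hY]
      exact add_mem (Submodule.smul_mem _ _ hX) (Submodule.smul_mem _ _ (Subtype.coe_prop _))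
    refine (S.mem_H10_iff _ _).2 ⟨hre, ?_⟩
    rw [S.J_sum h s t ⟨_, hre⟩ rfl, ← Finset.sum_neg_distrib]
    simp only [neg_sub]
    rfl

theorem AdaptedFrame.exists_eval_constSection (A : AdaptedFrame S n p₀)
    (hS : S.IsHypersurfaceType) (hn : 2 * n + 1 = m) (ξ : S.H10 p₀) :
    ∃ s t, (A.constSection s t).eval p₀ = ξ := by
  have h := ξ.2
  rw [← tensor_re_add_im (ξ : ℂ ⊗[ℝ] TangentSpace (𝓡 m) p₀), S.mem_H10_iff] at h
  obtain ⟨ha, hb⟩ := h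
  obtain ⟨s, t, hst⟩ := (A.exists_coeff hS hn).self_of_nhds ⟨_, ha⟩
  refine ⟨s, t, ?_⟩
  rw [← tensor_re_add_im (ξ : ℂ ⊗[ℝ] TangentSpace (𝓡 m) p₀), hb,
    S.J_sum A.horizontal.self_of_nhds s t ⟨_, ha⟩ hst, ← Finset.sum_neg_distrib]
  simp only [neg_sub]
  rw [ComplexVectorField.eval]
  congr 2
  exact hst.symm

/-- Every `(1,0)`-vector extends with constant coefficients in an adapted frame, so the default zero
field in `extend` is never taken. -/
theorem AlmostCRStructure.extend_spec (A : AdaptedFrame S n p₀) (hS : S.IsHypersurfaceType)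
    (hn : 2 * n + 1 = m) (hr : ∞ ≤ r) (ξ : S.H10 p₀) :
    S.IsSection10Near (S.extend p₀ ξ) p₀ ∧ (S.extend p₀ ξ).eval p₀ = ξ := by
  have h : ∃ X : ComplexVectorField m M, S.IsSection10Near X p₀ ∧ X.eval p₀ = ξ := by
    obtain ⟨s, t, h⟩ := A.exists_eval_constSection hS hn ξ
    exact ⟨_, A.isSection10Near_constSection hr s t, h⟩
  rw [extend, dif_pos h]
  exact h.choose_spec

/-- A kernel vector `v` of the matrix gives `ξ = ∑ v̄_β Z_β` with `ℒ(ξ, ·) = 0`: the `T`-component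
of `[X̄, Y]` at `p₀` is the bilinear expression in the structure functions, by tensoriality, for any
sections `X, Y`. -/
theorem AlmostCRStructure.det_structFun_ne_zero (A : AdaptedFrame S n p₀)
    (hS : S.IsHypersurfaceType) (hn : 2 * n + 1 = m) (hr : ∞ ≤ r)
    (hL : ∀ ξ : S.H10 p₀, (∀ η : S.H10 p₀, S.leviForm p₀ ξ η = 0) → ξ = 0) :
    (Matrix.of fun α β => A.frame.toComplex.structFun (some (false, α)) (some (true, β)) none
      (chartAt (EuclideanSpace ℝ (Fin m)) p₀ p₀)).det ≠ 0 := by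
  intro hdet
  obtain ⟨v, hv, hKv⟩ := Matrix.exists_mulVec_eq_zero_iff.2 hdet
  have hp := mem_chart_source (EuclideanSpace ℝ (Fin m)) p₀
  -- The coefficients are conjugated because the Levi form is conjugate-linear in its first
  -- argument.
  let X₀ := A.constSection (fun β => (v β).re) fun β => -(v β).im
  let ξ : S.H10 p₀ := ⟨X₀.eval p₀, (A.isSection10Near_constSection hr _ _).2.self_of_nhds⟩
  have hX₀ : ∀ l, X₀.inChart p₀ l (chartAt _ p₀ p₀) = ∑ β, (starRingEnd ℂ) (v β) *
      A.frame.toComplex.vec (some (false, β)) l (chartAt _ p₀ p₀) := fun l => by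
    rw [A.inChart_eq_sum hp (X := X₀) rfl rfl]
    refine Finset.sum_congr rfl fun β _ => congrArg (· * _) ?_
    apply Complex.ext <;> simp
  have hdual := A.frame.toComplex.vec_covec.self_of_nhds
  have h₂ : ∀ (a : Fin n → ℂ) (β : Fin n), ∑ l, (∑ γ, a γ * A.frame.toComplex.vec (some (false, γ)) l
      (chartAt _ p₀ p₀)) * A.frame.toComplex.covec l (some (false, β)) (chartAt _ p₀ p₀) =
      a β := fun a β => by
    simp only [Finset.sum_mul, mul_assoc]
    rw [Finset.sum_comm]
    simp only [← Finset.mul_sum, hdual]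
    simp
  have hξ : ξ = 0 := by
    refine hL ξ fun η => ?_
    obtain ⟨hX, hXe⟩ := S.extend_spec A hS hn hr ξ
    obtain ⟨hY, -⟩ := S.extend_spec A hS hn hr η
    obtain ⟨c, hc, hXc⟩ := S.exists_inChart_eq A hS hn hr hX
    obtain ⟨d, hd, hYd⟩ := S.exists_inChart_eq A hS hn hr hY
    rw [leviForm]
    generalize S.extend p₀ ξ = X at *
    generalize S.extend p₀ η = Y at *
    obtain ⟨e₁, e₂⟩ := tensor_ext (hXe : X.eval p₀ = X₀.eval p₀)
    -- The section picked by `extend` need not be `X₀`, but it agrees with it at `p₀`, which fixes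
    -- its coefficients there.
    have hcv : ∀ β, c β (chartAt _ p₀ p₀) = (starRingEnd ℂ) (v β) := fun β => by
      have h₁ : ∀ l, ∑ β, c β (chartAt _ p₀ p₀) *
          A.frame.toComplex.vec (some (false, β)) l (chartAt _ p₀ p₀) =
          ∑ β, (starRingEnd ℂ) (v β) *
            A.frame.toComplex.vec (some (false, β)) l (chartAt _ p₀ p₀) := fun l => by
        rw [← hX₀, ← hXc.self_of_nhds]
        simp only [ComplexVectorField.inChart, complexField, chartField_chartAt _ _ hp, e₁, e₂]
      rw [← h₂ (fun β => c β (chartAt _ p₀ p₀)), ← h₂ (fun β => (starRingEnd ℂ) (v β))]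
      simp only [h₁]
    have hXc' : ∀ᶠ y in 𝓝 (chartAt (EuclideanSpace ℝ (Fin m)) p₀ p₀), ∀ l,
        X.conj.inChart p₀ l y = ∑ β, (starRingEnd ℂ) (c β y) *
          A.frame.toComplex.vec (some (true, β)) l y := by
      filter_upwards [hXc, A.frame.toComplex.conj_vec] with y hy hc l
      rw [ComplexVectorField.inChart_conj, hy, map_sum]
      refine Finset.sum_congr rfl fun β _ => ?_
      rw [map_mul, hc]
      rfl
    have hXs : X.conj.SmoothNear p₀ := hX.1.mono fun q hq => ⟨hq.1, hq.2.neg_section⟩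
    have hbr := ComplexVectorField.contactDeriv_bracket
      (fun l => A.frame.toComplex.covec l none (chartAt _ p₀ p₀)) hXs hY.1
    rw [A.frame.toComplex.contactDeriv_bracket hr true false
      (fun β => (hc β).star) hd hXc' hYd] at hbr
    have hzero : ∑ α, ∑ β, (starRingEnd ℂ) (c α (chartAt _ p₀ p₀)) * d β (chartAt _ p₀ p₀) *
        A.frame.toComplex.structFun (some (true, α)) (some (false, β)) none (chartAt _ p₀ p₀) =
          0 := by
      have h₁ : ∀ β, ∑ α, A.frame.toComplex.structFun (some (false, β)) (some (true, α)) none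
          (chartAt _ p₀ p₀) * v α = 0 := fun β => congrFun hKv β
      rw [Finset.sum_comm]
      refine Finset.sum_eq_zero fun β _ => ?_
      have h₂ := congrArg (- d β (chartAt _ p₀ p₀) * ·) (h₁ β)
      simp only [mul_zero, Finset.mul_sum] at h₂
      rw [← h₂]
      refine Finset.sum_congr rfl fun α _ => ?_
      rw [A.frame.toComplex.structFun_antisymm (some (true, α)), hcv, Complex.conj_conj]
      ring
    replace hbr := hzero.symm.trans hbr
    have hre : (X.conj.bracket Y).re p₀ ∈ S.H p₀ := by
      refine A.mem_H_of_sum_covec ?_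
      have := congrArg Complex.re hbr
      simpa [RealFrame.toComplex, RealFrame.ccovec] using this.symm
    have him : (X.conj.bracket Y).im p₀ ∈ S.H p₀ := by
      refine A.mem_H_of_sum_covec ?_
      have := congrArg Complex.im hbr
      simpa [RealFrame.toComplex, RealFrame.ccovec] using this.symm
    rw [ComplexVectorField.eval, (Submodule.mkQ_apply _ _).trans
      ((Submodule.Quotient.mk_eq_zero _).2 (S.mem_complexH hre him)), smul_zero]
  obtain ⟨e₁, e₂⟩ := tensor_ext (a := X₀.re p₀) (b := X₀.im p₀) (a' := 0) (b' := 0)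
    ((congrArg Subtype.val hξ).trans (by simp))
  refine hv (funext fun β => ?_)
  have h₃ := h₂ (fun β => (starRingEnd ℂ) (v β)) β
  simp only [← hX₀, ComplexVectorField.inChart, complexField, chartField_chartAt _ _ hp, e₁,
    e₂] at h₃
  simpa using h₃.symm

end Levi

/-! ### Third derivatives -/

section ThirdDerivative

variable {E F : Type*} [NormedAddCommGroup E] [NormedSpace ℝ E] [NormedAddCommGroup F]
  [NormedSpace ℝ F] {f : E → F} {x : E}

theorem iteratedFDeriv_two_comp_swap (h : ContDiffAt ℝ ∞ f x) (v : Fin 2 → E) :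
    iteratedFDeriv ℝ 2 f x (v ∘ Equiv.swap 0 1) = iteratedFDeriv ℝ 2 f x v := by
  have := h.isSymmSndFDerivAt (by simpa using ENat.LEInfty.out)
  rw [iteratedFDeriv_two_apply, iteratedFDeriv_two_apply]
  exact this.eq _ _

/-- Adjacent transpositions generate the permutations. Swapping the first two arguments is symmetry
of the second derivative of `fderiv ℝ f`; swapping the last two is the derivative of the symmetry of
the second derivative at nearby points. -/
theorem iteratedFDeriv_three_comp_perm (h : ∀ᶠ y in 𝓝 x, ContDiffAt ℝ ∞ f y) (v : Fin 3 → E)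
    (σ : Equiv.Perm (Fin 3)) :
    iteratedFDeriv ℝ 3 f x (v ∘ σ) = iteratedFDeriv ℝ 3 f x v := by
  have hx := h.self_of_nhds
  have h₁ : ∀ v : Fin 3 → E,
      iteratedFDeriv ℝ 3 f x (v ∘ Equiv.swap 0 1) = iteratedFDeriv ℝ 3 f x v := fun v => by
    have e : ∀ w : Fin 3 → E, iteratedFDeriv ℝ 3 f x w =
        iteratedFDeriv ℝ 2 (fderiv ℝ f) x (Fin.init w) (w (Fin.last 2)) :=
      fun w => iteratedFDeriv_succ_apply_right w
    rw [e, e, ← iteratedFDeriv_two_comp_swap (hx.fderiv_right (m := ∞) (by simp)) (Fin.init v)]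
    congr 1
    congr 1
    ext i
    fin_cases i <;> rfl
  have h₂ : ∀ v : Fin 3 → E,
      iteratedFDeriv ℝ 3 f x (v ∘ Equiv.swap 1 2) = iteratedFDeriv ℝ 3 f x v := fun v => by
    rw [iteratedFDeriv_succ_apply_left, iteratedFDeriv_succ_apply_left]
    have hd : DifferentiableAt ℝ (iteratedFDeriv ℝ 2 f) x :=
      (hx.iteratedFDeriv_right (m := 1) (i := 2)
        (by exact_mod_cast (ENat.LEInfty.out : (3 : ℕ∞ω) ≤ ∞))).differentiableAt (by simp)
    have e : ∀ w : Fin 2 → E, ∀ u, fderiv ℝ (iteratedFDeriv ℝ 2 f) x u w =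
        fderiv ℝ (fun y => iteratedFDeriv ℝ 2 f y w) x u := fun w u => by
      let ev := ContinuousMultilinearMap.apply ℝ (fun _ : Fin 2 => E) F w
      have := (ev.hasFDerivAt.comp x hd.hasFDerivAt).fderiv
      exact (congrArg (fun L : E →L[ℝ] F => L u) this).symm
    have e' : (fun y => iteratedFDeriv ℝ 2 f y (Fin.tail (v ∘ Equiv.swap 1 2))) =ᶠ[𝓝 x]
        fun y => iteratedFDeriv ℝ 2 f y (Fin.tail v) := by
      filter_upwards [h] with y hy
      rw [← iteratedFDeriv_two_comp_swap hy (Fin.tail v)]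
      congr 1
      ext i
      fin_cases i <;> rfl
    rw [e, e, e'.fderiv_eq]
    rfl
  have hσ : σ ∈ Submonoid.closure
      (Set.range fun i : Fin 2 => Equiv.swap i.castSucc i.succ) := by
    rw [Equiv.Perm.mclosure_swap_castSucc_succ]; trivial
  induction hσ using Submonoid.closure_induction generalizing v with
  | mem τ hτ =>
    obtain ⟨i, rfl⟩ := hτ
    fin_cases i
    · exact h₁ v
    · exact h₂ v
  | one => rfl
  | mul σ τ _ _ hσ hτ => exact (hτ (v ∘ σ)).trans (hσ v)

/-- The derivatives of order less than the degree of a homogeneous polynomial vanish at `0`. -/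
theorem ContinuousMultilinearMap.iteratedFDeriv_comp_diagonal_zero {n i : ℕ} (C : E [×n]→L[ℝ] F)
    (hi : i < n) : iteratedFDeriv ℝ i (fun y => C fun _ => y) 0 = 0 := by
  let g : E →L[ℝ] (Fin n → E) := ContinuousLinearMap.pi fun _ => ContinuousLinearMap.id ℝ E
  change iteratedFDeriv ℝ i (C ∘ g) 0 = 0
  rw [ContinuousLinearMap.iteratedFDeriv_comp_right _ C.contDiff _ le_rfl, C.iteratedFDeriv_eq]
  ext v
  simp only [ContinuousMultilinearMap.iteratedFDeriv,
    ContinuousMultilinearMap.compContinuousLinearMap_apply, sum_apply,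
    ContinuousMultilinearMap.iteratedFDerivComponent_apply, Set.mem_range, Pi.compRightL_apply]
  refine Finset.sum_eq_zero fun e _ => ?_
  obtain ⟨j, hj⟩ : ∃ j, ∀ i, e i ≠ j := by
    by_contra! hc
    have := Fintype.card_le_of_surjective e hc
    simp only [Fintype.card_fin] at this
    omega
  refine C.map_coord_zero j ?_
  rw [dif_neg (by simpa using hj)]
  simp

/-- The symmetrization of a trilinear map. -/
def symmetrize (C : E [×3]→L[ℝ] F) : E [×3]→L[ℝ] F :=
  (6⁻¹ : ℝ) • ∑ σ : Equiv.Perm (Fin 3), C.domDomCongr σ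

theorem symmetrize_eq_self {C : E [×3]→L[ℝ] F}
    (hC : ∀ v, ∀ σ : Equiv.Perm (Fin 3), C (v ∘ σ) = C v) : symmetrize C = C := by
  ext v
  have h : ∀ σ : Equiv.Perm (Fin 3), C (fun i => v (σ i)) = C v := hC v
  simp [symmetrize, h, Fintype.card_perm, Nat.factorial, ← Nat.cast_smul_eq_nsmul ℝ, smul_smul]

theorem contDiff_symmetrize {r : WithTop ℕ∞} :
    ContDiff ℝ r (symmetrize : (E [×3]→L[ℝ] F) → E [×3]→L[ℝ] F) :=
  (ContDiff.sum fun (σ : Equiv.Perm (Fin 3)) _ => (ContinuousMultilinearMap.domDomCongrₗᵢ ℝ E F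
    σ).toContinuousLinearEquiv.contDiff).const_smul (6⁻¹ : ℝ)

theorem contDiff_cubic (C : E [×3]→L[ℝ] F) (x : E) :
    ContDiff ℝ ∞ (fun y => (6⁻¹ : ℝ) • C fun _ => y - x) :=
  contDiff_const.smul (C.contDiff.comp (contDiff_pi.2 fun _ => contDiff_id.sub contDiff_const))

theorem iteratedFDeriv_cubic_eq (C : E [×3]→L[ℝ] F) (x : E) (i : ℕ) :
    iteratedFDeriv ℝ i (fun y => (6⁻¹ : ℝ) • C fun _ => y - x) x =
      (6⁻¹ : ℝ) • iteratedFDeriv ℝ i (fun y => C fun _ => y) 0 := by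
  have hC : ContDiff ℝ i fun y : E => C fun _ => y := C.contDiff.comp (contDiff_pi.2 fun _ => contDiff_id)
  rw [iteratedFDeriv_comp_sub i x (f := fun y => (6⁻¹ : ℝ) • C fun _ => y), sub_self]
  exact iteratedFDeriv_const_smul_apply hC.contDiffAt

theorem iteratedFDeriv_cubic (C : E [×3]→L[ℝ] F) (x : E) :
    iteratedFDeriv ℝ 3 (fun y => (6⁻¹ : ℝ) • C fun _ => y - x) x = symmetrize C := by
  rw [iteratedFDeriv_cubic_eq]
  ext v
  simp [symmetrize, ContinuousMultilinearMap.iteratedFDeriv_comp_diagonal]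

theorem iteratedFDeriv_cubic_of_lt (C : E [×3]→L[ℝ] F) (x : E) {i : ℕ} (hi : i < 3) :
    iteratedFDeriv ℝ i (fun y => (6⁻¹ : ℝ) • C fun _ => y - x) x = 0 := by
  rw [iteratedFDeriv_cubic_eq, C.iteratedFDeriv_comp_diagonal_zero hi, smul_zero]

/-- A smooth map can be changed to have any symmetric third derivative, with the same derivatives of
lower order. -/
theorem exists_contDiffAt_iteratedFDeriv_three (h : ∀ᶠ y in 𝓝 x, ContDiffAt ℝ ∞ f y)
    (C : E [×3]→L[ℝ] F) : ∃ g : E → F, (∀ᶠ y in 𝓝 x, ContDiffAt ℝ ∞ g y) ∧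
      (∀ i < 3, iteratedFDeriv ℝ i g x = iteratedFDeriv ℝ i f x) ∧
      iteratedFDeriv ℝ 3 g x = symmetrize C := by
  -- A cubic correction, with `6 = 3!`: its derivatives of order below three vanish at `x`, and its
  -- third derivative is the symmetrization of the required difference.
  let q : E → F := fun y => (6⁻¹ : ℝ) • (C - iteratedFDeriv ℝ 3 f x) fun _ => y - x
  have hq : ContDiff ℝ ∞ q := contDiff_cubic _ x
  have hadd : ∀ i : ℕ, iteratedFDeriv ℝ i (f + q) x =
      iteratedFDeriv ℝ i f x + iteratedFDeriv ℝ i q x := fun i =>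
    iteratedFDeriv_add_apply (h.self_of_nhds.of_le (by simpa using ENat.LEInfty.out))
      (hq.contDiffAt.of_le (by simpa using ENat.LEInfty.out))
  refine ⟨f + q, h.mono fun y hy => hy.add hq.contDiffAt, fun i hi => ?_, ?_⟩
  · rw [hadd, iteratedFDeriv_cubic_of_lt _ x hi, add_zero]
  · have h₁ : symmetrize (C - iteratedFDeriv ℝ 3 f x) =
        symmetrize C - symmetrize (iteratedFDeriv ℝ 3 f x) := by
      ext v
      simp [symmetrize, smul_sub]
    rw [hadd, iteratedFDeriv_cubic, h₁,
      symmetrize_eq_self (C := iteratedFDeriv ℝ 3 f x) fun v σ => iteratedFDeriv_three_comp_perm h v σ]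
    abel

end ThirdDerivative

/-! ### Derivatives of compositions -/

section Composition

variable {E F G : Type*} [NormedAddCommGroup E] [NormedSpace ℝ E] [NormedAddCommGroup F]
  [NormedSpace ℝ F] [NormedAddCommGroup G] [NormedSpace ℝ G]

/-- By the formula of Faà di Bruno, derivatives of a composite up to order `k` depend only on
derivatives up to order `k` of the factors. -/
theorem iteratedFDeriv_comp_congr {k : ℕ} {φ φ' : F → G} {f f' : E → F} {x : E}
    (hφ : ContDiffAt ℝ ∞ φ (f x)) (hf : ContDiffAt ℝ ∞ f x) (hφ' : ContDiffAt ℝ ∞ φ' (f' x))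
    (hf' : ContDiffAt ℝ ∞ f' x)
    (h : ∀ i ≤ k, iteratedFDeriv ℝ i φ (f x) = iteratedFDeriv ℝ i φ' (f' x))
    (h' : ∀ i ≤ k, iteratedFDeriv ℝ i f x = iteratedFDeriv ℝ i f' x) {i : ℕ} (hi : i ≤ k) :
    iteratedFDeriv ℝ i (φ ∘ f) x = iteratedFDeriv ℝ i (φ' ∘ f') x := by
  rw [iteratedFDeriv_comp hφ hf (i := i) (by simpa using ENat.LEInfty.out),
    iteratedFDeriv_comp hφ' hf' (i := i) (by simpa using ENat.LEInfty.out)]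
  simp only [FormalMultilinearSeries.taylorComp]
  refine Finset.sum_congr rfl fun c _ => ?_
  have h₁ := h c.length (c.length_le.trans hi)
  have h₂ : (fun j => iteratedFDeriv ℝ (c.partSize j) f x) =
      fun j => iteratedFDeriv ℝ (c.partSize j) f' x :=
    funext fun j => h' _ ((c.partSize_le j).trans hi)
  exact congrArg₂ c.compAlongOrderedFinpartition h₁ h₂

end Composition

/-! ### Jets of local diffeomorphisms -/

section JetSpaces

variable {m : ℕ} {M M' : Type*}
  [TopologicalSpace M] [ChartedSpace (EuclideanSpace ℝ (Fin m)) M]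
  [TopologicalSpace M'] [ChartedSpace (EuclideanSpace ℝ (Fin m)) M']

theorem IsLocalDiffeomorphAt.eventually_contMDiffAt {f : M → M'} {p : M}
    (hf : IsLocalDiffeomorphAt (𝓡 m) (𝓡 m) ∞ f p) :
    ∀ᶠ q in 𝓝 p, ContMDiffAt (𝓡 m) (𝓡 m) ∞ f q := by
  obtain ⟨Φ, hp, h⟩ := hf
  filter_upwards [Φ.open_source.mem_nhds hp] with q hq
  exact IsLocalDiffeomorphAt.contMDiffAt ⟨Φ, hq, h⟩

/-- The inverse function theorem. -/
theorem isLocalDiffeomorphAt_of_hasFDerivAt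
    {g : EuclideanSpace ℝ (Fin m) → EuclideanSpace ℝ (Fin m)} {x : EuclideanSpace ℝ (Fin m)}
    (hg : ∀ᶠ y in 𝓝 x, ContDiffAt ℝ ∞ g y)
    {B : EuclideanSpace ℝ (Fin m) ≃L[ℝ] EuclideanSpace ℝ (Fin m)}
    (hB : HasFDerivAt g (B : EuclideanSpace ℝ (Fin m) →L[ℝ] EuclideanSpace ℝ (Fin m)) x) :
    IsLocalDiffeomorphAt (𝓡 m) (𝓡 m) ∞ g x := by
  have hx := hg.self_of_nhds
  let φ := hx.toOpenPartialHomeomorph g hB (by simp)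
  have hinv : ∀ᶠ y in 𝓝 x, fderiv ℝ g y ∈
      Set.range ((↑) : (EuclideanSpace ℝ (Fin m) ≃L[ℝ] EuclideanSpace ℝ (Fin m)) →
        EuclideanSpace ℝ (Fin m) →L[ℝ] EuclideanSpace ℝ (Fin m)) :=
    (hx.fderiv_right (m := 0) (by simp)).continuousAt.eventually_mem
      (by rw [hB.fderiv]; exact B.nhds)
  obtain ⟨U, hU, hUo, hxU⟩ := eventually_nhds_iff.1 (hg.and hinv)
  let ψ := φ.restrOpen U hUo
  refine ⟨⟨ψ.toPartialEquiv, ψ.open_source, ψ.open_target, fun y hy => ?_, fun y hy => ?_⟩, ?_, ?_⟩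
  · exact (hU y hy.2).1.contMDiffAt.contMDiffWithinAt
  · obtain ⟨h₁, B', h₂⟩ := hU _ (ψ.map_target hy).2
    have h₃ : HasFDerivAt ψ (B' : EuclideanSpace ℝ (Fin m) →L[ℝ] EuclideanSpace ℝ (Fin m))
        (ψ.symm y) := by
      rw [h₂]
      exact (h₁.differentiableAt (by simp)).hasFDerivAt
    exact (ψ.contDiffAt_symm hy h₃ h₁).contMDiffAt.contMDiffWithinAt
  · exact ⟨hx.mem_toOpenPartialHomeomorph_source hB (by simp), hxU⟩
  · exact fun _ _ => rfl

variable [IsManifold (𝓡 m) ∞ M] [IsManifold (𝓡 m) ∞ M']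
  {e : OpenPartialHomeomorph M (EuclideanSpace ℝ (Fin m))}
  {e' : OpenPartialHomeomorph M' (EuclideanSpace ℝ (Fin m))}

theorem isLocalDiffeomorphAt_chart (he : e ∈ atlas (EuclideanSpace ℝ (Fin m)) M) {p : M}
    (hp : p ∈ e.source) : IsLocalDiffeomorphAt (𝓡 m) (𝓡 m) ∞ e p :=
  PartialDiffeomorph.isLocalDiffeomorphAt _ _ _
    ⟨e.toPartialEquiv, e.open_source, e.open_target,
      contMDiffOn_of_mem_maximalAtlas (IsManifold.subset_maximalAtlas he),
      contMDiffOn_symm_of_mem_maximalAtlas (IsManifold.subset_maximalAtlas he)⟩ hp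

theorem isLocalDiffeomorphAt_chart_symm (he : e ∈ atlas (EuclideanSpace ℝ (Fin m)) M)
    {x : EuclideanSpace ℝ (Fin m)} (hx : x ∈ e.target) :
    IsLocalDiffeomorphAt (𝓡 m) (𝓡 m) ∞ e.symm x :=
  PartialDiffeomorph.isLocalDiffeomorphAt _ _ _
    ⟨e.symm.toPartialEquiv, e.open_target, e.open_source,
      contMDiffOn_symm_of_mem_maximalAtlas (IsManifold.subset_maximalAtlas he),
      contMDiffOn_of_mem_maximalAtlas (IsManifold.subset_maximalAtlas he)⟩ hx

theorem IsLocalDiffeomorphAt.inCharts {f : M → M'} {p : M}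
    (hf : IsLocalDiffeomorphAt (𝓡 m) (𝓡 m) ∞ f p)
    (he : e ∈ atlas (EuclideanSpace ℝ (Fin m)) M)
    (he' : e' ∈ atlas (EuclideanSpace ℝ (Fin m)) M') (hp : p ∈ e.source)
    (hq : f p ∈ e'.source) : IsLocalDiffeomorphAt (𝓡 m) (𝓡 m) ∞ (e' ∘ f ∘ e.symm) (e p) := by
  have h₁ := isLocalDiffeomorphAt_chart_symm he (e.map_source hp)
  have h₂ : IsLocalDiffeomorphAt (𝓡 m) (𝓡 m) ∞ (f ∘ e.symm) (e p) :=
    h₁.comp (𝓡 m) M' (by rwa [e.left_inv hp])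
  exact h₂.comp (𝓡 m) _ (isLocalDiffeomorphAt_chart he' (by simpa [e.left_inv hp] using hq))

theorem IsLocalDiffeomorphAt.exists_hasFDerivAt
    {g : EuclideanSpace ℝ (Fin m) → EuclideanSpace ℝ (Fin m)} {x : EuclideanSpace ℝ (Fin m)}
    (hg : IsLocalDiffeomorphAt (𝓡 m) (𝓡 m) ∞ g x) :
    ∃ B : EuclideanSpace ℝ (Fin m) ≃L[ℝ] EuclideanSpace ℝ (Fin m),
      HasFDerivAt g (B : EuclideanSpace ℝ (Fin m) →L[ℝ] EuclideanSpace ℝ (Fin m)) x := by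
  refine ⟨hg.mfderivToContinuousLinearEquiv (by simp), ?_⟩
  have := (hg.mdifferentiableAt (by simp)).differentiableAt.hasFDerivAt
  rwa [← mfderiv_eq_fderiv] at this

theorem eventually_contDiffAt_of_isLocalDiffeomorphAt
    {g : EuclideanSpace ℝ (Fin m) → EuclideanSpace ℝ (Fin m)} {x : EuclideanSpace ℝ (Fin m)}
    (hg : IsLocalDiffeomorphAt (𝓡 m) (𝓡 m) ∞ g x) : ∀ᶠ y in 𝓝 x, ContDiffAt ℝ ∞ g y :=
  hg.eventually_contMDiffAt.mono fun _ h => h.contDiffAt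

/-- Jets that agree in one pair of charts agree. -/
theorem jetSetoid_of_taylorCoord_eq {k : ℕ} {a b : PointedLocalDiffeo m M M'}
    (he : e ∈ atlas (EuclideanSpace ℝ (Fin m)) M)
    (he' : e' ∈ atlas (EuclideanSpace ℝ (Fin m)) M') (ha : a.point ∈ e.source)
    (ha' : a.toFun a.point ∈ e'.source) (hb : b.point ∈ e.source)
    (hb' : b.toFun b.point ∈ e'.source)
    (h : taylorCoord k e e' a.point a.toFun = taylorCoord k e e' b.point b.toFun) :
    jetSetoid m M M' k a b := by
  obtain ⟨p, f, hf⟩ := a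
  obtain ⟨q, g, hg⟩ := b
  dsimp only at *
  obtain rfl : p = q := e.injOn ha hb (congrArg Prod.fst h)
  have hD : ∀ i ≤ k, iteratedFDeriv ℝ i (e' ∘ f ∘ e.symm) (e p) =
      iteratedFDeriv ℝ i (e' ∘ g ∘ e.symm) (e p) := fun i hi =>
    congrFun (congrArg Prod.snd h) ⟨i, Nat.lt_succ_of_le hi⟩
  have hval : (e' ∘ f ∘ e.symm) (e p) = (e' ∘ g ∘ e.symm) (e p) := by
    have := congrArg (fun T => T 0) (hD 0 (Nat.zero_le _))
    simpa only [iteratedFDeriv_zero_apply] using this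
  have hfg : f p = g p := by
    refine e'.injOn ha' hb' ?_
    simpa [e.left_inv ha] using hval
  refine ⟨rfl, hfg, fun d hd d' hd' hp hp' => Prod.ext rfl (funext fun i => ?_)⟩
  dsimp only [taylorCoord] at hp hp' ⊢
  -- Changing charts composes with transition maps on both sides.
  have hsplit : ∀ f : M → M', f p ∈ e'.source → ContMDiffAt (𝓡 m) (𝓡 m) ∞ f p →
      d' ∘ f ∘ d.symm =ᶠ[𝓝 (d p)]
        (d' ∘ e'.symm) ∘ (e' ∘ f ∘ e.symm) ∘ (e ∘ d.symm) := fun f hfp hf => by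
    have h₁ : Tendsto d.symm (𝓝 (d p)) (𝓝 p) := by
      have := d.symm.continuousAt (x := d p) (d.map_source hp)
      rwa [ContinuousAt, d.left_inv hp] at this
    filter_upwards [h₁.eventually (e.open_source.mem_nhds ha),
      h₁.eventually (hf.continuousAt (e'.open_source.mem_nhds hfp))] with y hy hy'
    simp only [Function.comp_apply]
    rw [e.left_inv hy, e'.left_inv hy']
  have hφ : ContDiffAt ℝ ∞ (e ∘ d.symm) (d p) :=
    contDiffAt_atlas_comp (f := id) contMDiffAt_id hd he hp ha
  have hψ : ContDiffAt ℝ ∞ (d' ∘ e'.symm) (e' (f p)) :=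
    contDiffAt_atlas_comp (f := id) contMDiffAt_id he' hd' ha' hp'
  have hfc := contDiffAt_atlas_comp hf.contMDiffAt he he' ha ha'
  have hgc := contDiffAt_atlas_comp hg.contMDiffAt he he' ha hb'
  have hep : (e ∘ d.symm) (d p) = e p := by simp [d.left_inv hp]
  have hefp : ((e' ∘ f ∘ e.symm) ∘ (e ∘ d.symm)) (d p) = e' (f p) := by
    simp [d.left_inv hp, e.left_inv ha]
  have hegp : ((e' ∘ g ∘ e.symm) ∘ (e ∘ d.symm)) (d p) = e' (f p) := by
    simp [d.left_inv hp, e.left_inv ha, hfg]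
  have hi : (i : ℕ) ≤ k := Nat.le_of_lt_succ i.2
  rw [(Filter.EventuallyEq.iteratedFDeriv ℝ (hsplit f ha' hf.contMDiffAt) i).self_of_nhds,
    (Filter.EventuallyEq.iteratedFDeriv ℝ (hsplit g hb' hg.contMDiffAt) i).self_of_nhds]
  rw [← hep] at hfc hgc hD
  refine iteratedFDeriv_comp_congr (k := k) (by rwa [hefp]) (hfc.comp _ hφ) (by rwa [hegp])
    (hgc.comp _ hφ) (fun i _ => by rw [hefp, hegp]) (fun i hi => ?_) hi
  exact iteratedFDeriv_comp_congr (k := k) hfc hφ hgc hφ hD (fun _ _ => rfl) hi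

namespace InvJet

theorem coord_fst {k : ℕ} (he : e ∈ atlas (EuclideanSpace ℝ (Fin m)) M)
    (he' : e' ∈ atlas (EuclideanSpace ℝ (Fin m)) M') {Λ : InvJet m M M' k}
    (hΛ : Λ ∈ coordDomain k e e') : (coord e e' Λ).1 = e Λ.source := by
  obtain ⟨a, rfl⟩ := Quotient.exists_rep Λ
  exact congrArg Prod.fst (coord_mk e he e' he' a hΛ.1 hΛ.2)

theorem coord_snd_zero {k : ℕ} (he : e ∈ atlas (EuclideanSpace ℝ (Fin m)) M)
    (he' : e' ∈ atlas (EuclideanSpace ℝ (Fin m)) M') {Λ : InvJet m M M' k}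
    (hΛ : Λ ∈ coordDomain k e e') : (coord e e' Λ).2 0 0 = e' Λ.target := by
  obtain ⟨a, rfl⟩ := Quotient.exists_rep Λ
  rw [coord_mk e he e' he' a hΛ.1 hΛ.2]
  have h : e.symm (e a.point) = a.point := e.left_inv hΛ.1
  exact congrArg (fun q => e' (a.toFun q)) h

theorem coord_injOn {k : ℕ} (he : e ∈ atlas (EuclideanSpace ℝ (Fin m)) M)
    (he' : e' ∈ atlas (EuclideanSpace ℝ (Fin m)) M') :
    Set.InjOn (coord e e') (coordDomain (M := M) (M' := M') k e e') := by
  intro Λ hΛ Λ' hΛ' h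
  obtain ⟨a, rfl⟩ := Quotient.exists_rep Λ
  obtain ⟨b, rfl⟩ := Quotient.exists_rep Λ'
  rw [coord_mk e he e' he' a hΛ.1 hΛ.2, coord_mk e he e' he' b hΛ'.1 hΛ'.2] at h
  exact Quotient.sound (jetSetoid_of_taylorCoord_eq he he' hΛ.1 hΛ.2 hΛ'.1 hΛ'.2 h)

end InvJet

/-- The coordinates of the `3`-jet with given `2`-jet and third derivative. -/
def jetProlong (lam : JetCoord m 2)
    (C : EuclideanSpace ℝ (Fin m) [×3]→L[ℝ] EuclideanSpace ℝ (Fin m)) : JetCoord m 3 :=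
  (lam.1, Fin.snoc (α := fun i : Fin 4 =>
    EuclideanSpace ℝ (Fin m) [×(i : ℕ)]→L[ℝ] EuclideanSpace ℝ (Fin m)) lam.2 C)

theorem jetProlong_last (lam : JetCoord m 2)
    (C : EuclideanSpace ℝ (Fin m) [×3]→L[ℝ] EuclideanSpace ℝ (Fin m)) :
    (jetProlong lam C).2 (Fin.last 3) = C :=
  Fin.snoc_last (α := fun i : Fin 4 =>
    EuclideanSpace ℝ (Fin m) [×(i : ℕ)]→L[ℝ] EuclideanSpace ℝ (Fin m)) C lam.2

theorem jetProlong_castSucc (lam : JetCoord m 2)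
    (C : EuclideanSpace ℝ (Fin m) [×3]→L[ℝ] EuclideanSpace ℝ (Fin m)) (i : Fin 3) :
    (jetProlong lam C).2 i.castSucc = lam.2 i :=
  Fin.snoc_castSucc (α := fun i : Fin 4 =>
    EuclideanSpace ℝ (Fin m) [×(i : ℕ)]→L[ℝ] EuclideanSpace ℝ (Fin m)) C lam.2 i

theorem taylorCoord_three_eq {f : M → M'} {p : M} {lam : JetCoord m 2}
    {C : EuclideanSpace ℝ (Fin m) [×3]→L[ℝ] EuclideanSpace ℝ (Fin m)}
    (h : taylorCoord 2 e e' p f = lam)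
    (hC : iteratedFDeriv ℝ 3 (e' ∘ f ∘ e.symm) (e p) = C) :
    taylorCoord 3 e e' p f = jetProlong lam C := by
  subst h hC
  refine Prod.ext rfl (funext fun i => ?_)
  induction i using Fin.lastCases with
  | last => exact (jetProlong_last _ _).symm
  | cast i => exact (jetProlong_castSucc (taylorCoord 2 e e' p f) _ i).symm

theorem contDiffOn_jetProlong {r : WithTop ℕ∞} {W : Set (JetCoord m 2)}
    {G : JetCoord m 2 → EuclideanSpace ℝ (Fin m) [×3]→L[ℝ] EuclideanSpace ℝ (Fin m)}
    (hG : ContDiffOn ℝ r G W) : ContDiffOn ℝ r (fun lam => jetProlong lam (G lam)) W := by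
  refine contDiff_fst.contDiffOn.prodMk (contDiffOn_pi.2 fun i => ?_)
  induction i using Fin.lastCases with
  | last => exact hG.congr fun lam _ => jetProlong_last lam (G lam)
  | cast i =>
    exact ((contDiff_pi.1 contDiff_snd i).contDiffOn (s := W)).congr
      fun lam _ => jetProlong_castSucc lam (G lam) i

/-- A third-order component comes from a jet only if it is symmetric, hence the symmetrization.
Adding a cubic term to a representative realises it; the first derivative is unchanged, so the new
map is still a local diffeomorphism. -/
theorem InvJet.exists_coord_eq_jetProlong (he : e ∈ atlas (EuclideanSpace ℝ (Fin m)) M)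
    (he' : e' ∈ atlas (EuclideanSpace ℝ (Fin m)) M') {Λ : InvJet m M M' 2}
    (hΛ : Λ ∈ coordDomain 2 e e')
    (C : EuclideanSpace ℝ (Fin m) [×3]→L[ℝ] EuclideanSpace ℝ (Fin m)) :
    ∃ Λ₃ : InvJet m M M' 3, Λ₃ ∈ coordDomain 3 e e' ∧
      coord e e' Λ₃ = jetProlong (coord e e' Λ) (symmetrize C) := by
  obtain ⟨⟨p, f, hf⟩, rfl⟩ := Quotient.exists_rep Λ
  have hp : p ∈ e.source := hΛ.1
  have hq : f p ∈ e'.source := hΛ.2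
  rw [coord_mk e he e' he' _ hp hq]
  have hloc := hf.inCharts he he' hp hq
  obtain ⟨g, hg, hg₁, hg₂⟩ := exists_contDiffAt_iteratedFDeriv_three
    (eventually_contDiffAt_of_isLocalDiffeomorphAt hloc) C
  obtain ⟨B, hB⟩ := hloc.exists_hasFDerivAt
  have hgp : g (e p) = e' (f p) := by
    have := congrArg (fun T => T 0) (hg₁ 0 (by simp))
    simpa only [iteratedFDeriv_zero_apply, Function.comp_apply, e.left_inv hp] using this
  have hgB : HasFDerivAt g (B : EuclideanSpace ℝ (Fin m) →L[ℝ] EuclideanSpace ℝ (Fin m)) (e p) := by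
    have h₁ : fderiv ℝ g (e p) = B := by
      rw [← hB.fderiv]
      ext1 v
      have := congrArg (fun T => T (fun _ => v)) (hg₁ 1 (by simp))
      simpa only [iteratedFDeriv_one_apply] using this
    rw [← h₁]
    exact (hg.self_of_nhds.differentiableAt (by simp)).hasFDerivAt
  have hgloc := isLocalDiffeomorphAt_of_hasFDerivAt hg hgB
  have hnew : IsLocalDiffeomorphAt (𝓡 m) (𝓡 m) ∞ (e'.symm ∘ g ∘ e) p :=
    ((isLocalDiffeomorphAt_chart he hp).comp (𝓡 m) _ hgloc).comp (𝓡 m) _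
      (isLocalDiffeomorphAt_chart_symm he' (by
        simpa [hgp] using e'.map_source hq))
  have hq' : (e'.symm ∘ g ∘ e) p ∈ e'.source := by
    simpa [hgp, e'.left_inv hq] using hq
  refine ⟨Quotient.mk _ ⟨p, e'.symm ∘ g ∘ e, hnew⟩, ⟨hp, hq'⟩, ?_⟩
  have hev : e' ∘ (e'.symm ∘ g ∘ e) ∘ e.symm =ᶠ[𝓝 (e p)] g := by
    have ht : e'.target ∈ 𝓝 (g (e p)) :=
      e'.open_target.mem_nhds (hgp ▸ e'.map_source hq)
    filter_upwards [e.open_target.mem_nhds (e.map_source hp),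
      hg.self_of_nhds.continuousAt ht] with y hy hy'
    simp only [Function.comp_apply]
    rw [e.right_inv hy, e'.right_inv hy']
  rw [coord_mk e he e' he' _ hp hq']
  refine taylorCoord_three_eq (Prod.ext rfl (funext fun i => ?_)) ?_
  · exact (Filter.EventuallyEq.iteratedFDeriv ℝ hev i).self_of_nhds.trans (hg₁ i i.2)
  · exact (Filter.EventuallyEq.iteratedFDeriv ℝ hev 3).self_of_nhds.trans hg₂

end JetSpaces

end

end

/-! ### Assembly of the complete system on jet spaces -/

theorem AlmostCRStructure.exists_crDim {m : ℕ} {r : WithTop ℕ∞} {M : Type*} [TopologicalSpace M]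
    [ChartedSpace (EuclideanSpace ℝ (Fin m)) M] [IsManifold (𝓡 m) ∞ M]
    (S : AlmostCRStructure m r M) (hS : S.IsHypersurfaceType) (p : M) : ∃ d, 2 * d + 1 = m := by
  obtain ⟨d, b, -⟩ := exists_adapted_basis (S.J p) (S.J_J p)
  refine ⟨d, ?_⟩
  have h₁ := Module.finrank_eq_card_basis b
  have h₂ := hS p
  simp only [Fintype.card_prod, Fintype.card_fin] at h₁
  omega

theorem theorem2p1 {m : ℕ} (hm : 1 < m) {n : WithTop ℕ∞} (hn : n = ∞ ∨ n = ω)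
    {M M' : Type*}
    [TopologicalSpace M] [ChartedSpace (EuclideanSpace ℝ (Fin m)) M]
    [IsManifold (𝓡 m) ∞ M] [IsManifold (𝓡 m) n M]
    [TopologicalSpace M'] [ChartedSpace (EuclideanSpace ℝ (Fin m)) M']
    [IsManifold (𝓡 m) ∞ M'] [IsManifold (𝓡 m) n M']
    (S : AlmostCRStructure m n M) (S' : AlmostCRStructure m n M')
    (hS : S.IsHypersurfaceType) (hS' : S'.IsHypersurfaceType)
    (hSnd : S.IsStronglyNondegenerate) (hSnd' : S'.IsStronglyNondegenerate)
    (p₀ : M) (Λ₀ : InvJet m M M' 2) (hΛ₀ : Λ₀.source = p₀) :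
    ∃ Ω : Set (InvJet m M M' 2), IsOpen Ω ∧ Λ₀ ∈ Ω ∧
      ∃ Φ : InvJet m M M' 2 → InvJet m M M' 3,
        InvJet.ContDiffMapOn n Φ Ω ∧
        ∀ f : PartialDiffeomorph (𝓡 m) (𝓡 m) M M' ∞, IsCRDiffeo S S' f →
          ∀ (p : M) (hp : p ∈ f.source), f.jet 2 p hp ∈ Ω →
            f.jet 3 p hp = Φ (f.jet 2 p hp) := by
  classical
  have hr : ∞ ≤ n := by rcases hn with rfl | rfl <;> simp
  -- Both smoothness classes lose nothing under differentiation, which the closure argument needs.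
  have hr' : n + 1 = n := by rcases hn with rfl | rfl <;> rfl
  have hM : IsManifold (𝓡 m) (n + 1) M := by rw [hr']; infer_instance
  have hM' : IsManifold (𝓡 m) (n + 1) M' := by rw [hr']; infer_instance
  obtain ⟨d, hd⟩ := S.exists_crDim hS p₀
  -- Positive CR dimension: an index `α` is needed to recover `T r`.
  have : NeZero d := ⟨by omega⟩
  set q₀ := Λ₀.target with hq₀
  obtain ⟨A⟩ := S.exists_adaptedFrame hS hd p₀
  obtain ⟨A'⟩ := S'.exists_adaptedFrame hS' hd q₀
  let e := chartAt (EuclideanSpace ℝ (Fin m)) p₀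
  let e' := chartAt (EuclideanSpace ℝ (Fin m)) q₀
  have he : e ∈ atlas (EuclideanSpace ℝ (Fin m)) M := chart_mem_atlas _ _
  have he' : e' ∈ atlas (EuclideanSpace ℝ (Fin m)) M' := chart_mem_atlas _ _
  have hp₀ : p₀ ∈ e.source := mem_chart_source _ _
  have hq₀ : q₀ ∈ e'.source := mem_chart_source _ _
  have hΛ₀e : Λ₀ ∈ InvJet.coordDomain 2 e e' := ⟨by rwa [hΛ₀], hq₀⟩
  have h₁ : (InvJet.coord e e' Λ₀).1 = e p₀ := by rw [InvJet.coord_fst he he' hΛ₀e, hΛ₀]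
  have h₂ : (InvJet.coord e e' Λ₀).2 0 0 = e' q₀ := InvJet.coord_snd_zero he he' hΛ₀e
  have hinv : ∃ B : EuclideanSpace ℝ (Fin m) →L[ℝ] EuclideanSpace ℝ (Fin m),
      B.comp (jetFst (InvJet.coord e e' Λ₀)) = ContinuousLinearMap.id ℝ _ := by
    obtain ⟨a, ha⟩ := Quotient.exists_rep Λ₀
    have hap : a.point ∈ e.source := by rw [← ha] at hΛ₀e; exact hΛ₀e.1
    have haq : a.toFun a.point ∈ e'.source := by rw [← ha] at hΛ₀e; exact hΛ₀e.2
    obtain ⟨B, hB⟩ := (a.isLocalDiffeomorphAt.inCharts he he' hap haq).exists_hasFDerivAt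
    refine ⟨B.symm, ?_⟩
    rw [← ha, InvJet.coord_mk e he e' he' a hap haq]
    have : jetFst (taylorCoord 2 e e' a.point a.toFun) = B := jetFst_coordJet₂.trans hB.fderiv
    rw [this]
    exact B.coe_symm_comp_coe
  obtain ⟨G, hG, hGeq⟩ := exists_third_derivative_eq A.frame.toComplex A'.frame.toComplex
    (InvJet.coord e e' Λ₀) hr hr'.le h₁ h₂ hinv
    (S.det_structFun_ne_zero A hS hd hr (hSnd p₀).1)
  obtain ⟨U, hU, U', hU', hf⟩ := isAdaptedNear_of_isCRDiffeo hS' hd A A'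
  have hU₁ : ∀ᶠ lam : JetCoord m 2 in 𝓝 (InvJet.coord e e' Λ₀), e.symm lam.1 ∈ U := by
    have h : Filter.Tendsto (fun lam : JetCoord m 2 => lam.1) (𝓝 (InvJet.coord e e' Λ₀))
        (𝓝 (e p₀)) := h₁ ▸ continuous_fst.tendsto _
    exact ((tendsto_chartAt_symm p₀).comp h).eventually hU
  have hU₂ : ∀ᶠ lam : JetCoord m 2 in 𝓝 (InvJet.coord e e' Λ₀), e'.symm (lam.2 0 0) ∈ U' := by
    have h : Filter.Tendsto (fun lam : JetCoord m 2 => lam.2 0 0) (𝓝 (InvJet.coord e e' Λ₀))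
        (𝓝 (e' q₀)) := h₂ ▸ (jetVal 0 0).continuous.tendsto (InvJet.coord e e' Λ₀)
    exact ((tendsto_chartAt_symm q₀).comp h).eventually hU'
  obtain ⟨V, hV, hVo, hΛV⟩ := eventually_nhds_iff.1 (hG.and (hGeq.and (hU₁.and hU₂)))
  -- The 3-jet prolonging `Λ` by the symmetrized value of `G`. Outside the coordinate domain any jet
  -- will do; the one of a representative is taken.
  let Φ : InvJet m M M' 2 → InvJet m M M' 3 := fun Λ =>
    if h : Λ ∈ InvJet.coordDomain 2 e e' then
      (InvJet.exists_coord_eq_jetProlong he he' h (G (InvJet.coord e e' Λ))).choose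
    else Quotient.mk _ Λ.out
  have hΦ : ∀ Λ ∈ InvJet.coordDomain 2 e e', Φ Λ ∈ InvJet.coordDomain 3 e e' ∧
      InvJet.coord e e' (Φ Λ) = jetProlong (InvJet.coord e e' Λ)
        (symmetrize (G (InvJet.coord e e' Λ))) := fun Λ hΛ => by
    have h : Φ Λ = (InvJet.exists_coord_eq_jetProlong he he' hΛ
      (G (InvJet.coord e e' Λ))).choose := dif_pos hΛ
    rw [h]
    exact (InvJet.exists_coord_eq_jetProlong he he' hΛ (G (InvJet.coord e e' Λ))).choose_spec
  refine ⟨InvJet.coordDomain 2 e e' ∩ InvJet.coord e e' ⁻¹' V,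
    TopologicalSpace.isOpen_generateFrom_of_mem ⟨e, he, e', he', V, hVo, rfl⟩, ⟨hΛ₀e, hΛV⟩, Φ, ?_,
    fun f hfCR p hp hΩ => ?_⟩
  · intro Λ hΛ
    exact ⟨e, he, e', he', e, he, e', he', V, fun lam => jetProlong lam (symmetrize (G lam)),
      hΛ.1, hVo, hΛ.2, contDiffOn_jetProlong
        (contDiff_symmetrize.comp_contDiffOn fun lam h => (hV lam h).1.contDiffWithinAt),
      fun Λ' _ h _ => hΦ Λ' h⟩
  · obtain ⟨hdom, hΩV⟩ := hΩ
    obtain ⟨h₃, h₄⟩ := hΦ _ hdom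
    have hpe : p ∈ e.source := hdom.1
    have hqe : f p ∈ e'.source := hdom.2
    have h₅ : f.jet 3 p hp ∈ InvJet.coordDomain 3 e e' := ⟨hpe, hqe⟩
    refine InvJet.coord_injOn he he' h₅ h₃ ?_
    have hc : ∀ k, InvJet.coord e e' (f.jet k p hp) = taylorCoord k e e' p f := fun k =>
      InvJet.coord_mk e he e' he' _ hpe hqe
    rw [Set.mem_preimage, hc] at hΩV
    rw [h₄, hc, hc]
    obtain ⟨-, hGf, hUp, hUq⟩ := hV _ hΩV
    have hpU : p ∈ U := by
      have : e.symm (e p) ∈ U := hUp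
      rwa [e.left_inv hpe] at this
    have hqU : f p ∈ U' := by
      have : e'.symm (e' (f (e.symm (e p)))) ∈ U' := hUq
      rwa [e.left_inv hpe, e'.left_inv hqe] at this
    have hD := hGf (e' ∘ f ∘ e.symm, e p) rfl (hf f hfCR p hp hpU hqU)
    refine taylorCoord_three_eq rfl ?_
    -- On the jet of an actual map `G` is a true third derivative, already symmetric, so
    -- symmetrization does nothing.
    rw [← hD, symmetrize_eq_self]
    exact iteratedFDeriv_three_comp_perm (eventually_contDiffAt_of_isLocalDiffeomorphAt
      ((f.isLocalDiffeomorphAt _ _ _ hp).inCharts he he' hpe hqe))
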